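/- Let $M$ be a smooth manifold (finite-dimensional, without boundary, Hausdorff and second countable), and let $$\mathcal{E}:\quad E_{-2}\xrightarrow{\ \pi\ }E_{-1}\xrightarrow{\ \pi\ }E_0,\qquad \pi\circ\pi=0,$$ be a 3-term complex of smooth real vector bundles of finite rank over $M$. **The operators.** A covariant differential operator of $\mathcal{E}$ is a triple $\mathfrak d=(\mathfrak d_0,\mathfrak d_1,\mathfrak d_2)$ of $\mathbb R$-linear maps $\mathfrak d_i:\Gamma(E_{-i})\to\Gamma(E_{-i})$ together with a vector field $X=\mathfrak p(\mathfrak d)$ such that $\mathfrak d_i(fe)=f\,\mathfrak d_i(e)+X(f)\,e$ for all $f\in C^\infty(M)$, $e\in\Gamma(E_{-i})$, $i=0,1,2$. These are the sections of the vector bundle $\mathfrak D(\mathcal{E})=\mathfrak D(E_0)\times_{TM}\mathfrak D(E_{-1})\times_{TM}\mathfrak D(E_{-2})$. Let $\mathcal{D}_\pi$ be the $C^\infty(M)$-module of those $\mathfrak d$ that commute with $\pi$, i.e. $\mathfrak d_0\circ\pi=\pi\circ\mathfrak d_1$ and $\mathfrak d_1\circ\pi=\pi\circ\mathfrak d_2$.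 Assume that the dimension of the space of values $\{\mathfrak d(x):\mathfrak d\in\mathcal{D}_\pi\}\subset\mathfrak D(\mathcal{E})_x$ does not depend on $x\in M$. **Claim.** There is a smooth vector subbundle $\mathfrak D_\pi(\mathcal{E})\subset\mathfrak D(\mathcal{E})$ with $\Gamma(\mathfrak D_\pi(\mathcal{E}))=\mathcal{D}_\pi$. Put $\mathrm{End}^{-1}(\mathcal{E})=\mathrm{Hom}(E_0,E_{-1})\oplus\mathrm{Hom}(E_{-1},E_{-2})$ and $\mathrm{End}^{-2}(\mathcal{E})=\mathrm{Hom}(E_0,E_{-2})$. Then $$(\mathrm{End}^{-2}(\mathcal{E}),\mathrm{End}^{-1}(\mathcal{E}),\mathfrak D_\pi(\mathcal{E}),\mathfrak p,\mathrm d,[\cdot,\cdot]_C)$$ is a strict Lie 3-algebroid, with $\mathfrak D_\pi(\mathcal{E})$, $\mathrm{End}^{-1}(\mathcal{E})$, $\mathrm{End}^{-2}(\mathcal{E})$ in degrees $0,-1,-2$, anchor $\mathfrak p$, with $$l_1=\mathrm d:\qquad \mathrm d\theta=\pi\circ\theta-\theta\circ\pi\ \ (\theta\in\Gamma(\mathrm{End}^{-2}(\mathcal{E}))),\qquad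 \mathrm d\theta=\pi\circ\theta+\theta\circ\pi\ \ (\theta\in\Gamma(\mathrm{End}^{-1}(\mathcal{E}))),$$ and with $l_2=[\cdot,\cdot]_C$ the graded antisymmetric bracket of degree $0$ given, for $\mathfrak d,\mathfrak t\in\Gamma(\mathfrak D_\pi(\mathcal{E}))$, $\theta^i\in\Gamma(\mathrm{End}^{-i}(\mathcal{E}))$ $(i=1,2)$ and $\theta,\vartheta\in\Gamma(\mathrm{End}^{-1}(\mathcal{E}))$, by $$[\mathfrak d,\mathfrak t]_C=\mathfrak d\circ\mathfrak t-\mathfrak t\circ\mathfrak d,\qquad [\mathfrak d,\theta^i]_C=\mathfrak d\circ\theta^i-\theta^i\circ\mathfrak d,\qquad [\theta,\vartheta]_C=\theta\circ\vartheta+\vartheta\circ\theta .$$ **Terminology.** A (split) Lie $n$-algebroid is a graded vector bundle $\mathcal{A}=A_0\oplus A_{-1}\oplus\dots\oplus A_{-n+1}$ over $M$ with a bundle map $a:A_0\to TM$ (the anchor) and graded antisymmetric brackets $l_k$ of degree $2-k$ on $\Gamma(\mathcal{A})$ such that (1) $\Gamma(\mathcal{A})$ is an $L_\infty$-algebra,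 i.e. for all $k\ge 1$ and homogeneous $X_1,\dots,X_k$ $$\sum_{i+j=k+1}(-1)^{i(j-1)}\sum_{\sigma}\mathrm{sgn}(\sigma)\,\varepsilon(\sigma)\,l_j\big(l_i(X_{\sigma(1)},\dots,X_{\sigma(i)}),X_{\sigma(i+1)},\dots,X_{\sigma(k)}\big)=0,$$ where $i,j\ge1$, $\sigma$ runs over the $(i,k-i)$-unshuffles and $\varepsilon(\sigma)$ is the Koszul sign; (2) $l_2(X^0,fX)=f\,l_2(X^0,X)+a(X^0)(f)\,X$ for $X^0\in\Gamma(A_0)$, $X\in\Gamma(\mathcal{A})$, $f\in C^\infty(M)$, and $l_2$ is $C^\infty(M)$-bilinear on pairs of sections of negative degree; (3) $l_k$ is $C^\infty(M)$-multilinear for $k\ne2$. It is strict if $l_k=0$ for all $k\ge 3$. -/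

import Mathlib

open scoped Manifold ContDiff Bundle

universe u v w

/-- A real smooth vector bundle of finite rank over a smooth manifold `M` of dimension `m`
(Mathlib's notion of smooth vector bundle, bundled). -/
structure SmoothVectorBundle (m : ℕ) (M : Type u) [TopologicalSpace M]
    [ChartedSpace (EuclideanSpace ℝ (Fin m)) M] where
  Model : Type v
  Fiber : M → Type v
  [instNormed : NormedAddCommGroup Model]
  [instNormedSpace : NormedSpace ℝ Model]
  [instFiniteDimensional : FiniteDimensional ℝ Model]
  [instAddCommGroup : ∀ x, AddCommGroup (Fiber x)]
  [instModule : ∀ x, Module ℝ (Fiber x)]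
  [instTopology : ∀ x, TopologicalSpace (Fiber x)]
  [instTopologicalAddGroup : ∀ x, IsTopologicalAddGroup (Fiber x)]
  [instContinuousSMul : ∀ x, ContinuousSMul ℝ (Fiber x)]
  [instTotalSpace : TopologicalSpace (Bundle.TotalSpace Model Fiber)]
  [instFiberBundle : FiberBundle Model Fiber]
  [instVectorBundle : VectorBundle ℝ Model Fiber]
  [instSmooth : ContMDiffVectorBundle ∞ Model Fiber (𝓡 m)]

attribute [instance] SmoothVectorBundle.instNormed SmoothVectorBundle.instNormedSpace
  SmoothVectorBundle.instFiniteDimensional SmoothVectorBundle.instAddCommGroup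
  SmoothVectorBundle.instModule SmoothVectorBundle.instTopology
  SmoothVectorBundle.instTopologicalAddGroup SmoothVectorBundle.instContinuousSMul
  SmoothVectorBundle.instTotalSpace SmoothVectorBundle.instFiberBundle
  SmoothVectorBundle.instVectorBundle SmoothVectorBundle.instSmooth

noncomputable section

namespace SmoothVectorBundle

variable {m : ℕ} {M : Type u} [TopologicalSpace M]
  [ChartedSpace (EuclideanSpace ℝ (Fin m)) M]

/-- The space `Γ(V)` of smooth sections. -/
abbrev Sec (V : SmoothVectorBundle.{u, v} m M) : Type (max u v) :=
  ContMDiffSection (𝓡 m) V.Model ∞ V.Fiber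

/-- The bundle `Hom(V, W)`. Its smooth sections are the smooth bundle maps `V ⟶ W` over the
identity of `M`. -/
def hom (V : SmoothVectorBundle.{u, v} m M) (W : SmoothVectorBundle.{u, w} m M) :
    SmoothVectorBundle.{u, max v w} m M where
  Model := V.Model →L[ℝ] W.Model
  Fiber := fun x => V.Fiber x →L[ℝ] W.Fiber x

/-- The direct sum `V ⊕ W`. -/
def sum (V : SmoothVectorBundle.{u, v} m M) (W : SmoothVectorBundle.{u, w} m M) :
    SmoothVectorBundle.{u, max v w} m M where
  Model := V.Model × W.Model
  Fiber := fun x => V.Fiber x × W.Fiber x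
  instTotalSpace := inferInstanceAs (TopologicalSpace
    (Bundle.TotalSpace (V.Model × W.Model) (V.Fiber ×ᵇ W.Fiber)))
  instFiberBundle := inferInstanceAs (FiberBundle (V.Model × W.Model) (V.Fiber ×ᵇ W.Fiber))
  instVectorBundle := inferInstanceAs (VectorBundle ℝ (V.Model × W.Model) (V.Fiber ×ᵇ W.Fiber))
  instSmooth := inferInstanceAs
    (ContMDiffVectorBundle ∞ (V.Model × W.Model) (V.Fiber ×ᵇ W.Fiber) (𝓡 m))

/-- The tangent bundle `TM`. -/
def tangent (m : ℕ) (M : Type u) [TopologicalSpace M]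
    [ChartedSpace (EuclideanSpace ℝ (Fin m)) M] [IsManifold (𝓡 m) ∞ M] :
    SmoothVectorBundle.{u, 0} m M where
  Model := EuclideanSpace ℝ (Fin m)
  Fiber := fun x => TangentSpace (𝓡 m) x

/-- `Γ(V)` is a module over `C^∞(M)`. -/
instance (V : SmoothVectorBundle.{u, v} m M) : Module C^∞⟮𝓡 m, M; ℝ⟯ V.Sec where
  smul f s := ⟨fun x => f x • s x, f.contMDiff.smul_section s.contMDiff⟩
  one_smul s := by ext x; exact one_smul ℝ (s x)
  mul_smul f g s := by ext x; exact mul_smul (f x) (g x) (s x)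
  smul_zero f := by ext x; exact smul_zero (f x)
  smul_add f s t := by ext x; exact smul_add (f x) (s x) (t x)
  add_smul f g s := by ext x; exact add_smul (f x) (g x) (s x)
  zero_smul s := by ext x; exact zero_smul ℝ (s x)

theorem smul_apply (V : SmoothVectorBundle.{u, v} m M) (f : C^∞⟮𝓡 m, M; ℝ⟯) (s : V.Sec) (x : M) :
    (f • s) x = f x • s x := rfl

instance (V : SmoothVectorBundle.{u, v} m M) : SMulCommClass ℝ C^∞⟮𝓡 m, M; ℝ⟯ V.Sec where
  smul_comm r f s := by ext x; exact smul_comm r (f x) (s x)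

/-- The action of a bundle map on sections. -/
def Sec.act {V : SmoothVectorBundle.{u, v} m M} {W : SmoothVectorBundle.{u, w} m M}
    (θ : (V.hom W).Sec) (e : V.Sec) : W.Sec where
  toFun x := (show V.Fiber x →L[ℝ] W.Fiber x from θ x) (e x)
  contMDiff_toFun := ContMDiff.clm_bundle_apply (b := fun x => x) θ.contMDiff e.contMDiff

/-- First component of a section of `V ⊕ W`. -/
def Sec.fst {V : SmoothVectorBundle.{u, v} m M} {W : SmoothVectorBundle.{u, w} m M}
    (θ : (V.sum W).Sec) : V.Sec where
  toFun x := (show V.Fiber x × W.Fiber x from θ x).1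
  contMDiff_toFun := by
    intro x
    have h := (Bundle.contMDiffAt_section (IB := 𝓡 m) (F := V.Model × W.Model)
      (E := V.Fiber ×ᵇ W.Fiber) (n := ∞) x).1 (θ.contMDiff x)
    have h' : ContMDiff 𝓘(ℝ, V.Model × W.Model) 𝓘(ℝ, V.Model) ∞
        (Prod.fst : V.Model × W.Model → V.Model) := contDiff_fst.contMDiff
    exact (Bundle.contMDiffAt_section x).2 (h'.contMDiffAt.comp x h)

/-- Second component of a section of `V ⊕ W`. -/
def Sec.snd {V : SmoothVectorBundle.{u, v} m M} {W : SmoothVectorBundle.{u, w} m M}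
    (θ : (V.sum W).Sec) : W.Sec where
  toFun x := (show V.Fiber x × W.Fiber x from θ x).2
  contMDiff_toFun := by
    intro x
    have h := (Bundle.contMDiffAt_section (IB := 𝓡 m) (F := V.Model × W.Model)
      (E := V.Fiber ×ᵇ W.Fiber) (n := ∞) x).1 (θ.contMDiff x)
    have h' : ContMDiff 𝓘(ℝ, V.Model × W.Model) 𝓘(ℝ, W.Model) ∞
        (Prod.snd : V.Model × W.Model → W.Model) := contDiff_snd.contMDiff
    exact (Bundle.contMDiffAt_section x).2 (h'.contMDiffAt.comp x h)

/-- The derivative `X(f)` of a smooth function along a vector field. -/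
def lieDeriv [IsManifold (𝓡 m) ∞ M] (X : (tangent m M).Sec) (f : C^∞⟮𝓡 m, M; ℝ⟯) :
    C^∞⟮𝓡 m, M; ℝ⟯ where
  val x := mfderiv (𝓡 m) 𝓘(ℝ, ℝ) f x (show TangentSpace (𝓡 m) x from X x)
  property := by
    have h1 : ContMDiff (𝓡 m).tangent 𝓘(ℝ, ℝ).tangent ∞ (tangentMap (𝓡 m) 𝓘(ℝ, ℝ) f) :=
      f.contMDiff.contMDiff_tangentMap (by simp)
    have h2 : ContMDiff (𝓡 m) (𝓡 m).tangent ∞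
      (fun x => (⟨x, X x⟩ : TangentBundle (𝓡 m) M)) := X.contMDiff
    exact contMDiff_snd_tangentBundle_modelSpace ℝ 𝓘(ℝ, ℝ) |>.comp (h1.comp h2)

theorem lieDeriv_add [IsManifold (𝓡 m) ∞ M] (X Y : (tangent m M).Sec) (f : C^∞⟮𝓡 m, M; ℝ⟯) :
    lieDeriv (X + Y) f = lieDeriv X f + lieDeriv Y f := by
  ext x
  exact map_add (mfderiv (𝓡 m) 𝓘(ℝ, ℝ) f x) (show TangentSpace (𝓡 m) x from X x) (Y x)

theorem lieDeriv_zero [IsManifold (𝓡 m) ∞ M] (f : C^∞⟮𝓡 m, M; ℝ⟯) :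
    lieDeriv (0 : (tangent m M).Sec) f = 0 := by
  ext x
  exact map_zero (mfderiv (𝓡 m) 𝓘(ℝ, ℝ) f x)

theorem lieDeriv_smul [IsManifold (𝓡 m) ∞ M] (g : C^∞⟮𝓡 m, M; ℝ⟯) (X : (tangent m M).Sec)
    (f : C^∞⟮𝓡 m, M; ℝ⟯) : lieDeriv (g • X) f = g * lieDeriv X f := by
  ext x
  exact map_smul (mfderiv (𝓡 m) 𝓘(ℝ, ℝ) f x) (g x) (show TangentSpace (𝓡 m) x from X x)

theorem act_add {V : SmoothVectorBundle.{u, v} m M} {W : SmoothVectorBundle.{u, w} m M}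
    (θ : (V.hom W).Sec) (e e' : V.Sec) : θ.act (e + e') = θ.act e + θ.act e' := by
  ext x
  exact map_add (show V.Fiber x →L[ℝ] W.Fiber x from θ x) (e x) (e' x)

theorem act_zero {V : SmoothVectorBundle.{u, v} m M} {W : SmoothVectorBundle.{u, w} m M}
    (θ : (V.hom W).Sec) : θ.act (0 : V.Sec) = 0 := by
  ext x
  exact map_zero (show V.Fiber x →L[ℝ] W.Fiber x from θ x)

theorem act_smul {V : SmoothVectorBundle.{u, v} m M} {W : SmoothVectorBundle.{u, w} m M}
    (θ : (V.hom W).Sec) (f : C^∞⟮𝓡 m, M; ℝ⟯) (e : V.Sec) : θ.act (f • e) = f • θ.act e := by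
  ext x
  exact map_smul (show V.Fiber x →L[ℝ] W.Fiber x from θ x) (f x) (e x)

end SmoothVectorBundle

/-! ### Split Lie `n`-algebroids -/

/-- The Koszul sign `ε(σ)` of a permutation of homogeneous elements `X_i` of degrees `-d i`:
`X_1 ∧ ⋯ ∧ X_k = ε(σ) X_{σ 1} ∧ ⋯ ∧ X_{σ k}` in the free graded commutative algebra. -/
def koszulSign {k : ℕ} (d : Fin k → ℕ) (σ : Equiv.Perm (Fin k)) : ℤ :=
  ∏ p : Fin k × Fin k, if p.1 < p.2 ∧ σ p.2 < σ p.1 then (-1) ^ (d (σ p.1) * d (σ p.2)) else 1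

/-- `σ` is an `(i, k - i)`-unshuffle: `σ 1 < ⋯ < σ i` and `σ (i+1) < ⋯ < σ k`. -/
def IsUnshuffle {k : ℕ} (i : ℕ) (σ : Equiv.Perm (Fin k)) : Prop :=
  ∀ a b : Fin k, a < b → ((b : ℕ) < i ∨ i ≤ (a : ℕ)) → σ a < σ b

/-- The left-hand side of the `k`-th generalized Jacobi identity
`∑_{i + j = k + 1} (-1)^{i (j - 1)} ∑_σ sgn(σ) ε(σ) l_j (l_i (X_{σ 1}, …), X_{σ (i+1)}, …)`
for elements `x` of degrees `-d`. The summation variable `i` is shifted by one, so that the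
inner bracket has arity `i + 1 ≥ 1` and the outer one `j = k - (i + 1) + 1`. -/
def jacobiator {L : Type w} [AddCommGroup L] [Module ℝ L]
    (l : ∀ k : ℕ, MultilinearMap ℝ (fun _ : Fin k => L) L)
    (k : ℕ) (d : Fin k → ℕ) (x : Fin k → L) : L := by
  classical
  exact ∑ i : Fin k, ((-1 : ℤ) ^ (((i : ℕ) + 1) * (k - ((i : ℕ) + 1)))) •
    ∑ σ : Equiv.Perm (Fin k) with IsUnshuffle ((i : ℕ) + 1) σ,
      ((Equiv.Perm.sign σ : ℤ) * koszulSign d σ) •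
        l (k - ((i : ℕ) + 1) + 1)
          (Fin.cons (l ((i : ℕ) + 1) fun a => x (σ ⟨a, by omega⟩))
            (fun b : Fin (k - ((i : ℕ) + 1)) => x (σ ⟨(i : ℕ) + 1 + b, by omega⟩)))

open SmoothVectorBundle in
/-- A split Lie `n`-algebroid structure on the graded vector bundle
`A 0 ⊕ A 1 ⊕ ⋯ ⊕ A (n - 1)`, where `A i` sits in degree `-i`. A section of the graded bundle is a
family of sections; the homogeneous ones are `Pi.single i s` with `s ∈ Γ(A i)`.
The brackets are indexed by all arities `k`, but the degree axiom forces `l k = 0` for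
`k = 0` and for `k > n + 1`. -/
structure SplitLieAlgebroid {m : ℕ} {M : Type u} [TopologicalSpace M]
    [ChartedSpace (EuclideanSpace ℝ (Fin m)) M] [IsManifold (𝓡 m) ∞ M] (n : ℕ) [NeZero n]
    (A : Fin n → SmoothVectorBundle.{u, v} m M) where
  /-- The anchor, a bundle map `A 0 ⟶ TM`. -/
  anchor : ((A 0).hom (tangent m M)).Sec
  /-- The brackets. -/
  l : ∀ k : ℕ, MultilinearMap ℝ (fun _ : Fin k => ∀ i, (A i).Sec) (∀ i, (A i).Sec)
  /-- `l k` has degree `2 - k`. -/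
  degree : ∀ (k : ℕ) (d : Fin k → Fin n) (s : ∀ j, (A (d j)).Sec) (c : Fin n),
    -((c : ℕ) : ℤ) ≠ (∑ j, -((d j : ℕ) : ℤ)) + (2 - (k : ℤ)) →
      l k (fun j => Pi.single (d j) (s j)) c = 0
  /-- `l k` is graded antisymmetric. -/
  antisymm : ∀ (k : ℕ) (d : Fin k → Fin n) (s : ∀ j, (A (d j)).Sec) (σ : Equiv.Perm (Fin k)),
    l k (fun j => Pi.single (d j) (s j)) =
      ((Equiv.Perm.sign σ : ℤ) * koszulSign (fun j => (d j : ℕ)) σ) •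
        l k (fun j => Pi.single (d (σ j)) (s (σ j)))
  /-- The generalized Jacobi identities: `Γ(A)` is an `n`-term `L_∞`-algebra. -/
  jacobi : ∀ (k : ℕ) (d : Fin k → Fin n) (s : ∀ j, (A (d j)).Sec),
    jacobiator l k (fun j => (d j : ℕ)) (fun j => Pi.single (d j) (s j)) = 0
  /-- The Leibniz rule of `l 2` with respect to the anchor. -/
  leibniz : ∀ (X : (A 0).Sec) (f : C^∞⟮𝓡 m, M; ℝ⟯) (i : Fin n) (Y : (A i).Sec),
    l 2 ![Pi.single 0 X, Pi.single i (f • Y)] =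
      f • l 2 ![Pi.single 0 X, Pi.single i Y] + Pi.single i (lieDeriv (Sec.act anchor X) f • Y)
  /-- `l 2` is function linear on pairs of elements of negative degree. -/
  linear_two : ∀ (i j : Fin n), i ≠ 0 → j ≠ 0 →
    ∀ (X : (A i).Sec) (f : C^∞⟮𝓡 m, M; ℝ⟯) (Y : (A j).Sec),
      l 2 ![Pi.single i X, Pi.single j (f • Y)] = f • l 2 ![Pi.single i X, Pi.single j Y]
  /-- `l k` is function linear in each argument for `k ≠ 2`. -/
  linear : ∀ (k : ℕ), k ≠ 2 → ∀ (x : Fin k → ∀ i, (A i).Sec) (j : Fin k) (f : C^∞⟮𝓡 m, M; ℝ⟯),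
    l k (Function.update x j (f • x j)) = f • l k x

/-- A split Lie `n`-algebroid is strict if `l k = 0` for all `k ≥ 3`. -/
def SplitLieAlgebroid.IsStrict {m : ℕ} {M : Type u} [TopologicalSpace M]
    [ChartedSpace (EuclideanSpace ℝ (Fin m)) M] [IsManifold (𝓡 m) ∞ M] {n : ℕ} [NeZero n]
    {A : Fin n → SmoothVectorBundle.{u, v} m M} (S : SplitLieAlgebroid n A) : Prop :=
  ∀ k, 3 ≤ k → S.l k = 0

/-! ### Three-term complexes and their endomorphism Lie 3-algebroid -/

/-- A complex `E₂ ⟶ E₁ ⟶ E₀` of vector bundles over `M`; the bundle `E i` sits in degree `-i`. -/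
structure ThreeTermComplex (m : ℕ) (M : Type u) [TopologicalSpace M]
    [ChartedSpace (EuclideanSpace ℝ (Fin m)) M] where
  E₀ : SmoothVectorBundle.{u, v} m M
  E₁ : SmoothVectorBundle.{u, v} m M
  E₂ : SmoothVectorBundle.{u, v} m M
  /-- The differential `E₁ ⟶ E₀`. -/
  π₁ : (E₁.hom E₀).Sec
  /-- The differential `E₂ ⟶ E₁`. -/
  π₂ : (E₂.hom E₁).Sec
  comp_eq_zero : ∀ e : E₂.Sec, π₁.act (π₂.act e) = 0

namespace ThreeTermComplex

open SmoothVectorBundle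

variable {m : ℕ} {M : Type u} [TopologicalSpace M]
  [ChartedSpace (EuclideanSpace ℝ (Fin m)) M] [IsManifold (𝓡 m) ∞ M]

/-- Quadruples `(X, 𝔡₀, 𝔡₁, 𝔡₂)` of a vector field and `ℝ`-linear operators `𝔡ᵢ` on `Γ(E i)`. -/
abbrev Quad (𝓔 : ThreeTermComplex.{u, v} m M) : Type (max u v) :=
  (tangent m M).Sec × (𝓔.E₀.Sec →ₗ[ℝ] 𝓔.E₀.Sec) × (𝓔.E₁.Sec →ₗ[ℝ] 𝓔.E₁.Sec) ×
    (𝓔.E₂.Sec →ₗ[ℝ] 𝓔.E₂.Sec)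

/-- The covariant differential operators of the complex, that is, the sections of
`𝔇(E₀) ×_{TM} 𝔇(E₁) ×_{TM} 𝔇(E₂)`: operators `𝔡ᵢ` on `Γ(E i)` that satisfy
`𝔡ᵢ (f e) = f 𝔡ᵢ e + X(f) e` for one vector field `X`, the symbol. The symbol is part of the
data; it is determined by the operators unless all three bundles have rank zero. -/
def cdo (𝓔 : ThreeTermComplex.{u, v} m M) : Submodule C^∞⟮𝓡 m, M; ℝ⟯ 𝓔.Quad where
  carrier := {D |
    (∀ (f : C^∞⟮𝓡 m, M; ℝ⟯) (e : 𝓔.E₀.Sec), D.2.1 (f • e) = f • D.2.1 e + lieDeriv D.1 f • e) ∧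
    (∀ (f : C^∞⟮𝓡 m, M; ℝ⟯) (e : 𝓔.E₁.Sec),
      D.2.2.1 (f • e) = f • D.2.2.1 e + lieDeriv D.1 f • e) ∧
    (∀ (f : C^∞⟮𝓡 m, M; ℝ⟯) (e : 𝓔.E₂.Sec),
      D.2.2.2 (f • e) = f • D.2.2.2 e + lieDeriv D.1 f • e)}
  add_mem' := by
    rintro D D' ⟨h0, h1, h2⟩ ⟨h0', h1', h2'⟩
    refine ⟨fun f e => ?_, fun f e => ?_, fun f e => ?_⟩
    · change D.2.1 (f • e) + D'.2.1 (f • e) =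
        f • (D.2.1 e + D'.2.1 e) + lieDeriv (D.1 + D'.1) f • e
      rw [h0, h0', lieDeriv_add, smul_add, add_smul]; abel
    · change D.2.2.1 (f • e) + D'.2.2.1 (f • e) =
        f • (D.2.2.1 e + D'.2.2.1 e) + lieDeriv (D.1 + D'.1) f • e
      rw [h1, h1', lieDeriv_add, smul_add, add_smul]; abel
    · change D.2.2.2 (f • e) + D'.2.2.2 (f • e) =
        f • (D.2.2.2 e + D'.2.2.2 e) + lieDeriv (D.1 + D'.1) f • e
      rw [h2, h2', lieDeriv_add, smul_add, add_smul]; abel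
  zero_mem' := by
    refine ⟨fun f e => ?_, fun f e => ?_, fun f e => ?_⟩ <;> simp [lieDeriv_zero]
  smul_mem' := by
    rintro g D ⟨h0, h1, h2⟩
    refine ⟨fun f e => ?_, fun f e => ?_, fun f e => ?_⟩
    · change g • D.2.1 (f • e) = f • (g • D.2.1 e) + lieDeriv (g • D.1) f • e
      rw [h0, lieDeriv_smul, smul_add, smul_comm g f, mul_smul]
    · change g • D.2.2.1 (f • e) = f • (g • D.2.2.1 e) + lieDeriv (g • D.1) f • e
      rw [h1, lieDeriv_smul, smul_add, smul_comm g f, mul_smul]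
    · change g • D.2.2.2 (f • e) = f • (g • D.2.2.2 e) + lieDeriv (g • D.1) f • e
      rw [h2, lieDeriv_smul, smul_add, smul_comm g f, mul_smul]

/-- `Γ(𝔇_π)`: the covariant differential operators that commute with the differential. -/
def cdoPi (𝓔 : ThreeTermComplex.{u, v} m M) : Submodule C^∞⟮𝓡 m, M; ℝ⟯ 𝓔.Quad where
  carrier := {D | D ∈ 𝓔.cdo ∧
    (∀ e : 𝓔.E₁.Sec, D.2.1 (𝓔.π₁.act e) = 𝓔.π₁.act (D.2.2.1 e)) ∧
    (∀ e : 𝓔.E₂.Sec, D.2.2.1 (𝓔.π₂.act e) = 𝓔.π₂.act (D.2.2.2 e))}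
  add_mem' := by
    rintro D D' ⟨h, h0, h1⟩ ⟨h', h0', h1'⟩
    refine ⟨add_mem h h', fun e => ?_, fun e => ?_⟩
    · change D.2.1 (𝓔.π₁.act e) + D'.2.1 (𝓔.π₁.act e) = 𝓔.π₁.act (D.2.2.1 e + D'.2.2.1 e)
      rw [h0, h0', act_add]
    · change D.2.2.1 (𝓔.π₂.act e) + D'.2.2.1 (𝓔.π₂.act e) = 𝓔.π₂.act (D.2.2.2 e + D'.2.2.2 e)
      rw [h1, h1', act_add]
  zero_mem' := ⟨zero_mem _, fun _ => (act_zero _).symm, fun _ => (act_zero _).symm⟩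
  smul_mem' := by
    rintro g D ⟨h, h0, h1⟩
    refine ⟨Submodule.smul_mem _ g h, fun e => ?_, fun e => ?_⟩
    · change g • D.2.1 (𝓔.π₁.act e) = 𝓔.π₁.act (g • D.2.2.1 e)
      rw [h0, act_smul]
    · change g • D.2.2.1 (𝓔.π₂.act e) = 𝓔.π₂.act (g • D.2.2.2 e)
      rw [h1, act_smul]

/-- The value at `x` of a covariant differential operator, an element of the fibre at `x` of the
bundle `𝔇`: the symbol at `x` and the maps `e ↦ (𝔡ᵢ e) x`. -/
def valueAt (𝓔 : ThreeTermComplex.{u, v} m M) (x : M) (D : 𝓔.Quad) :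
    TangentSpace (𝓡 m) x × (𝓔.E₀.Sec → 𝓔.E₀.Fiber x) × (𝓔.E₁.Sec → 𝓔.E₁.Fiber x) ×
      (𝓔.E₂.Sec → 𝓔.E₂.Fiber x) :=
  (D.1 x, fun e => D.2.1 e x, fun e => D.2.2.1 e x, fun e => D.2.2.2 e x)

/-- The fibre of `𝔇_π` at `x`, inside the fibre of `𝔇`: the values at `x` of the sections of
`𝔇_π`. (The set of these values is a subspace already; the span only packages it as one.) -/
def devPiFiber (𝓔 : ThreeTermComplex.{u, v} m M) (x : M) :
    Submodule ℝ (TangentSpace (𝓡 m) x × (𝓔.E₀.Sec → 𝓔.E₀.Fiber x) ×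
      (𝓔.E₁.Sec → 𝓔.E₁.Fiber x) × (𝓔.E₂.Sec → 𝓔.E₂.Fiber x)) :=
  Submodule.span ℝ (𝓔.valueAt x '' {D | D ∈ 𝓔.cdoPi})

/-- The smooth vector bundle `𝔇_π`, the subbundle of `𝔇` whose sections are the covariant
differential operators that commute with the differential: a smooth vector bundle, a
`C^∞(M)`-linear identification of its sections with `Γ(𝔇_π)` (hence a bundle map to `𝔇`), which
is injective on fibres. -/
structure DevPiBundle (𝓔 : ThreeTermComplex.{u, v} m M) where
  bundle : SmoothVectorBundle.{u, v} m M
  toCdo : bundle.Sec ≃ₗ[C^∞⟮𝓡 m, M; ℝ⟯] 𝓔.cdoPi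
  injective_fiber : ∀ (s : bundle.Sec) (x : M), 𝓔.valueAt x (toCdo s) = 0 → s x = 0

/-- `End⁻¹ = Hom(E₀, E₁) ⊕ Hom(E₁, E₂)`. -/
def endOne (𝓔 : ThreeTermComplex.{u, v} m M) : SmoothVectorBundle.{u, v} m M :=
  (𝓔.E₀.hom 𝓔.E₁).sum (𝓔.E₁.hom 𝓔.E₂)

/-- `End⁻² = Hom(E₀, E₂)`. -/
def endTwo (𝓔 : ThreeTermComplex.{u, v} m M) : SmoothVectorBundle.{u, v} m M :=
  𝓔.E₀.hom 𝓔.E₂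

/-- The action `Γ(E₀) ⟶ Γ(E₁)` of a section of `End⁻¹`. -/
def map₀₁ {𝓔 : ThreeTermComplex.{u, v} m M} (θ : 𝓔.endOne.Sec) (e : 𝓔.E₀.Sec) : 𝓔.E₁.Sec :=
  Sec.act (Sec.fst (V := 𝓔.E₀.hom 𝓔.E₁) (W := 𝓔.E₁.hom 𝓔.E₂) θ) e

/-- The action `Γ(E₁) ⟶ Γ(E₂)` of a section of `End⁻¹`. -/
def map₁₂ {𝓔 : ThreeTermComplex.{u, v} m M} (θ : 𝓔.endOne.Sec) (e : 𝓔.E₁.Sec) : 𝓔.E₂.Sec :=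
  Sec.act (Sec.snd (V := 𝓔.E₀.hom 𝓔.E₁) (W := 𝓔.E₁.hom 𝓔.E₂) θ) e

/-- The action `Γ(E₀) ⟶ Γ(E₂)` of a section of `End⁻²`. -/
def map₀₂ {𝓔 : ThreeTermComplex.{u, v} m M} (θ : 𝓔.endTwo.Sec) (e : 𝓔.E₀.Sec) : 𝓔.E₂.Sec :=
  Sec.act (V := 𝓔.E₀) (W := 𝓔.E₂) θ e

namespace DevPiBundle

variable {𝓔 : ThreeTermComplex.{u, v} m M} (𝔇 : 𝓔.DevPiBundle)

/-- The symbol `𝔭(s)` of a section of `𝔇_π`. -/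
def symbol (s : 𝔇.bundle.Sec) : (tangent m M).Sec := (𝔇.toCdo s : 𝓔.Quad).1

/-- The operator on `Γ(E₀)`. -/
def op₀ (s : 𝔇.bundle.Sec) : 𝓔.E₀.Sec →ₗ[ℝ] 𝓔.E₀.Sec := (𝔇.toCdo s : 𝓔.Quad).2.1

/-- The operator on `Γ(E₁)`. -/
def op₁ (s : 𝔇.bundle.Sec) : 𝓔.E₁.Sec →ₗ[ℝ] 𝓔.E₁.Sec := (𝔇.toCdo s : 𝓔.Quad).2.2.1

/-- The operator on `Γ(E₂)`. -/
def op₂ (s : 𝔇.bundle.Sec) : 𝓔.E₂.Sec →ₗ[ℝ] 𝓔.E₂.Sec := (𝔇.toCdo s : 𝓔.Quad).2.2.2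

/-- The graded vector bundle `𝔇_π ⊕ End⁻¹ ⊕ End⁻²`, in degrees `0`, `-1`, `-2`. -/
def graded : Fin 3 → SmoothVectorBundle.{u, v} m M
  | 0 => 𝔇.bundle
  | 1 => 𝓔.endOne
  | 2 => 𝓔.endTwo

/-- Sections of the graded bundle. -/
abbrev GSec : Type (max u v) := ∀ i, (𝔇.graded i).Sec

/-- A section of `𝔇_π` as a homogeneous section of degree `0`. -/
def in₀ (s : 𝔇.bundle.Sec) : 𝔇.GSec := Pi.single (M := fun i => (𝔇.graded i).Sec) 0 s

/-- A section of `End⁻¹` as a homogeneous section of degree `-1`. -/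
def in₁ (θ : 𝓔.endOne.Sec) : 𝔇.GSec := Pi.single (M := fun i => (𝔇.graded i).Sec) 1 θ

/-- A section of `End⁻²` as a homogeneous section of degree `-2`. -/
def in₂ (θ : 𝓔.endTwo.Sec) : 𝔇.GSec := Pi.single (M := fun i => (𝔇.graded i).Sec) 2 θ

/-- The degree `0` component of a section. -/
def out₀ (z : 𝔇.GSec) : 𝔇.bundle.Sec := z 0

/-- The degree `-1` component of a section. -/
def out₁ (z : 𝔇.GSec) : 𝓔.endOne.Sec := z 1

/-- The degree `-2` component of a section. -/
def out₂ (z : 𝔇.GSec) : 𝓔.endTwo.Sec := z 2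

/-- The structure maps of the split Lie 3-algebroid `S` on `𝔇_π ⊕ End⁻¹ ⊕ End⁻²` are the anchor
`𝔭`, the differential given by (anti)commutation with `π` and the graded commutator bracket, and
`S` is strict. Sections are compared through their action on the sections of the `E i`; the
other brackets of homogeneous sections follow by graded antisymmetry or vanish for degree
reasons. -/
structure IsEndAlgebroid (S : SplitLieAlgebroid 3 𝔇.graded) : Prop where
  strict : S.IsStrict
  /-- The anchor is the symbol map `𝔭`. -/
  anchor : ∀ s : 𝔇.bundle.Sec, Sec.act (V := 𝔇.bundle) S.anchor s = 𝔇.symbol s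
  /-- `d θ = π ∘ θ - θ ∘ π` for `θ ∈ Γ(End⁻²)`. -/
  diff_two : ∀ θ : 𝓔.endTwo.Sec,
    (∀ e, map₀₁ (𝔇.out₁ (S.l 1 ![𝔇.in₂ θ])) e = 𝓔.π₂.act (map₀₂ θ e)) ∧
    (∀ e, map₁₂ (𝔇.out₁ (S.l 1 ![𝔇.in₂ θ])) e = -map₀₂ θ (𝓔.π₁.act e))
  /-- `d θ = π ∘ θ + θ ∘ π` for `θ ∈ Γ(End⁻¹)`. -/
  diff_one : ∀ θ : 𝓔.endOne.Sec,
    𝔇.symbol (𝔇.out₀ (S.l 1 ![𝔇.in₁ θ])) = 0 ∧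
    (∀ e, 𝔇.op₀ (𝔇.out₀ (S.l 1 ![𝔇.in₁ θ])) e = 𝓔.π₁.act (map₀₁ θ e)) ∧
    (∀ e, 𝔇.op₁ (𝔇.out₀ (S.l 1 ![𝔇.in₁ θ])) e =
      𝓔.π₂.act (map₁₂ θ e) + map₀₁ θ (𝓔.π₁.act e)) ∧
    (∀ e, 𝔇.op₂ (𝔇.out₀ (S.l 1 ![𝔇.in₁ θ])) e = map₁₂ θ (𝓔.π₂.act e))
  /-- `[𝔡, 𝔱] = 𝔡 ∘ 𝔱 - 𝔱 ∘ 𝔡` for `𝔡, 𝔱 ∈ Γ(𝔇_π)`, also for the symbols. -/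
  bracket_zero_zero : ∀ s t : 𝔇.bundle.Sec,
    (∀ f, lieDeriv (𝔇.symbol (𝔇.out₀ (S.l 2 ![𝔇.in₀ s, 𝔇.in₀ t]))) f =
      lieDeriv (𝔇.symbol s) (lieDeriv (𝔇.symbol t) f) -
        lieDeriv (𝔇.symbol t) (lieDeriv (𝔇.symbol s) f)) ∧
    (∀ e, 𝔇.op₀ (𝔇.out₀ (S.l 2 ![𝔇.in₀ s, 𝔇.in₀ t])) e =
      𝔇.op₀ s (𝔇.op₀ t e) - 𝔇.op₀ t (𝔇.op₀ s e)) ∧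
    (∀ e, 𝔇.op₁ (𝔇.out₀ (S.l 2 ![𝔇.in₀ s, 𝔇.in₀ t])) e =
      𝔇.op₁ s (𝔇.op₁ t e) - 𝔇.op₁ t (𝔇.op₁ s e)) ∧
    (∀ e, 𝔇.op₂ (𝔇.out₀ (S.l 2 ![𝔇.in₀ s, 𝔇.in₀ t])) e =
      𝔇.op₂ s (𝔇.op₂ t e) - 𝔇.op₂ t (𝔇.op₂ s e))
  /-- `[𝔡, θ] = 𝔡 ∘ θ - θ ∘ 𝔡` for `𝔡 ∈ Γ(𝔇_π)` and `θ ∈ Γ(End⁻¹)`. -/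
  bracket_zero_one : ∀ (s : 𝔇.bundle.Sec) (θ : 𝓔.endOne.Sec),
    (∀ e, map₀₁ (𝔇.out₁ (S.l 2 ![𝔇.in₀ s, 𝔇.in₁ θ])) e =
      𝔇.op₁ s (map₀₁ θ e) - map₀₁ θ (𝔇.op₀ s e)) ∧
    (∀ e, map₁₂ (𝔇.out₁ (S.l 2 ![𝔇.in₀ s, 𝔇.in₁ θ])) e =
      𝔇.op₂ s (map₁₂ θ e) - map₁₂ θ (𝔇.op₁ s e))
  /-- `[𝔡, θ] = 𝔡 ∘ θ - θ ∘ 𝔡` for `𝔡 ∈ Γ(𝔇_π)` and `θ ∈ Γ(End⁻²)`. -/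
  bracket_zero_two : ∀ (s : 𝔇.bundle.Sec) (θ : 𝓔.endTwo.Sec),
    ∀ e, map₀₂ (𝔇.out₂ (S.l 2 ![𝔇.in₀ s, 𝔇.in₂ θ])) e =
      𝔇.op₂ s (map₀₂ θ e) - map₀₂ θ (𝔇.op₀ s e)
  /-- `[θ, η] = θ ∘ η + η ∘ θ` for `θ, η ∈ Γ(End⁻¹)`. -/
  bracket_one_one : ∀ θ η : 𝓔.endOne.Sec,
    ∀ e, map₀₂ (𝔇.out₂ (S.l 2 ![𝔇.in₁ θ, 𝔇.in₁ η])) e =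
      map₁₂ θ (map₀₁ η e) + map₁₂ η (map₀₁ θ e)

end DevPiBundle
end ThreeTermComplex
end

/-! The proof has an analytic half, that `𝔇_π` is a vector bundle, and an algebraic half, that the
brackets satisfy the axioms.

The bundle. Near `x`, pick operators in `Γ(𝔇_π)` whose values at `x` form a basis of the fibre
there. The coefficients, in local frames, of the symbol and of `𝔡ᵢ e` for fixed sections `e` are
functionals on values that vary smoothly along every operator, and they separate values. So the
chosen operators have a dual coframe of such functionals. The matrix pairing the two is smooth and
equals the identity at `x`, hence is invertible near `x`; constant rank then makes the chosen
operators a frame of all nearby fibres. The changes of frame form a smooth cocycle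
(`SpanningFamily.core`). A smooth section of the resulting bundle is locally a combination of
operators with smooth coefficients, so it is again an operator commuting with `π`. Conversely, every
operator in `Γ(𝔇_π)` has smooth coordinates. The fibres are finite-dimensional because a Leibniz
operator at `x` is determined by its symbol and by its values on a frame.

The algebra. Graded sections act on `C^∞(M) ⊕ Γ(E₀) ⊕ Γ(E₁) ⊕ Γ(E₂)`, those of degree `0` and `-2`
by even operators, those of degree `-1` by odd ones, while `π` is an odd operator of square zero.
The action is faithful (`evOp_odOp_ext`), and it turns `d` and `[·,·]_C` into graded commutators in
an associative algebra. There the identity of arity one is `π² = 0`, those of arity two and three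
hold in any associative algebra, and from arity four on every term contains a bracket of arity at
least three (`GradedOperatorModel.jacobiator_eq_zero`).

What remains geometric is that the commutators stay among the sections considered. Symbol terms
cancel in `[𝔡, θ]`, and function-linear maps of sections come from bundle maps (`homOfTensorial`).
The symbol of `[𝔡, 𝔱]` is the Lie bracket of the symbols (`lieDeriv_lieBracket`). -/

noncomputable section

/-! ### Local frames, cut-offs and the locality of first order operators. -/

namespace SmoothVectorBundle

open Filter Topology Bundle

section Frames

variable {m : ℕ} {M : Type u} [TopologicalSpace M]
  [ChartedSpace (EuclideanSpace ℝ (Fin m)) M]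

/-- The local frame at `x` that comes from the preferred trivialization at `x`. -/
def frameAt (V : SmoothVectorBundle.{u, v} m M) (x : M)
    (j : Fin (Module.finrank ℝ V.Model)) (y : M) : V.Fiber y :=
  (trivializationAt V.Model V.Fiber x).localFrame (Module.finBasis ℝ V.Model) j y

/-- The coefficients in the local frame at `x`. -/
def coeffAt (V : SmoothVectorBundle.{u, v} m M) (x : M)
    (j : Fin (Module.finrank ℝ V.Model)) (y : M) : V.Fiber y →ₗ[ℝ] ℝ :=
  (trivializationAt V.Model V.Fiber x).localFrameCoeff (𝓡 m) (Module.finBasis ℝ V.Model) j y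

/-- The domain of the local frame at `x`. -/
def frameDomain (V : SmoothVectorBundle.{u, v} m M) (x : M) : Set M :=
  (trivializationAt V.Model V.Fiber x).baseSet

theorem isOpen_frameDomain (V : SmoothVectorBundle.{u, v} m M) (x : M) :
    IsOpen (V.frameDomain x) :=
  (trivializationAt V.Model V.Fiber x).open_baseSet

theorem mem_frameDomain (V : SmoothVectorBundle.{u, v} m M) (x : M) : x ∈ V.frameDomain x :=
  FiberBundle.mem_baseSet_trivializationAt V.Model V.Fiber x

theorem sum_coeffAt_smul_frameAt (V : SmoothVectorBundle.{u, v} m M) {x y : M}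
    (hy : y ∈ V.frameDomain x) (e : V.Fiber y) :
    ∑ j, V.coeffAt x j y e • V.frameAt x j y = e := by
  classical
  -- The frame expansion speaks of sections but asks for no regularity, so the single vector `e` is
  -- extended by zero.
  let s : ∀ z, V.Fiber z := Function.update 0 y e
  have h := (trivializationAt V.Model V.Fiber x).eq_sum_localFrameCoeff_smul (I := 𝓡 m)
    (b := Module.finBasis ℝ V.Model) (s := s) hy
  simp only [s, Function.update_self] at h
  exact h.symm

theorem contMDiffAt_coeffAt (V : SmoothVectorBundle.{u, v} m M) {x y : M}
    (hy : y ∈ V.frameDomain x) (j : Fin (Module.finrank ℝ V.Model)) {s : ∀ y, V.Fiber y}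
    (hs : ContMDiffAt (𝓡 m) ((𝓡 m).prod 𝓘(ℝ, V.Model)) ∞
      (fun z => TotalSpace.mk' V.Model z (s z)) y) :
    ContMDiffAt (𝓡 m) 𝓘(ℝ, ℝ) ∞ (fun z => V.coeffAt x j z (s z)) y :=
  contMDiffAt_localFrameCoeff (Module.finBasis ℝ V.Model) hy hs j

theorem contMDiffAt_frameAt (V : SmoothVectorBundle.{u, v} m M) {x y : M}
    (hy : y ∈ V.frameDomain x) (j : Fin (Module.finrank ℝ V.Model)) :
    ContMDiffAt (𝓡 m) ((𝓡 m).prod 𝓘(ℝ, V.Model)) ∞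
      (fun z => TotalSpace.mk' V.Model z (V.frameAt x j z)) y :=
  contMDiffAt_localFrame_of_mem ∞ _ (Module.finBasis ℝ V.Model) j hy

theorem sec_sum_apply {ι : Type*} (V : SmoothVectorBundle.{u, v} m M) (t : Finset ι)
    (s : ι → V.Sec) (x : M) : (∑ i ∈ t, s i) x = ∑ i ∈ t, s i x := by
  classical
  induction t using Finset.induction_on with
  | empty => simp
  | insert a t ha ih => rw [Finset.sum_insert ha, Finset.sum_insert ha, ← ih]; rfl

theorem map_sum_of_add {V : SmoothVectorBundle.{u, v} m M} {A : Type*} [AddCommGroup A]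
    {Φ : V.Sec → A} (hadd : ∀ e e' : V.Sec, Φ (e + e') = Φ e + Φ e') {ι : Type*}
    (t : Finset ι) (s : ι → V.Sec) : Φ (∑ i ∈ t, s i) = ∑ i ∈ t, Φ (s i) :=
  map_sum (AddMonoidHom.mk' Φ hadd) s t

variable [IsManifold (𝓡 m) ∞ M] [T2Space M]

/-- A smooth cut-off function, equal to `1` near `x` and supported in a given neighbourhood. -/
theorem exists_cutoff {x : M} {U : Set M} (hU : U ∈ 𝓝 x) :
    ∃ χ : C^∞⟮𝓡 m, M; ℝ⟯, (∀ᶠ y in 𝓝 x, χ y = 1) ∧ tsupport χ ⊆ U := by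
  obtain ⟨f, -, hf⟩ := (SmoothBumpFunction.nhds_basis_tsupport (I := 𝓡 m) x).mem_iff.1 hU
  exact ⟨⟨f, f.contMDiff⟩, f.eventuallyEq_one, hf⟩

/-- A section that is smooth near `x` agrees near `x` with a global smooth section. -/
theorem exists_section_eventuallyEq (V : SmoothVectorBundle.{u, v} m M) {x : M}
    {s : ∀ y, V.Fiber y}
    (hs : ∀ᶠ y in 𝓝 x, ContMDiffAt (𝓡 m) ((𝓡 m).prod 𝓘(ℝ, V.Model)) ∞
      (fun z => TotalSpace.mk' V.Model z (s z)) y) :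
    ∃ σ : V.Sec, ∀ᶠ y in 𝓝 x, σ y = s y := by
  obtain ⟨χ, h1, h2⟩ := exists_cutoff (m := m) hs
  refine ⟨⟨fun y => χ y • s y, fun y => ?_⟩, h1.mono fun y hy => ?_⟩
  · by_cases hy : y ∈ tsupport χ
    · exact ContMDiffAt.smul_section (χ.contMDiff y) (h2 hy)
    · refine (contMDiffAt_zeroSection ℝ V.Fiber (F := V.Model) (IB := 𝓡 m)
        (n := ∞) (x := y)).congr_of_eventuallyEq ?_
      filter_upwards [(isClosed_tsupport χ).isOpen_compl.mem_nhds hy] with z hz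
      have : χ z = 0 := image_eq_zero_of_notMem_tsupport hz
      simp [this, zeroSection]
  · change χ y • s y = s y
    rw [hy, one_smul]

/-- A function that is smooth near `x` agrees near `x` with a global smooth function. -/
theorem exists_function_eventuallyEq {x : M} {f : M → ℝ}
    (hf : ∀ᶠ y in 𝓝 x, ContMDiffAt (𝓡 m) 𝓘(ℝ, ℝ) ∞ f y) :
    ∃ g : C^∞⟮𝓡 m, M; ℝ⟯, ∀ᶠ y in 𝓝 x, g y = f y := by
  obtain ⟨χ, h1, h2⟩ := exists_cutoff (m := m) hf
  refine ⟨⟨fun y => χ y * f y, fun y => ?_⟩, h1.mono fun y hy => ?_⟩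
  · by_cases hy : y ∈ tsupport χ
    · exact (χ.contMDiff y).mul (h2 hy)
    · refine (contMDiffAt_const (c := (0 : ℝ))).congr_of_eventuallyEq ?_
      filter_upwards [(isClosed_tsupport χ).isOpen_compl.mem_nhds hy] with z hz
      have : χ z = 0 := image_eq_zero_of_notMem_tsupport hz
      simp [this]
  · change χ y * f y = f y
    rw [hy, one_mul]

/-- Operators on `Γ(V)` can only be fed global sections, so the local frame is cut off away from
`x`. -/
theorem exists_frame_section (V : SmoothVectorBundle.{u, v} m M) (x : M) :
    ∃ σ : Fin (Module.finrank ℝ V.Model) → V.Sec, ∀ᶠ y in 𝓝 x, ∀ j, σ j y = V.frameAt x j y := by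
  have h : ∀ j, ∃ σ : V.Sec, ∀ᶠ y in 𝓝 x, σ y = V.frameAt x j y := fun j =>
    exists_section_eventuallyEq V <| by
      filter_upwards [(V.isOpen_frameDomain x).mem_nhds (V.mem_frameDomain x)] with y hy
      exact V.contMDiffAt_frameAt hy j
  choose σ hσ using h
  exact ⟨σ, eventually_all.2 hσ⟩

/-- Global sections extending the local frame at `x`. -/
def frameSec (V : SmoothVectorBundle.{u, v} m M) (x : M) :
    Fin (Module.finrank ℝ V.Model) → V.Sec :=
  (V.exists_frame_section x).choose

theorem frameSec_eventuallyEq (V : SmoothVectorBundle.{u, v} m M) (x : M) :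
    ∀ᶠ y in 𝓝 x, ∀ j, V.frameSec x j y = V.frameAt x j y :=
  (V.exists_frame_section x).choose_spec

/-- Every section is, near `x`, a combination of the frame sections, with coefficients whose
values at `x` depend only on the value of the section. -/
theorem exists_frame_expansion (V : SmoothVectorBundle.{u, v} m M) (x : M) (e : V.Sec) :
    ∃ f : Fin (Module.finrank ℝ V.Model) → C^∞⟮𝓡 m, M; ℝ⟯,
      (∀ j, f j x = V.coeffAt x j x (e x)) ∧
        ∀ᶠ y in 𝓝 x, e y = (∑ j, f j • V.frameSec x j) y := by
  have h : ∀ j, ∃ f : C^∞⟮𝓡 m, M; ℝ⟯, ∀ᶠ y in 𝓝 x, f y = V.coeffAt x j y (e y) := fun j =>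
    exists_function_eventuallyEq <| by
      filter_upwards [(V.isOpen_frameDomain x).mem_nhds (V.mem_frameDomain x)] with y hy
      exact V.contMDiffAt_coeffAt hy j (e.contMDiff y)
  choose f hf using h
  refine ⟨f, fun j => (hf j).self_of_nhds, ?_⟩
  filter_upwards [eventually_all.2 hf, V.frameSec_eventuallyEq x,
    (V.isOpen_frameDomain x).mem_nhds (V.mem_frameDomain x)] with y h1 h2 h3
  rw [sec_sum_apply]
  conv_lhs => rw [← V.sum_coeffAt_smul_frameAt h3 (e y)]
  refine Finset.sum_congr rfl fun j _ => ?_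
  rw [smul_apply, h1, h2]

/-- Through every vector there passes a smooth section. -/
theorem exists_section_eq (V : SmoothVectorBundle.{u, v} m M) (x : M) (e : V.Fiber x) :
    ∃ s : V.Sec, s x = e := by
  refine ⟨∑ j, V.coeffAt x j x e • V.frameSec x j, ?_⟩
  rw [sec_sum_apply]
  conv_rhs => rw [← V.sum_coeffAt_smul_frameAt (V.mem_frameDomain x) e]
  refine Finset.sum_congr rfl fun j _ => ?_
  rw [← (V.frameSec_eventuallyEq x).self_of_nhds j]
  rfl

section Operators

variable {V : SmoothVectorBundle.{u, v} m M} {A : Type*} [AddCommGroup A] [Module ℝ A] {x : M}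
  {Φ : V.Sec → A} {D : C^∞⟮𝓡 m, M; ℝ⟯ → ℝ} {β : V.Fiber x → A}

/-- A first order operator is local. -/
theorem eq_of_eventuallyEq_of_leibniz (hadd : ∀ e e', Φ (e + e') = Φ e + Φ e')
    (hβ : β 0 = 0) (hsmul : ∀ f e, Φ (f • e) = f x • Φ e + D f • β (e x))
    {e e' : V.Sec} (h : ∀ᶠ y in 𝓝 x, e y = e' y) : Φ e = Φ e' := by
  -- The cut-off lives where `e = e'`, so `χ • (e - e') = 0`. Applying `Φ` with the Leibniz rule
  -- leaves `χ x • Φ (e - e')` with `χ x = 1`, because `e - e'` vanishes at `x` and `β 0 = 0`.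
  obtain ⟨χ, h1, h2⟩ := exists_cutoff (m := m) h
  have h3 : χ • (e - e') = 0 := by
    ext y
    rw [smul_apply]
    by_cases hy : y ∈ tsupport χ
    · have : e y = e' y := h2 hy
      simp [this]
    · have : χ y = 0 := image_eq_zero_of_notMem_tsupport hy
      simp [this]
  have h0 : Φ 0 = 0 := by simpa using hadd 0 0
  have h4 : Φ (e - e') = 0 := by
    have h5 := hsmul χ (e - e')
    have h6 : (e - e') x = 0 := sub_eq_zero.2 h.self_of_nhds
    rw [h3, h0, h1.self_of_nhds, h6, hβ, smul_zero, add_zero, one_smul] at h5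
    exact h5.symm
  calc Φ e = Φ ((e - e') + e') := by rw [sub_add_cancel]
    _ = Φ e' := by rw [hadd, h4, zero_add]

/-- A tensorial operator is determined by its values on the frame sections. -/
theorem tensorial_eq_sum (hadd : ∀ e e', Φ (e + e') = Φ e + Φ e')
    (hsmul : ∀ (f : C^∞⟮𝓡 m, M; ℝ⟯) e, Φ (f • e) = f x • Φ e) (e : V.Sec) :
    Φ e = ∑ j, V.coeffAt x j x (e x) • Φ (V.frameSec x j) := by
  obtain ⟨f, hf, hf'⟩ := V.exists_frame_expansion x e
  rw [eq_of_eventuallyEq_of_leibniz (D := 0) (β := 0) hadd rfl (by simpa using hsmul) hf',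
    map_sum_of_add hadd]
  exact Finset.sum_congr rfl fun j _ => by rw [hsmul, hf]

end Operators

end Frames

end SmoothVectorBundle

/-! ### Function-linear maps of sections as sections of `Hom(V, W)`; direct sums. -/

namespace SmoothVectorBundle

open Filter Topology Bundle

section HomOfTensorial

variable {m : ℕ} {M : Type u} [TopologicalSpace M]
  [ChartedSpace (EuclideanSpace ℝ (Fin m)) M]

/-- A map into a space of operators with finite-dimensional source is smooth if it is so on each
vector of a basis. -/
theorem contMDiffAt_clm_of_basis {F G ι : Type*} [NormedAddCommGroup F] [NormedSpace ℝ F]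
    [FiniteDimensional ℝ F] [NormedAddCommGroup G] [NormedSpace ℝ G] [Fintype ι]
    (b : Module.Basis ι ℝ F) {g : M → F →L[ℝ] G} {x : M}
    (h : ∀ j, ContMDiffAt (𝓡 m) 𝓘(ℝ, G) ∞ (fun y => g y (b j)) x) :
    ContMDiffAt (𝓡 m) 𝓘(ℝ, F →L[ℝ] G) ∞ g x := by
  -- The operator is the sum over `j` of the `j`-th coordinate functional tensored with the column
  -- `g y (b j)`, and each summand is a fixed continuous linear map applied to that column.
  have hg : g = fun y => ∑ j, ContinuousLinearMap.smulRightL ℝ F G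
      (LinearMap.toContinuousLinearMap (b.coord j)) (g y (b j)) := by
    funext y
    ext e
    conv_lhs => rw [← b.sum_repr e, map_sum]
    simp
  rw [hg]
  refine ContMDiffAt.sum fun j _ => ?_
  exact (ContinuousLinearMap.contMDiff _).contMDiffAt.comp x (h j)

/-- A section of `Hom(V, W)` is determined by its action on sections. -/
theorem act_injective [IsManifold (𝓡 m) ∞ M] [T2Space M] {V : SmoothVectorBundle.{u, v} m M}
    {W : SmoothVectorBundle.{u, w} m M} {θ θ' : (V.hom W).Sec}
    (h : ∀ e : V.Sec, θ.act e = θ'.act e) : θ = θ' := by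
  ext x
  refine ContinuousLinearMap.ext (M₁ := V.Fiber x) (M₂ := W.Fiber x) fun e => ?_
  obtain ⟨s, rfl⟩ := V.exists_section_eq x e
  exact congrArg (fun t : W.Sec => t x) (h s)

variable [IsManifold (𝓡 m) ∞ M] [T2Space M]
  {V : SmoothVectorBundle.{u, v} m M} {W : SmoothVectorBundle.{u, w} m M}

/-- The linear map on fibres at `x` induced by an operator on sections. -/
def fiberMap (Φ : V.Sec → W.Sec) (x : M) : V.Fiber x →L[ℝ] W.Fiber x :=
  have : T2Space (V.Fiber x) := FiberBundle.t2Space V.Model V.Fiber x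
  have : FiniteDimensional ℝ (V.Fiber x) := VectorBundle.finiteDimensional ℝ V.Model V.Fiber x
  LinearMap.toContinuousLinearMap
    (∑ j, (V.coeffAt x j x).smulRight (Φ (V.frameSec x j) x))

/-- By tensoriality `Φ e x` depends only on `e x`, through its coefficients in the frame at `x`;
`fiberMap` is that expression. -/
theorem fiberMap_apply {Φ : V.Sec → W.Sec} (hadd : ∀ e e', Φ (e + e') = Φ e + Φ e')
    (hsmul : ∀ (f : C^∞⟮𝓡 m, M; ℝ⟯) e, Φ (f • e) = f • Φ e) (x : M) (e : V.Sec) :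
    fiberMap Φ x (e x) = Φ e x := by
  rw [tensorial_eq_sum (Φ := fun e => Φ e x) (x := x) (fun e e' => by rw [hadd]; rfl)
    (fun f e => by rw [hsmul]; rfl) e]
  simp [fiberMap]

/-- The section of `Hom(V, W)` that corresponds to a function linear map `Γ(V) → Γ(W)`. -/
def homOfTensorial (Φ : V.Sec → W.Sec) (hadd : ∀ e e', Φ (e + e') = Φ e + Φ e')
    (hsmul : ∀ (f : C^∞⟮𝓡 m, M; ℝ⟯) e, Φ (f • e) = f • Φ e) : (V.hom W).Sec where
  toFun x := fiberMap Φ x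
  contMDiff_toFun := fun x => by
    refine (contMDiffAt_hom_bundle (F₁ := V.Model) (E₁ := V.Fiber) (F₂ := W.Model)
      (E₂ := W.Fiber) _).2 ⟨contMDiffAt_id, ?_⟩
    refine contMDiffAt_clm_of_basis (Module.finBasis ℝ V.Model) fun j => ?_
    -- Near `x` the frame section is the constant `j`-th basis vector of the trivialization. The
    -- `j`-th column of the operator is therefore the coordinate expression of the smooth section `Φ
    -- (V.frameSec x j)`.
    have h := (contMDiffAt_section (F := W.Model) (E := W.Fiber) (IB := 𝓡 m) (n := ∞) x).1
      ((Φ (V.frameSec x j)).contMDiff x)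
    refine h.congr_of_eventuallyEq ?_
    filter_upwards [(V.isOpen_frameDomain x).mem_nhds (V.mem_frameDomain x),
      (W.isOpen_frameDomain x).mem_nhds (W.mem_frameDomain x),
      V.frameSec_eventuallyEq x] with y hV hW hy
    have h1 : (trivializationAt V.Model V.Fiber x).symm y (Module.finBasis ℝ V.Model j) =
        V.frameSec x j y := by
      rw [hy, frameAt, Trivialization.localFrame_apply_of_mem_baseSet _ _ hV]
      simp only [Trivialization.basisAt, Module.Basis.map_apply]
      rfl
    rw [ContinuousLinearMap.inCoordinates_eq hV hW]
    simp only [ContinuousLinearMap.comp_apply, ContinuousLinearEquiv.coe_coe]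
    rw [← fiberMap_apply hadd hsmul, ← h1]
    rfl

theorem homOfTensorial_act (Φ : V.Sec → W.Sec) (hadd : ∀ e e', Φ (e + e') = Φ e + Φ e')
    (hsmul : ∀ (f : C^∞⟮𝓡 m, M; ℝ⟯) e, Φ (f • e) = f • Φ e) (e : V.Sec) :
    (homOfTensorial Φ hadd hsmul).act e = Φ e := by
  ext x
  exact fiberMap_apply hadd hsmul x e

end HomOfTensorial

section Sum

variable {m : ℕ} {M : Type u} [TopologicalSpace M]
  [ChartedSpace (EuclideanSpace ℝ (Fin m)) M]
  {V : SmoothVectorBundle.{u, v} m M} {W : SmoothVectorBundle.{u, w} m M}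

/-- The section of `V ⊕ W` with given components. -/
def Sec.pair (s : V.Sec) (t : W.Sec) : (V.sum W).Sec where
  toFun x := (show V.Fiber x × W.Fiber x from (s x, t x))
  contMDiff_toFun := fun x => by
    refine (contMDiffAt_section (IB := 𝓡 m) (F := V.Model × W.Model)
      (E := V.Fiber ×ᵇ W.Fiber) (n := ∞) x).2 ?_
    exact ContMDiffAt.prodMk_space
      ((contMDiffAt_section (IB := 𝓡 m) (F := V.Model) (E := V.Fiber) x).1 (s.contMDiff x))
      ((contMDiffAt_section (IB := 𝓡 m) (F := W.Model) (E := W.Fiber) x).1 (t.contMDiff x))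

theorem Sec.pair_ext {θ θ' : (V.sum W).Sec} (h1 : θ.fst = θ'.fst) (h2 : θ.snd = θ'.snd) :
    θ = θ' := by
  ext x
  exact Prod.ext (congrArg (fun s : V.Sec => s x) h1) (congrArg (fun s : W.Sec => s x) h2)

end Sum

/-! ### Vector fields as derivations, and the Lie bracket as their commutator. -/

section LieBracket

variable {m : ℕ} {M : Type u} [TopologicalSpace M]
  [ChartedSpace (EuclideanSpace ℝ (Fin m)) M] [IsManifold (𝓡 m) ∞ M]

theorem lieDeriv_apply (X : (tangent m M).Sec) (f : C^∞⟮𝓡 m, M; ℝ⟯) (x : M) :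
    lieDeriv X f x = mfderiv (𝓡 m) 𝓘(ℝ, ℝ) f x (show TangentSpace (𝓡 m) x from X x) := rfl

/-- A vector field is determined by its action on functions. -/
theorem lieDeriv_injective [T2Space M] {X Y : (tangent m M).Sec}
    (h : ∀ f, lieDeriv X f = lieDeriv Y f) : X = Y := by
  ext x
  have hinv : (mfderiv (𝓡 m) 𝓘(ℝ, EuclideanSpace ℝ (Fin m)) (extChartAt (𝓡 m) x) x).IsInvertible :=
    isInvertible_mfderiv_extChartAt (mem_extChartAt_source x)
  have hd : MDifferentiableAt (𝓡 m) 𝓘(ℝ, EuclideanSpace ℝ (Fin m)) (extChartAt (𝓡 m) x) x :=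
    mdifferentiableAt_extChartAt (mem_chart_source _ x)
  -- The test functions are the coordinates of the chart at `x`, cut off to global functions. Their
  -- differentials at `x` separate tangent vectors because the chart has invertible derivative.
  have key (i : Fin m) : ∃ g : C^∞⟮𝓡 m, M; ℝ⟯, ∀ Z : TangentSpace (𝓡 m) x,
      mfderiv (𝓡 m) 𝓘(ℝ, ℝ) g x Z = (EuclideanSpace.proj i : EuclideanSpace ℝ (Fin m) →L[ℝ] ℝ)
        (mfderiv (𝓡 m) 𝓘(ℝ, EuclideanSpace ℝ (Fin m)) (extChartAt (𝓡 m) x) x Z) := by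
    obtain ⟨g, hg⟩ := exists_function_eventuallyEq (m := m) (x := x)
      (f := (EuclideanSpace.proj i : EuclideanSpace ℝ (Fin m) →L[ℝ] ℝ) ∘ extChartAt (𝓡 m) x) (by
        filter_upwards [extChartAt_source_mem_nhds (I := 𝓡 m) x] with y hy
        have h1 : ContMDiffAt (𝓡 m) 𝓘(ℝ, EuclideanSpace ℝ (Fin m)) ∞ (extChartAt (𝓡 m) x) y :=
          contMDiffAt_extChartAt' (by simpa using hy)
        exact (ContinuousLinearMap.contMDiff _).contMDiffAt.comp y h1)
    refine ⟨g, fun Z => ?_⟩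
    have hg' : g =ᶠ[𝓝 x]
      (EuclideanSpace.proj i : EuclideanSpace ℝ (Fin m) →L[ℝ] ℝ) ∘ extChartAt (𝓡 m) x := hg
    rw [hg'.mfderiv_eq, mfderiv_comp x (ContinuousLinearMap.contMDiff (n := 1) _
      |>.mdifferentiableAt (by simp)) hd, ContinuousLinearMap.mfderiv_eq]
    rfl
  refine hinv.injective (PiLp.ext fun i => ?_)
  have hg (Z W : TangentSpace (𝓡 m) x) (hZW : ∀ g : C^∞⟮𝓡 m, M; ℝ⟯,
      mfderiv (𝓡 m) 𝓘(ℝ, ℝ) g x Z = mfderiv (𝓡 m) 𝓘(ℝ, ℝ) g x W) :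
      (EuclideanSpace.proj i : EuclideanSpace ℝ (Fin m) →L[ℝ] ℝ)
        (mfderiv (𝓡 m) 𝓘(ℝ, EuclideanSpace ℝ (Fin m)) (extChartAt (𝓡 m) x) x Z) =
      (EuclideanSpace.proj i : EuclideanSpace ℝ (Fin m) →L[ℝ] ℝ)
        (mfderiv (𝓡 m) 𝓘(ℝ, EuclideanSpace ℝ (Fin m)) (extChartAt (𝓡 m) x) x W) := by
    obtain ⟨g, hg⟩ := key i
    rw [← hg, ← hg, hZW]
  exact hg _ _ fun g => congrArg (fun f : C^∞⟮𝓡 m, M; ℝ⟯ => f x) (h g)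

/-- The Lie bracket of vector fields. -/
def lieBracket (X Y : (tangent m M).Sec) : (tangent m M).Sec where
  toFun x := VectorField.mlieBracket (𝓡 m) (fun y => (X y : TangentSpace (𝓡 m) y))
    (fun y => (Y y : TangentSpace (𝓡 m) y)) x
  contMDiff_toFun := by
    have : IsManifold (𝓡 m) ((⊤ : ℕ∞) + 1) M := by simpa using ‹IsManifold (𝓡 m) ∞ M›
    have : IsManifold (𝓡 m) (minSmoothness ℝ 2) M := by
      simp only [minSmoothness_of_isRCLikeNormedField]
      infer_instance
    have : IsManifold (𝓡 m) (minSmoothness ℝ 3) M := by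
      simp only [minSmoothness_of_isRCLikeNormedField]
      infer_instance
    exact ContDiff.mlieBracket_vectorField (m := ⊤) (n := ⊤) X.contMDiff Y.contMDiff (by simp)

/-- A vector field read in the chart at `x`. -/
def chartField (x : M) (V : ∀ y : M, TangentSpace (𝓡 m) y) :
    EuclideanSpace ℝ (Fin m) → EuclideanSpace ℝ (Fin m) :=
  VectorField.mpullbackWithin 𝓘(ℝ, EuclideanSpace ℝ (Fin m)) (𝓡 m)
    (extChartAt (𝓡 m) x).symm V (Set.range (𝓡 m))

/-- The tangent space at `x` is identified with the model space through this very chart, so the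
derivative of the chart at `x` is the identity and the pullback back to `M` disappears. -/
theorem mlieBracket_eq_lieBracket_chartField (V W : ∀ y : M, TangentSpace (𝓡 m) y) (x : M) :
    VectorField.mlieBracket (𝓡 m) V W x =
      VectorField.lieBracket ℝ (chartField x V) (chartField x W) (extChartAt (𝓡 m) x x) := by
  rw [← VectorField.mlieBracketWithin_univ, VectorField.mlieBracketWithin_apply,
    mfderiv_extChartAt_self]
  have h : Set.range (𝓡 m) = Set.univ := ModelWithCorners.range_eq_univ _
  rw [Set.preimage_univ, Set.univ_inter, ← VectorField.lieBracketWithin_univ, ← h]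
  exact congrArg (fun T : EuclideanSpace ℝ (Fin m) →L[ℝ] EuclideanSpace ℝ (Fin m) => T _)
    (ContinuousLinearMap.inverse_id (R := ℝ) (M := EuclideanSpace ℝ (Fin m)))

/-- Without boundary the range of the model is everything, so differentiability within it is plain
differentiability. -/
theorem differentiableAt_chartField {V : ∀ y : M, TangentSpace (𝓡 m) y} {x : M}
    (hV : MDifferentiableAt (𝓡 m) (𝓡 m).tangent (fun y => (V y : TangentBundle (𝓡 m) M)) x) :
    DifferentiableAt ℝ (chartField x V) (extChartAt (𝓡 m) x x) := by
  have : IsManifold (𝓡 m) (minSmoothness ℝ 2) M := by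
    simp only [minSmoothness_of_isRCLikeNormedField]
    infer_instance
  have h1 := MDifferentiableWithinAt.differentiableWithinAt_mpullbackWithin_vectorField
    (I := 𝓡 m) (s := Set.univ) (x := x) (V := V) hV.mdifferentiableWithinAt
  have h : Set.range (𝓡 m) = Set.univ := ModelWithCorners.range_eq_univ _
  rw [Set.preimage_univ, Set.univ_inter] at h1
  exact (h ▸ h1 : DifferentiableWithinAt ℝ (chartField x V) Set.univ _).differentiableAt
    Filter.univ_mem

/-- Chain rule: the derivative of the inverse chart undoes the inverse derivative built into the
pullback. Hence derivatives along vector fields may be computed in the chart. -/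
theorem fderiv_comp_extChartAt_symm (V : ∀ x : M, TangentSpace (𝓡 m) x) (g : C^∞⟮𝓡 m, M; ℝ⟯)
    (x : M) {y : EuclideanSpace ℝ (Fin m)} (hy : y ∈ (extChartAt (𝓡 m) x).target) :
    fderiv ℝ (g ∘ (extChartAt (𝓡 m) x).symm) y
      (chartField x V y) =
      mfderiv (𝓡 m) 𝓘(ℝ, ℝ) g ((extChartAt (𝓡 m) x).symm y)
        (V ((extChartAt (𝓡 m) x).symm y)) := by
  have : IsManifold (𝓡 m) (minSmoothness ℝ 2) M := by
    simp only [minSmoothness_of_isRCLikeNormedField]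
    infer_instance
  unfold chartField
  have hinv := isInvertible_mfderivWithin_extChartAt_symm (I := 𝓡 m) hy
  have hd := mdifferentiableWithinAt_extChartAt_symm (I := 𝓡 m) hy
  rw [ModelWithCorners.range_eq_univ] at hinv hd ⊢
  rw [mfderivWithin_univ] at hinv
  rw [mdifferentiableWithinAt_univ] at hd
  rw [← mfderiv_eq_fderiv, mfderiv_comp y (g.contMDiff.mdifferentiableAt (by simp)) hd,
    VectorField.mpullbackWithin_apply, mfderivWithin_univ]
  change mfderiv (𝓡 m) 𝓘(ℝ, ℝ) g _ (mfderiv _ _ _ y ((mfderiv _ _ _ y).inverse _)) = _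
  rw [hinv.self_apply_inverse]

/-- Read in the chart at `x`, this is the Euclidean identity, in which the second derivatives of `f`
cancel by symmetry. The iterated derivative needs the chart formula on a whole neighbourhood, not
only at the centre. -/
theorem lieDeriv_lieBracket (X Y : (tangent m M).Sec) (f : C^∞⟮𝓡 m, M; ℝ⟯) :
    lieDeriv (lieBracket X Y) f = lieDeriv X (lieDeriv Y f) - lieDeriv Y (lieDeriv X f) := by
  have : IsManifold (𝓡 m) (minSmoothness ℝ 2) M := by
    simp only [minSmoothness_of_isRCLikeNormedField]
    infer_instance
  ext x
  let φ := extChartAt (𝓡 m) x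
  let pb (V : (tangent m M).Sec) : EuclideanSpace ℝ (Fin m) → EuclideanSpace ℝ (Fin m) :=
    chartField x (fun y => (V y : TangentSpace (𝓡 m) y))
  have hpb (V : (tangent m M).Sec) (g : C^∞⟮𝓡 m, M; ℝ⟯) {y : EuclideanSpace ℝ (Fin m)}
      (hy : y ∈ φ.target) : fderiv ℝ (g ∘ φ.symm) y (pb V y) = lieDeriv V g (φ.symm y) :=
    fderiv_comp_extChartAt_symm _ g x hy
  have hxt : φ x ∈ φ.target := mem_extChartAt_target x
  have hxs : φ.symm (φ x) = x := extChartAt_to_inv x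
  have hnt : φ.target ∈ 𝓝 (φ x) := extChartAt_target_mem_nhds x
  have hdiff (V : (tangent m M).Sec) : DifferentiableAt ℝ (pb V) (φ x) :=
    differentiableAt_chartField ((V.contMDiff x).mdifferentiableAt (by simp))
  have hf : ContDiffAt ℝ ∞ (f ∘ φ.symm) (φ x) := by
    have h1 : ContMDiffAt 𝓘(ℝ, EuclideanSpace ℝ (Fin m)) (𝓡 m) ∞ φ.symm (φ x) :=
      (contMDiffOn_extChartAt_symm x).contMDiffAt hnt
    exact ((f.contMDiff _).comp _ h1).contDiffAt
  have hiter (V W : (tangent m M).Sec) :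
      fderiv ℝ (fun y => fderiv ℝ (f ∘ φ.symm) y (pb W y)) (φ x) (pb V (φ x)) =
        lieDeriv V (lieDeriv W f) x := by
    have h1 : (fun y => fderiv ℝ (f ∘ φ.symm) y (pb W y)) =ᶠ[𝓝 (φ x)]
        (lieDeriv W f) ∘ φ.symm := by
      filter_upwards [hnt] with y hy using hpb W f hy
    rw [h1.fderiv_eq, hpb V _ hxt, hxs]
  have hbr := VectorField.fderiv_apply_lieBracket hf (by simpa using ENat.LEInfty.out) (hdiff Y) (hdiff X)
  rw [hiter, hiter] at hbr
  refine Eq.trans ?_ hbr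
  have hmf : mfderiv (𝓡 m) 𝓘(ℝ, ℝ) f x = fderiv ℝ (f ∘ φ.symm) (φ x) := by
    rw [(f.contMDiff.mdifferentiableAt (by simp)).mfderiv, ModelWithCorners.range_eq_univ,
      fderivWithin_univ]
    rfl
  rw [lieDeriv_apply, hmf]
  exact congrArg (fderiv ℝ (f ∘ φ.symm) (φ x)) (mlieBracket_eq_lieBracket_chartField _ _ x)

end LieBracket

end SmoothVectorBundle

/-! ### The vector bundle spanned by a family of constant rank. -/

section SubbundleConstruction

open Filter Topology Bundle

/-- A family of sections, with values in vector spaces `Q x`, whose values span a subspace of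
constant finite dimension `r` at each point (the dimension of the model space `F`), and such that
near every point these subspaces are separated by linear functionals that are smooth on the members
of the family. -/
structure SpanningFamily (m : ℕ) (M : Type u) [TopologicalSpace M]
    [ChartedSpace (EuclideanSpace ℝ (Fin m)) M] (Q : M → Type w) [∀ x, AddCommGroup (Q x)]
    [∀ x, Module ℝ (Q x)] (Δ : Type*) (F : Type v) [NormedAddCommGroup F] [NormedSpace ℝ F]
    (r : ℕ) where
  basis : Module.Basis (Fin r) ℝ F
  val : Δ → ∀ x, Q x
  finite : ∀ x, FiniteDimensional ℝ (Submodule.span ℝ (Set.range fun D => val D x))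
  finrank_eq : ∀ x, Module.finrank ℝ (Submodule.span ℝ (Set.range fun D => val D x)) = r
  nhd : M → Set M
  isOpen_nhd : ∀ x, IsOpen (nhd x)
  mem_nhd : ∀ x, x ∈ nhd x
  separating : ∀ x, ∀ v ∈ Submodule.span ℝ (Set.range fun D => val D x), v ≠ 0 →
    ∃ l : ∀ y, Q y →ₗ[ℝ] ℝ,
      (∀ D, ∀ y ∈ nhd x, ContMDiffAt (𝓡 m) 𝓘(ℝ, ℝ) ∞ (fun z => l z (val D z)) y) ∧ l x v ≠ 0

namespace SpanningFamily

variable {m : ℕ} {M : Type u} [TopologicalSpace M]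
  [ChartedSpace (EuclideanSpace ℝ (Fin m)) M] {Q : M → Type w} [∀ x, AddCommGroup (Q x)]
  [∀ x, Module ℝ (Q x)] {Δ : Type*} {F : Type v} [NormedAddCommGroup F] [NormedSpace ℝ F] {r : ℕ}
  (P : SpanningFamily m M Q Δ F r)

/-- The span of the values at `x`. -/
def fiber (x : M) : Submodule ℝ (Q x) := Submodule.span ℝ (Set.range fun D => P.val D x)

theorem val_mem_fiber (D : Δ) (x : M) : P.val D x ∈ P.fiber x :=
  Submodule.subset_span ⟨D, rfl⟩

instance (x : M) : FiniteDimensional ℝ (P.fiber x) := P.finite x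

/-- The functionals that are smooth on the family near `x`. -/
def functionals (x : M) : Submodule ℝ (∀ y, Q y →ₗ[ℝ] ℝ) where
  carrier := {l | ∀ D, ∀ y ∈ P.nhd x,
    ContMDiffAt (𝓡 m) 𝓘(ℝ, ℝ) ∞ (fun z => l z (P.val D z)) y}
  add_mem' h h' D y hy := (h D y hy).add (h' D y hy)
  zero_mem' _ _ _ := contMDiffAt_const
  smul_mem' _ _ h D y hy := contMDiffAt_const.mul (h D y hy)

/-- The restrictions of smooth functionals form a subspace of the dual of the fibre. Since they
separate points its coannihilator is zero, and in finite dimension such a subspace is the whole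
dual. -/
theorem exists_functional_eq (x : M) (φ : Module.Dual ℝ (P.fiber x)) :
    ∃ l ∈ P.functionals x, ∀ v : P.fiber x, l x v = φ v := by
  let res : P.functionals x →ₗ[ℝ] Module.Dual ℝ (P.fiber x) :=
    { toFun := fun l => (l.1 x).comp (P.fiber x).subtype
      map_add' := fun _ _ => rfl
      map_smul' := fun _ _ => rfl }
  have hres : LinearMap.range res = ⊤ := by
    rw [← Subspace.dualCoannihilator_dualAnnihilator_eq (W := LinearMap.range res)]
    suffices h : (LinearMap.range res).dualCoannihilator = ⊥ by
      rw [h, Submodule.dualAnnihilator_bot]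
    refine (Submodule.eq_bot_iff _).2 fun v hv => ?_
    by_contra hne
    obtain ⟨l, hl, hlv⟩ := P.separating x v v.2 (fun h => hne (Subtype.ext h))
    exact hlv ((Submodule.mem_dualCoannihilator _).1 hv (res ⟨l, hl⟩) ⟨_, rfl⟩)
  obtain ⟨l, hl⟩ := LinearMap.range_eq_top.1 hres φ
  exact ⟨l.1, l.2, fun v => LinearMap.congr_fun hl v⟩

/-- A spanning set contains a basis, and each dual coordinate is the restriction of a smooth
functional. -/
theorem exists_frame (x : M) : ∃ (D : Fin r → Δ) (l : Fin r → ∀ y, Q y →ₗ[ℝ] ℝ),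
    (∀ j, l j ∈ P.functionals x) ∧ ∀ i j, l j x (P.val (D i) x) = if i = j then 1 else 0 := by
  have hfin := P.finite x
  have h := Submodule.exists_fun_fin_finrank_span_eq ℝ (Set.range fun D => P.val D x)
  rw [P.finrank_eq x] at h
  obtain ⟨f, hf, hs, hli⟩ := h
  choose D hD using hf
  let b : Module.Basis (Fin r) ℝ (P.fiber x) :=
    (Module.Basis.span hli).map (LinearEquiv.ofEq _ _ hs)
  have hb : ∀ i, (b i : Q x) = f i := fun i => by
    exact congrArg Subtype.val (Module.Basis.span_apply hli i)
  choose l hl hl' using fun j => P.exists_functional_eq x (b.coord j)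
  refine ⟨D, l, hl, fun i j => ?_⟩
  have h := hl' j (b i)
  rw [hb, ← hD] at h
  rw [h, Module.Basis.coord_apply, Module.Basis.repr_self, Finsupp.single_apply]

/-- Members of the family whose values form a basis at `x`. -/
def frame (x : M) : Fin r → Δ := (P.exists_frame x).choose

/-- Functionals dual to the frame at `x`. -/
def coframe (x : M) : Fin r → ∀ y, Q y →ₗ[ℝ] ℝ := (P.exists_frame x).choose_spec.choose

theorem coframe_mem (x : M) (j : Fin r) : P.coframe x j ∈ P.functionals x :=
  (P.exists_frame x).choose_spec.choose_spec.1 j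

theorem coframe_frame (x : M) (i j : Fin r) :
    P.coframe x j x (P.val (P.frame x i) x) = if i = j then 1 else 0 :=
  (P.exists_frame x).choose_spec.choose_spec.2 i j

/-- The combination at `y` of the frame at `x` with given coefficients. -/
def combine (x y : M) : F →ₗ[ℝ] Q y :=
  ∑ i, (P.basis.coord i).smulRight (P.val (P.frame x i) y)

/-- The coframe at `x`, as a map into the model fibre. -/
def measure (x y : M) : Q y →ₗ[ℝ] F :=
  ∑ j, (P.coframe x j y).smulRight (P.basis j)

theorem combine_apply (x y : M) (a : F) :
    P.combine x y a = ∑ i, P.basis.repr a i • P.val (P.frame x i) y := by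
  simp [combine]

theorem combine_mem (x y : M) (a : F) : P.combine x y a ∈ P.fiber y := by
  rw [combine_apply]
  exact sum_mem fun i _ => Submodule.smul_mem _ _ (P.val_mem_fiber _ _)

theorem measure_apply (x y : M) (v : Q y) :
    P.measure x y v = ∑ j, P.coframe x j y v • P.basis j := by
  simp [measure]

theorem contMDiffAt_measure (x : M) {y : M} (hy : y ∈ P.nhd x) (D : Δ) :
    ContMDiffAt (𝓡 m) 𝓘(ℝ, F) ∞ (fun z => P.measure x z (P.val D z)) y := by
  simp only [measure_apply]
  exact ContMDiffAt.sum fun j _ =>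
    (P.coframe_mem x j D y hy).smul contMDiffAt_const

variable [FiniteDimensional ℝ F]

/-- The frame at `x₀` measured by the coframe at `x`, at the point `y`. -/
def pairing (x x₀ y : M) : F →L[ℝ] F :=
  LinearMap.toContinuousLinearMap (P.measure x y ∘ₗ P.combine x₀ y)

/-- The coordinates at `y` with respect to the frame at `x`. -/
def coords (x y : M) : Q y →ₗ[ℝ] F :=
  (P.pairing x x y).inverse.toLinearMap ∘ₗ P.measure x y

/-- The points near `x` at which the frame at `x` is a basis. -/
def domain (x : M) : Set M :=
  {y | y ∈ P.nhd x ∧ (P.pairing x x y).IsInvertible}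

theorem contMDiffAt_pairing (x x₀ : M) {y : M} (hy : y ∈ P.nhd x) :
    ContMDiffAt (𝓡 m) 𝓘(ℝ, F →L[ℝ] F) ∞
      (P.pairing x x₀) y := by
  refine SmoothVectorBundle.contMDiffAt_clm_of_basis P.basis fun j => ?_
  have h : (fun z => P.pairing x x₀ z (P.basis j)) =
      fun z => P.measure x z (P.val (P.frame x₀ j) z) := by
    funext z
    change P.measure x z (P.combine x₀ z _) = _
    rw [combine_apply]
    simp [Finsupp.single_apply]
  rw [h]
  exact P.contMDiffAt_measure x hy _

theorem pairing_self (x : M) : P.pairing x x x = ContinuousLinearMap.id ℝ _ := by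
  refine ContinuousLinearMap.coe_injective (P.basis.ext fun i => ?_)
  change P.measure x x (P.combine x x _) = _
  rw [combine_apply, measure_apply]
  simp [Finsupp.single_apply, coframe_frame]

theorem mem_domain (x : M) : x ∈ P.domain x :=
  ⟨P.mem_nhd x, by rw [pairing_self]; exact ⟨ContinuousLinearEquiv.refl ℝ _, rfl⟩⟩

theorem isOpen_domain (x : M) : IsOpen (P.domain x) := by
  have h : ContinuousOn (P.pairing x x) (P.nhd x) := fun y hy =>
    (P.contMDiffAt_pairing x x hy).continuousAt.continuousWithinAt
  exact h.isOpen_inter_preimage (P.isOpen_nhd x) (ContinuousLinearEquiv.isOpen (𝕜 := ℝ)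
    (E := F) (F := F))

/-- The pairing is `measure` after `combine`, and `coords` is `measure` followed by the inverse
pairing, a genuine inverse only on the domain. -/
theorem coords_combine {x y : M} (hy : y ∈ P.domain x) (a : F) :
    P.coords x y (P.combine x y a) = a :=
  hy.2.inverse_apply_self a

/-- Constant rank enters here: `combine` is injective into a fibre of the same dimension `r`, so the
frame chosen at `x` spans the fibre at `y` too. -/
theorem range_combine {x y : M} (hy : y ∈ P.domain x) :
    LinearMap.range (P.combine x y) = P.fiber y := by
  refine Submodule.eq_of_le_of_finrank_eq ?_ ?_
  · rintro _ ⟨a, rfl⟩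
    exact P.combine_mem x y a
  · rw [LinearMap.finrank_range_of_inj (Function.LeftInverse.injective (P.coords_combine hy)),
      Module.finrank_eq_card_basis P.basis, Fintype.card_fin]
    exact (P.finrank_eq y).symm

theorem combine_coords {x y : M} (hy : y ∈ P.domain x) {v : Q y} (hv : v ∈ P.fiber y) :
    P.combine x y (P.coords x y v) = v := by
  rw [← P.range_combine hy] at hv
  obtain ⟨a, rfl⟩ := hv
  rw [P.coords_combine hy]

/-- Inversion of operators is smooth at every invertible one. -/
theorem contMDiffAt_inverse_pairing {x y : M} (hy : y ∈ P.domain x) :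
    ContMDiffAt (𝓡 m) 𝓘(ℝ, F →L[ℝ] F) ∞
      (fun z => (P.pairing x x z).inverse) y := by
  obtain ⟨e, he⟩ := hy.2
  have h : ContDiffAt ℝ ∞ ContinuousLinearMap.inverse (P.pairing x x y) := by
    rw [← he]
    exact contDiffAt_map_inverse e
  exact h.contMDiffAt.comp y (P.contMDiffAt_pairing x x hy.1)

theorem contMDiffAt_coords {x y : M} (hy : y ∈ P.domain x) (D : Δ) :
    ContMDiffAt (𝓡 m) 𝓘(ℝ, F) ∞
      (fun z => P.coords x z (P.val D z)) y :=
  (P.contMDiffAt_inverse_pairing hy).clm_apply (P.contMDiffAt_measure x hy.1 D)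

/-- The change of coordinates from the frame at `x₀` to the frame at `x`. -/
def change (x₀ x y : M) : F →L[ℝ] F :=
  (P.pairing x x y).inverse.comp (P.pairing x x₀ y)

theorem change_apply (x₀ x y : M) (a : F) :
    P.change x₀ x y a = P.coords x y (P.combine x₀ y a) := rfl

theorem contMDiffAt_change (x₀ : M) {x y : M} (hy : y ∈ P.domain x) :
    ContMDiffAt (𝓡 m) 𝓘(ℝ, F →L[ℝ] F) ∞
      (P.change x₀ x) y :=
  (P.contMDiffAt_inverse_pairing hy).clm_comp (P.contMDiffAt_pairing x x₀ hy.1)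

/-- The cocycle of the vector bundle spanned by the family. -/
def core : VectorBundleCore ℝ M (F) M where
  baseSet := P.domain
  isOpen_baseSet := P.isOpen_domain
  indexAt := id
  mem_baseSet_at := P.mem_domain
  coordChange := P.change
  coordChange_self x y hy a := P.coords_combine hy a
  continuousOn_coordChange x₀ x y hy :=
    (P.contMDiffAt_change x₀ hy.2).continuousAt.continuousWithinAt
  coordChange_comp i j k y hy a := by
    -- Combining the coordinates in the frame at `j` gives back the vector, so the intermediate
    -- frame drops out.
    rw [change_apply, change_apply, change_apply, P.combine_coords hy.1.2 (P.combine_mem _ _ _)]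

instance : P.core.IsContMDiff (𝓡 m) ∞ where
  contMDiffOn_coordChange x₀ _ _ hy := (P.contMDiffAt_change x₀ hy.2).contMDiffWithinAt

/-- The vector bundle spanned by the family. -/
def bundle : SmoothVectorBundle.{u, v} m M where
  Model := F
  Fiber := P.core.Fiber
  instTopologicalAddGroup := fun _ => inferInstanceAs (IsTopologicalAddGroup F)
  instContinuousSMul := fun _ => inferInstanceAs (ContinuousSMul ℝ F)

/-- The inclusion of the bundle spanned by the family. -/
def incl (x : M) : P.bundle.Fiber x →ₗ[ℝ] Q x := P.combine x x

theorem incl_injective (x : M) : Function.Injective (P.incl x) :=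
  Function.LeftInverse.injective (P.coords_combine (P.mem_domain x))

theorem range_incl (x : M) : LinearMap.range (P.incl x) = P.fiber x :=
  P.range_combine (P.mem_domain x)

/-- The fibre over `y` is the model read in the frame at `y` itself. The trivialization at `x`
applies the coordinate change from `y` to `x`, which is by definition `coords x y` after `incl y`.
-/
theorem contMDiffAt_iff_coords (x : M) (s : ∀ y, P.bundle.Fiber y) :
    ContMDiffAt (𝓡 m) ((𝓡 m).prod 𝓘(ℝ, P.bundle.Model)) ∞
      (fun y => TotalSpace.mk' P.bundle.Model y (s y)) x ↔
    ContMDiffAt (𝓡 m) 𝓘(ℝ, F) ∞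
      (fun y => P.coords x y (P.incl y (s y))) x :=
  contMDiffAt_section (F := F) (E := P.core.Fiber) x

/-- A section of the spanned bundle with the values of a member of the family is smooth. -/
theorem contMDiff_of_incl_eq_val (s : ∀ y, P.bundle.Fiber y) (D : Δ)
    (h : ∀ y, P.incl y (s y) = P.val D y) :
    ContMDiff (𝓡 m) ((𝓡 m).prod 𝓘(ℝ, P.bundle.Model)) ∞
      (fun y => TotalSpace.mk' P.bundle.Model y (s y)) := fun x => by
  rw [contMDiffAt_iff_coords]
  simp only [h]
  exact P.contMDiffAt_coords (P.mem_domain x) D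

/-- A smooth section of the spanned bundle is locally a combination of members of the family. -/
theorem exists_local_expansion (s : P.bundle.Sec) (x : M) :
    ∃ f : Fin r → M → ℝ, (∀ i, ContMDiffAt (𝓡 m) 𝓘(ℝ, ℝ) ∞ (f i) x) ∧
      ∀ᶠ y in 𝓝 x, P.incl y (s y) = ∑ i, f i y • P.val (P.frame x i) y := by
  refine ⟨fun i y => P.basis.repr (P.coords x y (P.incl y (s y))) i,
    fun i => ?_, ?_⟩
  · have h := (P.contMDiffAt_iff_coords x s).1 (s.contMDiff x)
    exact (ContinuousLinearMap.contMDiff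
      (LinearMap.toContinuousLinearMap (P.basis.coord i))).contMDiffAt.comp x h
  · filter_upwards [(P.isOpen_domain x).mem_nhds (P.mem_domain x)] with y hy
    rw [← combine_apply, P.combine_coords hy]
    rw [← P.range_incl]
    exact ⟨_, rfl⟩

end SpanningFamily

end SubbundleConstruction

/-! ### Values of operators at a point, and the bundle `𝔇_π`. -/

namespace ThreeTermComplex

open SmoothVectorBundle Filter Topology Bundle

variable {m : ℕ} {M : Type u} [TopologicalSpace M]
  [ChartedSpace (EuclideanSpace ℝ (Fin m)) M]

/-- The differential of a function at a point. -/
def diffAt (f : C^∞⟮𝓡 m, M; ℝ⟯) (x : M) : TangentSpace (𝓡 m) x →L[ℝ] ℝ :=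
  mfderiv (𝓡 m) 𝓘(ℝ, ℝ) f x

/-- The value at a point of a section of `Hom(V, W)`. -/
def homAt {V W : SmoothVectorBundle.{u, v} m M} (θ : (V.hom W).Sec) (x : M) :
    V.Fiber x →L[ℝ] W.Fiber x := θ x

/-- The maps `Γ(V) → V_x` that are `ℝ`-linear and satisfy the Leibniz rule at `x` with symbol `X`. -/
structure IsLeibnizAt {V : SmoothVectorBundle.{u, v} m M} {x : M} (X : TangentSpace (𝓡 m) x)
    (d : V.Sec → V.Fiber x) : Prop where
  add : ∀ e e', d (e + e') = d e + d e'
  smul : ∀ (f : C^∞⟮𝓡 m, M; ℝ⟯) e,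
    d (f • e) = f x • d e + diffAt f x X • e x

/-- Real homogeneity is the Leibniz rule for a constant function, whose differential vanishes. -/
theorem IsLeibnizAt.const_smul {V : SmoothVectorBundle.{u, v} m M} {x : M}
    {X : TangentSpace (𝓡 m) x} {d : V.Sec → V.Fiber x} (h : IsLeibnizAt X d) (c : ℝ) (e : V.Sec) :
    d (c • e) = c • d e := by
  let f : C^∞⟮𝓡 m, M; ℝ⟯ := ⟨fun _ => c, contMDiff_const⟩
  have h1 := h.smul f e
  have h2 : diffAt f x = 0 := mfderiv_const
  rw [h2] at h1
  have h3 : f • e = c • e := by ext y; rfl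
  rw [h3] at h1
  simpa [f] using h1

theorem isLeibnizAt_zero {V : SmoothVectorBundle.{u, v} m M} {x : M} :
    IsLeibnizAt (0 : TangentSpace (𝓡 m) x) (0 : V.Sec → V.Fiber x) where
  add := by simp
  smul := by simp

theorem IsLeibnizAt.sum_add {V : SmoothVectorBundle.{u, v} m M} {x : M}
    {X X' : TangentSpace (𝓡 m) x} {d d' : V.Sec → V.Fiber x} (h : IsLeibnizAt X d)
    (h' : IsLeibnizAt X' d') : IsLeibnizAt (X + X') (d + d') where
  add e e' := by simp only [Pi.add_apply, h.add, h'.add]; abel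
  smul f e := by
    simp only [Pi.add_apply, h.smul, h'.smul, map_add, add_smul, smul_add]
    abel

theorem IsLeibnizAt.smul_left {V : SmoothVectorBundle.{u, v} m M} {x : M}
    {X : TangentSpace (𝓡 m) x} {d : V.Sec → V.Fiber x} (h : IsLeibnizAt X d) (c : ℝ) :
    IsLeibnizAt (c • X) (c • d) where
  add e e' := by simp only [Pi.smul_apply, h.add, smul_add]
  smul f e := by
    simp only [Pi.smul_apply, h.smul, map_smul, smul_eq_mul, smul_add, mul_smul, smul_comm c]

variable [IsManifold (𝓡 m) ∞ M] (𝓔 : ThreeTermComplex.{u, v} m M)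

/-- The space in which the values at `x` of operators on sections live. -/
abbrev Value (x : M) : Type (max u v) :=
  TangentSpace (𝓡 m) x × (𝓔.E₀.Sec → 𝓔.E₀.Fiber x) × (𝓔.E₁.Sec → 𝓔.E₁.Fiber x) ×
    (𝓔.E₂.Sec → 𝓔.E₂.Fiber x)

/-- The values at `x` that satisfy the Leibniz rule and commute with the differential. -/
def valuePi (x : M) : Submodule ℝ (𝓔.Value x) where
  carrier := {v | IsLeibnizAt v.1 v.2.1 ∧ IsLeibnizAt v.1 v.2.2.1 ∧ IsLeibnizAt v.1 v.2.2.2 ∧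
    (∀ e, v.2.1 (𝓔.π₁.act e) = homAt 𝓔.π₁ x (v.2.2.1 e)) ∧
    (∀ e, v.2.2.1 (𝓔.π₂.act e) =
      homAt 𝓔.π₂ x (v.2.2.2 e))}
  add_mem' := by
    rintro v v' ⟨h0, h1, h2, h3, h4⟩ ⟨h0', h1', h2', h3', h4'⟩
    refine ⟨h0.sum_add h0', h1.sum_add h1', h2.sum_add h2', fun e => ?_, fun e => ?_⟩
    · simp only [Prod.snd_add, Prod.fst_add, Pi.add_apply, h3, h3', map_add]
    · simp only [Prod.snd_add, Prod.fst_add, Pi.add_apply, h4, h4', map_add]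
  zero_mem' := ⟨isLeibnizAt_zero, isLeibnizAt_zero, isLeibnizAt_zero, by simp, by simp⟩
  smul_mem' := by
    rintro c v ⟨h0, h1, h2, h3, h4⟩
    refine ⟨h0.smul_left c, h1.smul_left c, h2.smul_left c, fun e => ?_, fun e => ?_⟩
    · simp only [Prod.smul_snd, Prod.smul_fst, Pi.smul_apply, h3, map_smul]
    · simp only [Prod.smul_snd, Prod.smul_fst, Pi.smul_apply, h4, map_smul]

theorem valueAt_mem_valuePi (D : 𝓔.cdoPi) (x : M) : 𝓔.valueAt x D ∈ 𝓔.valuePi x := by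
  obtain ⟨D, ⟨h0, h1, h2⟩, h3, h4⟩ := D
  exact ⟨⟨fun e e' => by simp [valueAt], fun f e => congrArg (fun s : 𝓔.E₀.Sec => s x) (h0 f e)⟩,
    ⟨fun e e' => by simp [valueAt], fun f e => congrArg (fun s : 𝓔.E₁.Sec => s x) (h1 f e)⟩,
    ⟨fun e e' => by simp [valueAt], fun f e => congrArg (fun s : 𝓔.E₂.Sec => s x) (h2 f e)⟩,
    fun e => congrArg (fun s : 𝓔.E₀.Sec => s x) (h3 e),
    fun e => congrArg (fun s : 𝓔.E₁.Sec => s x) (h4 e)⟩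

theorem devPiFiber_eq_span (x : M) :
    𝓔.devPiFiber x = Submodule.span ℝ (Set.range fun D : 𝓔.cdoPi => 𝓔.valueAt x D) := by
  unfold devPiFiber
  congr 1
  ext v
  constructor
  · rintro ⟨D, hD, rfl⟩
    exact ⟨⟨D, hD⟩, rfl⟩
  · rintro ⟨D, rfl⟩
    exact ⟨D, D.2, rfl⟩

/-- The Leibniz rule and commutation with `π` are linear conditions on the value at `x`, so they
pass from operators to pointwise combinations of them. The inclusion can be strict, as a pointwise
solution need not extend to an operator. -/
theorem devPiFiber_le_valuePi (x : M) : 𝓔.devPiFiber x ≤ 𝓔.valuePi x := by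
  rw [devPiFiber_eq_span, Submodule.span_le]
  rintro _ ⟨D, rfl⟩
  exact 𝓔.valueAt_mem_valuePi D x

/-- The restriction of a value to the frame sections at `x`. -/
def valueOnFrame [T2Space M] (x : M) : 𝓔.Value x →ₗ[ℝ]
    TangentSpace (𝓡 m) x × (Fin (Module.finrank ℝ 𝓔.E₀.Model) → 𝓔.E₀.Fiber x) ×
      (Fin (Module.finrank ℝ 𝓔.E₁.Model) → 𝓔.E₁.Fiber x) ×
      (Fin (Module.finrank ℝ 𝓔.E₂.Model) → 𝓔.E₂.Fiber x) where
  toFun v := (v.1, fun j => v.2.1 (𝓔.E₀.frameSec x j), fun j => v.2.2.1 (𝓔.E₁.frameSec x j),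
    fun j => v.2.2.2 (𝓔.E₂.frameSec x j))
  map_add' _ _ := rfl
  map_smul' _ _ := rfl

theorem IsLeibnizAt.eq_zero [T2Space M] {V : SmoothVectorBundle.{u, v} m M} {x : M}
    {d : V.Sec → V.Fiber x} (h : IsLeibnizAt (0 : TangentSpace (𝓡 m) x) d)
    (h0 : ∀ j, d (V.frameSec x j) = 0) : d = 0 := by
  funext e
  rw [tensorial_eq_sum h.add (fun f e => by rw [h.smul, map_zero, zero_smul, add_zero]) e]
  simp [h0]

/-- A value with zero symbol is tensorial, hence zero once it kills the frame sections. So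
restriction to frame sections, together with the symbol, is injective into a finite-dimensional
space. -/
theorem finiteDimensional_devPiFiber [T2Space M] (x : M) :
    FiniteDimensional ℝ (𝓔.devPiFiber x) := by
  have h0 := VectorBundle.finiteDimensional ℝ 𝓔.E₀.Model 𝓔.E₀.Fiber x
  have h1 := VectorBundle.finiteDimensional ℝ 𝓔.E₁.Model 𝓔.E₁.Fiber x
  have h2 := VectorBundle.finiteDimensional ℝ 𝓔.E₂.Model 𝓔.E₂.Fiber x
  have : FiniteDimensional ℝ (TangentSpace (𝓡 m) x) :=
    inferInstanceAs (FiniteDimensional ℝ (EuclideanSpace ℝ (Fin m)))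
  refine FiniteDimensional.of_injective ((𝓔.valueOnFrame x).comp (𝓔.devPiFiber x).subtype)
    ((injective_iff_map_eq_zero _).2 fun v hv => Subtype.ext ?_)
  obtain ⟨v, hv'⟩ := v
  obtain ⟨l0, l1, l2, -⟩ := 𝓔.devPiFiber_le_valuePi x hv'
  obtain ⟨X, d0, d1, d2⟩ := v
  simp only [LinearMap.comp_apply, valueOnFrame, Prod.ext_iff, funext_iff, LinearMap.coe_mk,
    AddHom.coe_mk, Submodule.subtype_apply, Prod.fst_zero, Prod.snd_zero, Pi.zero_apply] at hv
  obtain ⟨rfl, hd0, hd1, hd2⟩ := hv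
  exact Prod.ext rfl (Prod.ext (l0.eq_zero hd0) (Prod.ext (l1.eq_zero hd1) (l2.eq_zero hd2)))

end ThreeTermComplex

namespace SmoothVectorBundle

open Filter Topology Bundle

variable {m : ℕ} {M : Type u} [TopologicalSpace M]
  [ChartedSpace (EuclideanSpace ℝ (Fin m)) M]

theorem eq_zero_of_coeffAt (V : SmoothVectorBundle.{u, v} m M) {x : M} {e : V.Fiber x}
    (h : ∀ j, V.coeffAt x j x e = 0) : e = 0 := by
  rw [← V.sum_coeffAt_smul_frameAt (V.mem_frameDomain x) e]
  simp [h]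

theorem contMDiffAt_of_local_expansion (V : SmoothVectorBundle.{u, v} m M) {ι : Type*} [Fintype ι]
    {t : ∀ y, V.Fiber y} {x : M} {f : ι → M → ℝ} (σ : ι → V.Sec)
    (hf : ∀ i, ContMDiffAt (𝓡 m) 𝓘(ℝ, ℝ) ∞ (f i) x)
    (h : ∀ᶠ y in 𝓝 x, t y = ∑ i, f i y • σ i y) :
    ContMDiffAt (𝓡 m) ((𝓡 m).prod 𝓘(ℝ, V.Model)) ∞
      (fun y => TotalSpace.mk' V.Model y (t y)) x := by
  have h1 : ContMDiffAt (𝓡 m) ((𝓡 m).prod 𝓘(ℝ, V.Model)) ∞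
      (fun y => TotalSpace.mk' V.Model y (∑ i, f i y • σ i y)) x :=
    ContMDiffAt.sum_section fun i _ => (hf i).smul_section ((σ i).contMDiff x)
  refine h1.congr_of_eventuallyEq (h.mono fun y hy => ?_)
  simp only [hy]

end SmoothVectorBundle

namespace ThreeTermComplex

open SmoothVectorBundle Filter Topology Bundle

variable {m : ℕ} {M : Type u} [TopologicalSpace M]
  [ChartedSpace (EuclideanSpace ℝ (Fin m)) M] [IsManifold (𝓡 m) ∞ M]
  (𝓔 : ThreeTermComplex.{u, v} m M)

/-- The functionals are the frame coefficients of the symbol and of `𝔡ᵢ e` for a fixed section `e`;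
they are smooth along `D` because `D` maps smooth sections to smooth sections. All of them are
smooth on one neighbourhood, independent of `e`. If all vanish on `v`, then `v = 0`. -/
theorem exists_smooth_functional (x : M) {v : 𝓔.Value x} (hv : v ≠ 0) :
    ∃ l : ∀ y, 𝓔.Value y →ₗ[ℝ] ℝ, (∀ D : 𝓔.cdoPi, ∀ y ∈ (tangent m M).frameDomain x ∩
      (𝓔.E₀.frameDomain x ∩ (𝓔.E₁.frameDomain x ∩ 𝓔.E₂.frameDomain x)),
      ContMDiffAt (𝓡 m) 𝓘(ℝ, ℝ) ∞ (fun z => l z (𝓔.valueAt z D)) y) ∧ l x v ≠ 0 := by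
  contrapose! hv
  refine Prod.ext ((tangent m M).eq_zero_of_coeffAt fun j => ?_)
    (Prod.ext (funext fun e => 𝓔.E₀.eq_zero_of_coeffAt fun j => ?_)
      (Prod.ext (funext fun e => 𝓔.E₁.eq_zero_of_coeffAt fun j => ?_)
        (funext fun e => 𝓔.E₂.eq_zero_of_coeffAt fun j => ?_)))
  · exact hv (fun y => (show TangentSpace (𝓡 m) y →ₗ[ℝ] ℝ from
      (tangent m M).coeffAt x j y) ∘ₗ LinearMap.fst ℝ _ _) fun D y hy =>
        (tangent m M).contMDiffAt_coeffAt hy.1 j ((D : 𝓔.Quad).1.contMDiff y)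
  · exact hv (fun y => 𝓔.E₀.coeffAt x j y ∘ₗ LinearMap.proj e ∘ₗ LinearMap.fst ℝ _ _ ∘ₗ
      LinearMap.snd ℝ _ _) fun D y hy =>
        𝓔.E₀.contMDiffAt_coeffAt hy.2.1 j (((D : 𝓔.Quad).2.1 e).contMDiff y)
  · exact hv (fun y => 𝓔.E₁.coeffAt x j y ∘ₗ LinearMap.proj e ∘ₗ LinearMap.fst ℝ _ _ ∘ₗ
      LinearMap.snd ℝ _ _ ∘ₗ LinearMap.snd ℝ _ _) fun D y hy =>
        𝓔.E₁.contMDiffAt_coeffAt hy.2.2.1 j (((D : 𝓔.Quad).2.2.1 e).contMDiff y)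
  · exact hv (fun y => 𝓔.E₂.coeffAt x j y ∘ₗ LinearMap.proj e ∘ₗ LinearMap.snd ℝ _ _ ∘ₗ
      LinearMap.snd ℝ _ _ ∘ₗ LinearMap.snd ℝ _ _) fun D y hy =>
        𝓔.E₂.contMDiffAt_coeffAt hy.2.2.2 j (((D : 𝓔.Quad).2.2.2 e).contMDiff y)

theorem quad_ext {D D' : 𝓔.Quad} (h : ∀ x, 𝓔.valueAt x D = 𝓔.valueAt x D') : D = D' := by
  simp only [valueAt, Prod.ext_iff, funext_iff] at h
  refine Prod.ext ?_ (Prod.ext ?_ (Prod.ext ?_ ?_))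
  · ext x; exact (h x).1
  · ext e x; exact (h x).2.1 e
  · ext e x; exact (h x).2.2.1 e
  · ext e x; exact (h x).2.2.2 e

variable [T2Space M] {r : ℕ} (hr : ∀ x : M, Module.finrank ℝ (𝓔.devPiFiber x) = r)

/-- The operators in `Γ(𝔇_π)`, as a family that spans the fibres of `𝔇_π`. -/
def devPiFamily : SpanningFamily m M 𝓔.Value 𝓔.cdoPi (ULift.{v} (EuclideanSpace ℝ (Fin r))) r where
  -- `ULift` moves the model fibre to the universe of the bundles `E i`.
  basis := (EuclideanSpace.basisFun (Fin r) ℝ).toBasis.map ULift.moduleEquiv.symm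
  val D x := 𝓔.valueAt x D
  finite x := by
    rw [← devPiFiber_eq_span]
    exact 𝓔.finiteDimensional_devPiFiber x
  finrank_eq x := by
    rw [← devPiFiber_eq_span]
    exact hr x
  nhd x := (tangent m M).frameDomain x ∩
      (𝓔.E₀.frameDomain x ∩ (𝓔.E₁.frameDomain x ∩ 𝓔.E₂.frameDomain x))
  isOpen_nhd x := (isOpen_frameDomain _ x).inter ((isOpen_frameDomain _ x).inter
    ((isOpen_frameDomain _ x).inter (isOpen_frameDomain _ x)))
  mem_nhd x := ⟨mem_frameDomain _ x, mem_frameDomain _ x, mem_frameDomain _ x, mem_frameDomain _ x⟩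
  separating x _ _ hv := 𝓔.exists_smooth_functional x hv

instance finiteDimensional_model (r : ℕ) :
    FiniteDimensional ℝ (ULift.{v} (EuclideanSpace ℝ (Fin r))) :=
  Module.Finite.equiv (ULift.moduleEquiv (R := ℝ) (M := EuclideanSpace ℝ (Fin r))).symm

/-- The smooth vector bundle with fibres `𝓔.devPiFiber x`. -/
def devPi : SmoothVectorBundle.{u, v} m M := (𝓔.devPiFamily hr).bundle

/-- The value at `x` of the operator that a section of `𝔇_π` defines. -/
def devPiIncl (x : M) : (𝓔.devPi hr).Fiber x →ₗ[ℝ] 𝓔.Value x := (𝓔.devPiFamily hr).incl x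

theorem devPiIncl_mem (x : M) (a : (𝓔.devPi hr).Fiber x) :
    𝓔.devPiIncl hr x a ∈ 𝓔.devPiFiber x := by
  rw [devPiFiber_eq_span]
  exact ((𝓔.devPiFamily hr).range_incl x).le ⟨a, rfl⟩

theorem devPiIncl_mem_valuePi (x : M) (a : (𝓔.devPi hr).Fiber x) :
    𝓔.devPiIncl hr x a ∈ 𝓔.valuePi x :=
  𝓔.devPiFiber_le_valuePi x (𝓔.devPiIncl_mem hr x a)

theorem exists_devPi_expansion (s : (𝓔.devPi hr).Sec) (x : M) :
    ∃ (D : Fin r → 𝓔.cdoPi) (f : Fin r → M → ℝ),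
      (∀ i, ContMDiffAt (𝓡 m) 𝓘(ℝ, ℝ) ∞ (f i) x) ∧
        ∀ᶠ y in 𝓝 x, 𝓔.devPiIncl hr y (s y) = ∑ i, f i y • 𝓔.valueAt y (D i) :=
  ⟨_, (𝓔.devPiFamily hr).exists_local_expansion s x⟩

/-- The operator that a section of `𝔇_π` defines. -/
def devPiQuad (s : (𝓔.devPi hr).Sec) : 𝓔.Quad :=
  ⟨{ toFun := fun x => (𝓔.devPiIncl hr x (s x)).1
     contMDiff_toFun := fun x => by
      -- Near `x` the vector field is a combination of symbols of finitely many global operators,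
      -- with coefficients smooth at `x`. The same argument, at a fixed `e`, serves the three
      -- operators below.
      obtain ⟨D, f, hf, h⟩ := 𝓔.exists_devPi_expansion hr s x
      refine (tangent m M).contMDiffAt_of_local_expansion (fun i => (D i : 𝓔.Quad).1) hf
        (h.mono fun y hy => ?_)
      rw [hy, Prod.fst_sum]
      rfl },
    { toFun := fun e =>
        { toFun := fun x => (𝓔.devPiIncl hr x (s x)).2.1 e
          contMDiff_toFun := fun x => by
            obtain ⟨D, f, hf, h⟩ := 𝓔.exists_devPi_expansion hr s x
            refine 𝓔.E₀.contMDiffAt_of_local_expansion (fun i => (D i : 𝓔.Quad).2.1 e) hf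
              (h.mono fun y hy => ?_)
            rw [hy, Prod.snd_sum, Prod.fst_sum, Finset.sum_apply]
            rfl }
      map_add' := fun e e' => by
        ext x
        exact (𝓔.devPiIncl_mem_valuePi hr x (s x)).1.add e e'
      map_smul' := fun c e => by
        ext x
        exact (𝓔.devPiIncl_mem_valuePi hr x (s x)).1.const_smul c e },
    { toFun := fun e =>
        { toFun := fun x => (𝓔.devPiIncl hr x (s x)).2.2.1 e
          contMDiff_toFun := fun x => by
            obtain ⟨D, f, hf, h⟩ := 𝓔.exists_devPi_expansion hr s x
            refine 𝓔.E₁.contMDiffAt_of_local_expansion (fun i => (D i : 𝓔.Quad).2.2.1 e) hf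
              (h.mono fun y hy => ?_)
            rw [hy, Prod.snd_sum, Prod.snd_sum, Prod.fst_sum, Finset.sum_apply]
            rfl }
      map_add' := fun e e' => by
        ext x
        exact (𝓔.devPiIncl_mem_valuePi hr x (s x)).2.1.add e e'
      map_smul' := fun c e => by
        ext x
        exact (𝓔.devPiIncl_mem_valuePi hr x (s x)).2.1.const_smul c e },
    { toFun := fun e =>
        { toFun := fun x => (𝓔.devPiIncl hr x (s x)).2.2.2 e
          contMDiff_toFun := fun x => by
            obtain ⟨D, f, hf, h⟩ := 𝓔.exists_devPi_expansion hr s x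
            refine 𝓔.E₂.contMDiffAt_of_local_expansion (fun i => (D i : 𝓔.Quad).2.2.2 e) hf
              (h.mono fun y hy => ?_)
            rw [hy, Prod.snd_sum, Prod.snd_sum, Prod.snd_sum, Finset.sum_apply]
            rfl }
      map_add' := fun e e' => by
        ext x
        exact (𝓔.devPiIncl_mem_valuePi hr x (s x)).2.2.1.add e e'
      map_smul' := fun c e => by
        ext x
        exact (𝓔.devPiIncl_mem_valuePi hr x (s x)).2.2.1.const_smul c e }⟩

theorem devPiQuad_mem (s : (𝓔.devPi hr).Sec) : 𝓔.devPiQuad hr s ∈ 𝓔.cdoPi := by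
  refine ⟨⟨fun f e => ?_, fun f e => ?_, fun f e => ?_⟩, fun e => ?_, fun e => ?_⟩ <;> ext x
  · exact (𝓔.devPiIncl_mem_valuePi hr x (s x)).1.smul f e
  · exact (𝓔.devPiIncl_mem_valuePi hr x (s x)).2.1.smul f e
  · exact (𝓔.devPiIncl_mem_valuePi hr x (s x)).2.2.1.smul f e
  · exact (𝓔.devPiIncl_mem_valuePi hr x (s x)).2.2.2.1 e
  · exact (𝓔.devPiIncl_mem_valuePi hr x (s x)).2.2.2.2 e

/-- The operator that a section of `𝔇_π` defines, as a function linear map. -/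
def devPiToCdo : (𝓔.devPi hr).Sec →ₗ[C^∞⟮𝓡 m, M; ℝ⟯] 𝓔.cdoPi where
  toFun s := ⟨𝓔.devPiQuad hr s, 𝓔.devPiQuad_mem hr s⟩
  map_add' s t := Subtype.ext <| 𝓔.quad_ext fun x => map_add (𝓔.devPiIncl hr x) (s x) (t x)
  map_smul' f s := Subtype.ext <| 𝓔.quad_ext fun x => map_smul (𝓔.devPiIncl hr x) (f x) (s x)

theorem devPiIncl_injective (x : M) : Function.Injective (𝓔.devPiIncl hr x) :=
  (𝓔.devPiFamily hr).incl_injective x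

theorem devPiToCdo_injective : Function.Injective (𝓔.devPiToCdo hr) := fun s t h => by
  ext x
  exact 𝓔.devPiIncl_injective hr x (congrArg (fun D : 𝓔.cdoPi => 𝓔.valueAt x D) h)

/-- Preimages are chosen point by point; injectivity of the inclusion leaves no freedom, and
smoothness holds since the values are those of one operator. -/
theorem devPiToCdo_surjective : Function.Surjective (𝓔.devPiToCdo hr) := fun D => by
  have h (x : M) : ∃ a : (𝓔.devPi hr).Fiber x, 𝓔.devPiIncl hr x a = 𝓔.valueAt x D :=
    ((𝓔.devPiFamily hr).range_incl x).ge ((𝓔.devPiFamily hr).val_mem_fiber D x)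
  choose a ha using h
  exact ⟨⟨a, (𝓔.devPiFamily hr).contMDiff_of_incl_eq_val a D ha⟩,
    Subtype.ext (𝓔.quad_ext ha)⟩

/-- The vector bundle `𝔇_π`. -/
def devPiBundle : 𝓔.DevPiBundle where
  bundle := 𝓔.devPi hr
  toCdo := LinearEquiv.ofBijective (𝓔.devPiToCdo hr)
    ⟨𝓔.devPiToCdo_injective hr, 𝓔.devPiToCdo_surjective hr⟩
  injective_fiber _ x h := 𝓔.devPiIncl_injective hr x (h.trans (map_zero _).symm)

end ThreeTermComplex

/-! ### The generalized Jacobi identities in low arity. -/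

section Jacobiator

variable {L : Type w} [AddCommGroup L] [Module ℝ L]
  (l : ∀ k : ℕ, MultilinearMap ℝ (fun _ : Fin k => L) L)

instance {k : ℕ} (i : ℕ) : DecidablePred (IsUnshuffle (k := k) i) := fun σ =>
  inferInstanceAs (Decidable (∀ a b : Fin k, a < b → ((b : ℕ) < i ∨ i ≤ (a : ℕ)) → σ a < σ b))

/-- `jacobiator` filters by classical decidability; with the computable instance the unshuffles can
be listed by `decide`. -/
theorem jacobiator_eq (k : ℕ) (d : Fin k → ℕ) (x : Fin k → L) :
    jacobiator l k d x = ∑ i : Fin k, ((-1 : ℤ) ^ (((i : ℕ) + 1) * (k - ((i : ℕ) + 1)))) •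
      ∑ σ : Equiv.Perm (Fin k) with IsUnshuffle ((i : ℕ) + 1) σ,
        ((Equiv.Perm.sign σ : ℤ) * koszulSign d σ) •
          l (k - ((i : ℕ) + 1) + 1)
            (Fin.cons (l ((i : ℕ) + 1) fun a => x (σ ⟨a, by omega⟩))
              (fun b : Fin (k - ((i : ℕ) + 1)) => x (σ ⟨(i : ℕ) + 1 + b, by omega⟩))) := by
  unfold jacobiator
  refine Finset.sum_congr rfl fun i _ => ?_
  congr 1
  exact Finset.sum_congr (by ext; simp) fun _ _ => rfl

/-- The inner and outer arities add up to `k + 1 ≥ 5`, so one of them is at least three. -/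
theorem jacobiator_eq_zero_of_four_le (hl : ∀ k, 3 ≤ k → l k = 0) {k : ℕ} (hk : 4 ≤ k)
    (d : Fin k → ℕ) (x : Fin k → L) : jacobiator l k d x = 0 := by
  rw [jacobiator_eq]
  refine Finset.sum_eq_zero fun i _ => ?_
  rw [Finset.sum_eq_zero, smul_zero]
  intro σ _
  by_cases hi : 3 ≤ (i : ℕ) + 1
  · rw [hl _ hi, zero_apply, (l _).map_coord_zero 0 rfl, smul_zero]
  · rw [hl (k - ((i : ℕ) + 1) + 1) (by omega), zero_apply, smul_zero]

theorem map_congr_one {y z : Fin 1 → L} (h : y 0 = z 0) : l 1 y = l 1 z :=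
  congrArg _ (funext fun j => by fin_cases j; exact h)

theorem map_congr_two {y z : Fin 2 → L} (h : y 0 = z 0) (h' : y 1 = z 1) : l 2 y = l 2 z :=
  congrArg _ (funext fun j => by fin_cases j; exacts [h, h'])

theorem koszulSign_one {k : ℕ} (d : Fin k → ℕ) : koszulSign d 1 = 1 := by
  refine Finset.prod_eq_one fun p _ => if_neg fun h => ?_
  exact lt_asymm h.1 h.2

theorem koszulSign_swap (d : Fin 2 → ℕ) :
    koszulSign d (Equiv.swap 0 1) = (-1) ^ (d 0 * d 1) := by
  simp [koszulSign, Fintype.prod_prod_type, mul_comm]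

theorem jacobiator_one (d : Fin 1 → ℕ) (x : Fin 1 → L) :
    jacobiator l 1 d x = l 1 ![l 1 ![x 0]] := by
  have h1 : (Finset.univ.filter fun σ : Equiv.Perm (Fin 1) => IsUnshuffle 1 σ) = {1} := by decide
  rw [jacobiator_eq, Fin.sum_univ_one]
  simp only [Fin.val_zero, Nat.zero_add, h1, Finset.sum_singleton, koszulSign_one,
    Equiv.Perm.sign_one, Nat.sub_self, mul_zero, pow_zero, Units.val_one, mul_one, one_smul]
  exact map_congr_one l (map_congr_one l rfl)

theorem jacobiator_two (d : Fin 2 → ℕ) (x : Fin 2 → L) :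
    jacobiator l 2 d x = l 1 ![l 2 ![x 0, x 1]] - l 2 ![l 1 ![x 0], x 1] +
      ((-1 : ℤ) ^ (d 0 * d 1)) • l 2 ![l 1 ![x 1], x 0] := by
  rw [jacobiator_eq, Fin.sum_univ_two]
  have h1 : (Finset.univ.filter fun σ : Equiv.Perm (Fin 2) => IsUnshuffle 1 σ) =
    {1, Equiv.swap 0 1} := by decide
  have h2 : (Finset.univ.filter fun σ : Equiv.Perm (Fin 2) => IsUnshuffle 2 σ) = {1} := by decide
  simp only [Fin.val_zero, Fin.val_one, Nat.zero_add, Nat.reduceAdd, h1, h2]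
  rw [Finset.sum_pair (by decide), Finset.sum_singleton]
  simp only [koszulSign_one, koszulSign_swap]
  have hs : Equiv.Perm.sign (Equiv.swap (0 : Fin 2) 1) = -1 := Equiv.Perm.sign_swap (by decide)
  simp only [hs, Equiv.Perm.sign_one]
  -- The signs are settled for arbitrary elements. The brackets are matched afterwards, because
  -- arities such as `2 - 1 + 1` agree with numerals only by evaluation.
  have key : ∀ (a b c : L) (n : ℤ), ((-1 : ℤ) ^ 1) • ((((1 : ℤˣ) : ℤ) * 1) • b +
      (((-1 : ℤˣ) : ℤ) * n) • c) + ((-1 : ℤ) ^ 0) • ((((1 : ℤˣ) : ℤ) * 1) • a) =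
      a - b + n • c := by
    intro a b c n
    simp
    abel
  refine (key _ _ _ _).trans (congrArg₂ (· + ·) (congrArg₂ (· - ·) ?_ ?_) (congrArg (_ • ·) ?_))
  · exact map_congr_one l (map_congr_two l rfl rfl)
  · exact map_congr_two l (map_congr_one l rfl) rfl
  · exact map_congr_two l (map_congr_one l rfl) rfl

/-- The terms with inner arity one or three involve `l 3`, so only the three unshuffles of type `(2,
1)` contribute. -/
theorem jacobiator_three (hl : l 3 = 0) (d : Fin 3 → ℕ) (x : Fin 3 → L) :
    jacobiator l 3 d x = l 2 ![l 2 ![x 0, x 1], x 2] -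
      ((-1 : ℤ) ^ (d 1 * d 2)) • l 2 ![l 2 ![x 0, x 2], x 1] +
      ((-1 : ℤ) ^ (d 0 * d 1) * (-1 : ℤ) ^ (d 0 * d 2)) • l 2 ![l 2 ![x 1, x 2], x 0] := by
  rw [jacobiator_eq, Fin.sum_univ_three]
  have h2 : (Finset.univ.filter fun σ : Equiv.Perm (Fin 3) => IsUnshuffle 2 σ) =
    {1, Equiv.swap 1 2, Equiv.swap 0 1 * Equiv.swap 1 2} := by decide
  simp only [Fin.val_zero, Fin.val_one, Fin.val_two, Nat.zero_add, Nat.reduceAdd, h2]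
  rw [Finset.sum_insert (by decide), Finset.sum_pair (by decide)]
  have e2 : koszulSign d (Equiv.swap 1 2) = (-1) ^ (d 1 * d 2) := by
    have h0 : Equiv.swap (1 : Fin 3) 2 0 = 0 := by decide
    have h1 : Equiv.swap (1 : Fin 3) 2 1 = 2 := by decide
    have h2 : Equiv.swap (1 : Fin 3) 2 2 = 1 := by decide
    simp [koszulSign, Fintype.prod_prod_type, Fin.prod_univ_three, h0, h1, h2, mul_comm]
  have e3 : koszulSign d (Equiv.swap 0 1 * Equiv.swap 1 2) =
      (-1) ^ (d 0 * d 1) * (-1) ^ (d 0 * d 2) := by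
    have h0 : (Equiv.swap 0 1 * Equiv.swap 1 2 : Equiv.Perm (Fin 3)) 0 = 1 := by decide
    have h1 : (Equiv.swap 0 1 * Equiv.swap 1 2 : Equiv.Perm (Fin 3)) 1 = 2 := by decide
    have h2 : (Equiv.swap 0 1 * Equiv.swap 1 2 : Equiv.Perm (Fin 3)) 2 = 0 := by decide
    generalize (Equiv.swap 0 1 * Equiv.swap 1 2 : Equiv.Perm (Fin 3)) = σ at h0 h1 h2
    simp [koszulSign, Fintype.prod_prod_type, Fin.prod_univ_three, h0, h1, h2, mul_comm]
  have s2 : Equiv.Perm.sign (Equiv.swap (1 : Fin 3) 2) = -1 := Equiv.Perm.sign_swap (by decide)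
  have s3 : Equiv.Perm.sign (Equiv.swap (0 : Fin 3) 1 * Equiv.swap 1 2) = 1 := by
    rw [map_mul, s2, Equiv.Perm.sign_swap (by decide)]; rfl
  rw [Finset.sum_eq_zero (s := Finset.univ.filter fun σ : Equiv.Perm (Fin 3) => IsUnshuffle 1 σ),
    Finset.sum_eq_zero (s := Finset.univ.filter fun σ : Equiv.Perm (Fin 3) => IsUnshuffle 3 σ)]
  · simp only [koszulSign_one, e2, e3, s2, s3, Equiv.Perm.sign_one]
    have key : ∀ (a b c : L) (n n' : ℤ) (p q : ℕ), ((-1 : ℤ) ^ p) • (0 : L) + ((-1 : ℤ) ^ 2) •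
        ((((1 : ℤˣ) : ℤ) * 1) • a + ((((-1 : ℤˣ) : ℤ) * n) • b + (((1 : ℤˣ) : ℤ) * n') • c)) +
        ((-1 : ℤ) ^ q) • (0 : L) = a - n • b + n' • c := by
      intro a b c n n' p q
      simp
      abel
    refine (key _ _ _ _ _ _ _).trans (congrArg₂ (· + ·) (congrArg₂ (· - ·) ?_
      (congrArg (_ • ·) ?_)) (congrArg (_ • ·) ?_))
    · exact map_congr_two l (map_congr_two l rfl rfl) rfl
    · exact map_congr_two l (map_congr_two l rfl rfl) rfl
    · exact map_congr_two l (map_congr_two l rfl rfl) rfl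
  · intro σ _
    rw [hl, zero_apply, (l _).map_coord_zero 0 rfl, smul_zero]
  · intro σ _
    rw [show l (3 - 1 + 1) = 0 from hl, zero_apply, smul_zero]

end Jacobiator

/-! ### Graded commutators in an associative algebra. -/

/-- A representation of a vector space `G` with a unary and a binary operation by operators with an
even and an odd part, under which the operations become the graded commutator with an odd operator
`diff` of square zero and the graded commutator. -/
structure GradedOperatorModel (G 𝒜 : Type*) [AddCommGroup G] [Module ℝ G] [Ring 𝒜]
    [Algebra ℝ 𝒜] where
  ev : G →ₗ[ℝ] 𝒜
  od : G →ₗ[ℝ] 𝒜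
  ext : ∀ {z w : G}, ev z = ev w → od z = od w → z = w
  diff : 𝒜
  diff_mul_diff : diff * diff = 0
  d : G → G
  br : G → G → G
  ev_d : ∀ z, ev (d z) = diff * od z + od z * diff
  od_d : ∀ z, od (d z) = diff * ev z - ev z * diff
  ev_br : ∀ z w, ev (br z w) = ev z * ev w - ev w * ev z + (od z * od w + od w * od z)
  od_br : ∀ z w, od (br z w) = ev z * od w - od w * ev z + (od z * ev w - ev w * od z)

namespace GradedOperatorModel

variable {G 𝒜 : Type*} [AddCommGroup G] [Module ℝ G] [Ring 𝒜] [Algebra ℝ 𝒜]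
  (S : GradedOperatorModel G 𝒜)

/-- The differential as a linear map. -/
def dLin : G →ₗ[ℝ] G where
  toFun := S.d
  map_add' z w := S.ext (by simp only [S.ev_d, map_add]; noncomm_ring)
    (by simp only [S.od_d, map_add]; noncomm_ring)
  map_smul' c z := S.ext
    (by simp only [S.ev_d, map_smul, mul_smul_comm, smul_mul_assoc, smul_add, RingHom.id_apply])
    (by simp only [S.od_d, map_smul, mul_smul_comm, smul_mul_assoc, smul_sub, RingHom.id_apply])

/-- Bilinearity is not assumed of `br`; it is inherited from `𝒜` by faithfulness. -/
theorem br_add_left (z z' w : G) : S.br (z + z') w = S.br z w + S.br z' w :=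
  S.ext (by simp only [S.ev_br, map_add]; noncomm_ring)
    (by simp only [S.od_br, map_add]; noncomm_ring)

theorem br_add_right (z w w' : G) : S.br z (w + w') = S.br z w + S.br z w' :=
  S.ext (by simp only [S.ev_br, map_add]; noncomm_ring)
    (by simp only [S.od_br, map_add]; noncomm_ring)

theorem br_smul_left (c : ℝ) (z w : G) : S.br (c • z) w = c • S.br z w :=
  S.ext
    (by simp only [S.ev_br, map_smul, mul_smul_comm, smul_mul_assoc, smul_add, smul_sub])
    (by simp only [S.od_br, map_smul, mul_smul_comm, smul_mul_assoc, smul_add, smul_sub])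

theorem br_smul_right (c : ℝ) (z w : G) : S.br z (c • w) = c • S.br z w :=
  S.ext
    (by simp only [S.ev_br, map_smul, mul_smul_comm, smul_mul_assoc, smul_add, smul_sub])
    (by simp only [S.od_br, map_smul, mul_smul_comm, smul_mul_assoc, smul_add, smul_sub])

/-- The binary bracket as a multilinear map. -/
def brMulti : MultilinearMap ℝ (fun _ : Fin 2 => G) G where
  toFun x := S.br (x 0) (x 1)
  map_update_add' x i y z := by
    fin_cases i <;> simp [Function.update, br_add_left, br_add_right]
  map_update_smul' x i c y := by
    fin_cases i <;> simp [Function.update, br_smul_left, br_smul_right]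

/-- The family of brackets of the model; only those of arity one and two are nonzero. -/
def bracket : ∀ k, MultilinearMap ℝ (fun _ : Fin k => G) G
  | 1 => MultilinearMap.ofSubsingleton ℝ G G (0 : Fin 1) S.dLin
  | 2 => S.brMulti
  | _ => 0

theorem bracket_one (z : G) : S.bracket 1 ![z] = S.d z := rfl

theorem bracket_two (z w : G) : S.bracket 2 ![z, w] = S.br z w := rfl

theorem bracket_of_three_le (k : ℕ) (hk : 3 ≤ k) : S.bracket k = 0 := by
  match k, hk with
  | k + 3, _ => rfl

/-- `z` has the parity of the number `n`. -/
def HasParity (n : ℕ) (z : G) : Prop := (Even n ∧ S.od z = 0) ∨ (Odd n ∧ S.ev z = 0)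

theorem d_d (z : G) : S.d (S.d z) = 0 := by
  have h := S.diff_mul_diff
  have h' : ∀ a, S.diff * (S.diff * a) = 0 := fun a => by rw [← mul_assoc, h, zero_mul]
  refine S.ext ?_ ?_
  · simp only [S.ev_d, S.od_d, map_zero, mul_sub, sub_mul, mul_assoc, h, h', mul_zero]
    noncomm_ring
  · simp only [S.ev_d, S.od_d, map_zero, mul_add, add_mul, mul_assoc, h, h', mul_zero]
    noncomm_ring

/-- Only the parities of the degrees enter the signs. For each choice of parities, faithfulness
turns the identity into one of noncommutative polynomials: the commutator with `diff` is a graded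
derivation, and graded commutators satisfy the Jacobi identity. -/
theorem jacobiator_eq_zero {k : ℕ} (n : Fin k → ℕ) (x : Fin k → G)
    (hx : ∀ j, S.HasParity (n j) (x j)) : jacobiator S.bracket k n x = 0 := by
  match k with
  | 0 => rw [jacobiator_eq]; exact Finset.sum_empty
  | 1 =>
    rw [jacobiator_one, bracket_one, bracket_one, S.d_d]
  | 2 =>
    have h0 := hx 0
    have h1 := hx 1
    rw [jacobiator_two]
    simp only [bracket_one, bracket_two]
    generalize x 0 = a at *
    generalize x 1 = b at *
    rcases h0 with ⟨p0, z0⟩ | ⟨p0, z0⟩ <;> rcases h1 with ⟨p1, z1⟩ | ⟨p1, z1⟩ <;>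
    -- Writing `(-1) ^ (a * b)` as `((-1) ^ a) ^ b` lets the parities evaluate the Koszul sign.
    simp only [pow_mul, p0.neg_one_pow, p1.neg_one_pow, one_pow, one_smul, neg_smul] <;>
    refine S.ext ?_ ?_ <;>
    simp only [map_add, map_sub, map_neg, map_zero, S.ev_d, S.od_d, S.ev_br, S.od_br, z0, z1] <;>
    noncomm_ring
  | 3 =>
    have h0 := hx 0
    have h1 := hx 1
    have h2 := hx 2
    rw [jacobiator_three _ rfl]
    simp only [bracket_two]
    generalize x 0 = a at *
    generalize x 1 = b at *
    generalize x 2 = c at *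
    rcases h0 with ⟨p0, z0⟩ | ⟨p0, z0⟩ <;> rcases h1 with ⟨p1, z1⟩ | ⟨p1, z1⟩ <;>
    rcases h2 with ⟨p2, z2⟩ | ⟨p2, z2⟩ <;>
    simp only [pow_mul, p0.neg_one_pow, p1.neg_one_pow, p2.neg_one_pow, one_pow, one_smul,
      neg_smul, mul_one, mul_neg, neg_neg] <;>
    refine S.ext ?_ ?_ <;>
    simp only [map_add, map_sub, map_neg, map_zero, S.ev_br, S.od_br, z0, z1, z2] <;>
    noncomm_ring
  | k + 4 => exact jacobiator_eq_zero_of_four_le _ S.bracket_of_three_le (by omega) _ _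

theorem bracket_perm {k : ℕ} (n : Fin k → ℕ) (x : Fin k → G)
    (hx : ∀ j, S.HasParity (n j) (x j)) (σ : Equiv.Perm (Fin k)) :
    S.bracket k x =
      ((Equiv.Perm.sign σ : ℤ) * koszulSign n σ) • S.bracket k fun j => x (σ j) := by
  match k with
  | 0 => rw [show S.bracket 0 = 0 from rfl, zero_apply, zero_apply, smul_zero]
  | 1 =>
    rw [Subsingleton.elim σ 1, koszulSign_one, Equiv.Perm.sign_one]
    simp
  | 2 =>
    have hσ : σ = 1 ∨ σ = Equiv.swap 0 1 := by revert σ; decide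
    rcases hσ with rfl | rfl
    · rw [koszulSign_one, Equiv.Perm.sign_one]
      simp
    · rw [Equiv.Perm.sign_swap (by decide), koszulSign_swap]
      change S.br (x 0) (x 1) = _ • S.br (x 1) (x 0)
      have h0 := hx 0
      have h1 := hx 1
      generalize x 0 = a at *
      generalize x 1 = b at *
      rcases h0 with ⟨p0, z0⟩ | ⟨p0, z0⟩ <;> rcases h1 with ⟨p1, z1⟩ | ⟨p1, z1⟩ <;>
      simp only [pow_mul, p0.neg_one_pow, p1.neg_one_pow, one_pow, one_smul, neg_smul, mul_one,
        mul_neg, neg_neg, Units.val_neg, Units.val_one] <;>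
      refine S.ext ?_ ?_ <;>
      simp only [map_neg, S.ev_br, S.od_br, z0, z1] <;>
      noncomm_ring
  | k + 3 =>
    rw [S.bracket_of_three_le _ (by omega), zero_apply, zero_apply, smul_zero]

end GradedOperatorModel

/-! ### Calculus of symbols, bundle maps and operators. -/

namespace SmoothVectorBundle

variable {m : ℕ} {M : Type u} [TopologicalSpace M]
  [ChartedSpace (EuclideanSpace ℝ (Fin m)) M]

theorem algebraMap_smul_sec (V : SmoothVectorBundle.{u, v} m M) (c : ℝ) (s : V.Sec) :
    algebraMap ℝ C^∞⟮𝓡 m, M; ℝ⟯ c • s = c • s := by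
  ext x; rfl

section LieDerivative

theorem mdifferentiableAt_function (f : C^∞⟮𝓡 m, M; ℝ⟯) (x : M) :
    MDifferentiableAt (𝓡 m) 𝓘(ℝ, ℝ) f x :=
  f.contMDiff.mdifferentiable (by simp) x

variable [IsManifold (𝓡 m) ∞ M] (X : (tangent m M).Sec)

theorem lieDeriv_add_right (f g : C^∞⟮𝓡 m, M; ℝ⟯) :
    lieDeriv X (f + g) = lieDeriv X f + lieDeriv X g := by
  ext x
  have h := mfderiv_add (mdifferentiableAt_function f x) (mdifferentiableAt_function g x)
  exact congrArg (fun L : TangentSpace (𝓡 m) x →L[ℝ] ℝ =>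
    L (show TangentSpace (𝓡 m) x from X x)) h

theorem lieDeriv_mul (f g : C^∞⟮𝓡 m, M; ℝ⟯) :
    lieDeriv X (f * g) = f * lieDeriv X g + lieDeriv X f * g := by
  ext x
  have h := ((mdifferentiableAt_function f x).hasMFDerivAt.mul
    (mdifferentiableAt_function g x).hasMFDerivAt).mfderiv
  refine (congrArg (fun L : TangentSpace (𝓡 m) x →L[ℝ] ℝ =>
    L (show TangentSpace (𝓡 m) x from X x)) h).trans ?_
  change f x * _ + g x * _ = f x * _ + _ * g x
  rw [mul_comm (g x)]
  rfl

theorem lieDeriv_algebraMap (c : ℝ) : lieDeriv X (algebraMap ℝ C^∞⟮𝓡 m, M; ℝ⟯ c) = 0 := by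
  ext x
  have h : mfderiv (𝓡 m) 𝓘(ℝ, ℝ) (algebraMap ℝ C^∞⟮𝓡 m, M; ℝ⟯ c) x = 0 :=
    mfderiv_const (I := 𝓡 m) (I' := 𝓘(ℝ, ℝ)) (c := c)
  rw [lieDeriv_apply, h]
  rfl

theorem lieDeriv_smul_right (c : ℝ) (f : C^∞⟮𝓡 m, M; ℝ⟯) :
    lieDeriv X (c • f) = c • lieDeriv X f := by
  rw [Algebra.smul_def, lieDeriv_mul, lieDeriv_algebraMap, zero_mul, add_zero, Algebra.smul_def]

theorem lieDeriv_zero_right : lieDeriv X (0 : C^∞⟮𝓡 m, M; ℝ⟯) = 0 := by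
  simpa only [map_zero] using lieDeriv_algebraMap X 0

theorem lieDeriv_smul_left (c : ℝ) (f : C^∞⟮𝓡 m, M; ℝ⟯) :
    lieDeriv (c • X) f = c • lieDeriv X f := by
  rw [← algebraMap_smul_sec, lieDeriv_smul, Algebra.smul_def]

end LieDerivative

section Act

variable {V : SmoothVectorBundle.{u, v} m M} {W : SmoothVectorBundle.{u, w} m M}

theorem act_real_smul (θ : (V.hom W).Sec) (c : ℝ) (e : V.Sec) :
    θ.act (c • e) = c • θ.act e := by
  rw [← algebraMap_smul_sec, act_smul, algebraMap_smul_sec]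

theorem act_sub (θ : (V.hom W).Sec) (e e' : V.Sec) : θ.act (e - e') = θ.act e - θ.act e' :=
  map_sub (⟨⟨θ.act, act_zero θ⟩, act_add θ⟩ : V.Sec →+ W.Sec) e e'

variable [IsManifold (𝓡 m) ∞ M] [T2Space M]

/-- The section of `Hom(V, W)` that corresponds to a function linear map `Γ(V) → Γ(W)`. -/
def homOfLinear (Φ : V.Sec →ₗ[C^∞⟮𝓡 m, M; ℝ⟯] W.Sec) : (V.hom W).Sec :=
  homOfTensorial Φ (map_add Φ) (map_smul Φ)

theorem homOfLinear_act (Φ : V.Sec →ₗ[C^∞⟮𝓡 m, M; ℝ⟯] W.Sec) (e : V.Sec) :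
    (homOfLinear Φ).act e = Φ e :=
  homOfTensorial_act _ _ _ e

end Act

end SmoothVectorBundle

namespace ThreeTermComplex

open SmoothVectorBundle

variable {m : ℕ} {M : Type u} [TopologicalSpace M]
  [ChartedSpace (EuclideanSpace ℝ (Fin m)) M]
  {𝓔 : ThreeTermComplex.{u, v} m M}

section Endomorphisms

theorem map₀₁_add_left (θ θ' : 𝓔.endOne.Sec) (e) : map₀₁ (θ + θ') e = map₀₁ θ e + map₀₁ θ' e := by
  ext x; rfl

theorem map₁₂_add_left (θ θ' : 𝓔.endOne.Sec) (e) : map₁₂ (θ + θ') e = map₁₂ θ e + map₁₂ θ' e := by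
  ext x; rfl

theorem map₀₂_add_left (θ θ' : 𝓔.endTwo.Sec) (e) : map₀₂ (θ + θ') e = map₀₂ θ e + map₀₂ θ' e := by
  ext x; rfl

theorem map₀₁_smul_left (f : C^∞⟮𝓡 m, M; ℝ⟯) (θ : 𝓔.endOne.Sec) (e) :
    map₀₁ (f • θ) e = f • map₀₁ θ e := by
  ext x; rfl

theorem map₁₂_smul_left (f : C^∞⟮𝓡 m, M; ℝ⟯) (θ : 𝓔.endOne.Sec) (e) :
    map₁₂ (f • θ) e = f • map₁₂ θ e := by
  ext x; rfl

theorem map₀₂_smul_left (f : C^∞⟮𝓡 m, M; ℝ⟯) (θ : 𝓔.endTwo.Sec) (e) :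
    map₀₂ (f • θ) e = f • map₀₂ θ e := by
  ext x; rfl

theorem map₀₁_zero_left (e : 𝓔.E₀.Sec) : map₀₁ (0 : 𝓔.endOne.Sec) e = 0 := by
  ext x; rfl

theorem map₁₂_zero_left (e : 𝓔.E₁.Sec) : map₁₂ (0 : 𝓔.endOne.Sec) e = 0 := by
  ext x; rfl

theorem map₀₂_zero_left (e : 𝓔.E₀.Sec) : map₀₂ (0 : 𝓔.endTwo.Sec) e = 0 := by
  ext x; rfl

theorem map₀₁_add (θ : 𝓔.endOne.Sec) (e e') : map₀₁ θ (e + e') = map₀₁ θ e + map₀₁ θ e' :=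
  act_add _ _ _

theorem map₁₂_add (θ : 𝓔.endOne.Sec) (e e') : map₁₂ θ (e + e') = map₁₂ θ e + map₁₂ θ e' :=
  act_add _ _ _

theorem map₀₂_add (θ : 𝓔.endTwo.Sec) (e e') : map₀₂ θ (e + e') = map₀₂ θ e + map₀₂ θ e' :=
  act_add (V := 𝓔.E₀) (W := 𝓔.E₂) θ _ _

theorem map₀₁_smul (θ : 𝓔.endOne.Sec) (f : C^∞⟮𝓡 m, M; ℝ⟯) (e) :
    map₀₁ θ (f • e) = f • map₀₁ θ e :=
  act_smul _ _ _

theorem map₁₂_smul (θ : 𝓔.endOne.Sec) (f : C^∞⟮𝓡 m, M; ℝ⟯) (e) :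
    map₁₂ θ (f • e) = f • map₁₂ θ e :=
  act_smul _ _ _

theorem map₀₂_smul (θ : 𝓔.endTwo.Sec) (f : C^∞⟮𝓡 m, M; ℝ⟯) (e) :
    map₀₂ θ (f • e) = f • map₀₂ θ e :=
  act_smul (V := 𝓔.E₀) (W := 𝓔.E₂) θ _ _

theorem map₀₁_zero (θ : 𝓔.endOne.Sec) : map₀₁ θ 0 = 0 := act_zero _

theorem map₁₂_zero (θ : 𝓔.endOne.Sec) : map₁₂ θ 0 = 0 := act_zero _

theorem map₀₂_zero (θ : 𝓔.endTwo.Sec) : map₀₂ θ 0 = 0 := act_zero (V := 𝓔.E₀) (W := 𝓔.E₂) θ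

theorem map₀₁_real_smul (θ : 𝓔.endOne.Sec) (c : ℝ) (e) : map₀₁ θ (c • e) = c • map₀₁ θ e :=
  act_real_smul _ _ _

theorem map₁₂_real_smul (θ : 𝓔.endOne.Sec) (c : ℝ) (e) : map₁₂ θ (c • e) = c • map₁₂ θ e :=
  act_real_smul _ _ _

theorem map₀₂_real_smul (θ : 𝓔.endTwo.Sec) (c : ℝ) (e) : map₀₂ θ (c • e) = c • map₀₂ θ e :=
  act_real_smul (V := 𝓔.E₀) (W := 𝓔.E₂) θ _ _

variable [IsManifold (𝓡 m) ∞ M] [T2Space M]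

theorem endOne_ext {θ θ' : 𝓔.endOne.Sec} (h1 : ∀ e, map₀₁ θ e = map₀₁ θ' e)
    (h2 : ∀ e, map₁₂ θ e = map₁₂ θ' e) : θ = θ' :=
  Sec.pair_ext (V := 𝓔.E₀.hom 𝓔.E₁) (W := 𝓔.E₁.hom 𝓔.E₂) (act_injective h1) (act_injective h2)

theorem endTwo_ext {θ θ' : 𝓔.endTwo.Sec} (h : ∀ e, map₀₂ θ e = map₀₂ θ' e) : θ = θ' :=
  act_injective (V := 𝓔.E₀) (W := 𝓔.E₂) h

/-- The section of `End⁻¹` with given actions. -/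
def endOneOfLinear (Φ : 𝓔.E₀.Sec →ₗ[C^∞⟮𝓡 m, M; ℝ⟯] 𝓔.E₁.Sec)
    (Ψ : 𝓔.E₁.Sec →ₗ[C^∞⟮𝓡 m, M; ℝ⟯] 𝓔.E₂.Sec) : 𝓔.endOne.Sec :=
  Sec.pair (homOfLinear Φ) (homOfLinear Ψ)

/-- The section of `End⁻²` with given action. -/
def endTwoOfLinear (Φ : 𝓔.E₀.Sec →ₗ[C^∞⟮𝓡 m, M; ℝ⟯] 𝓔.E₂.Sec) : 𝓔.endTwo.Sec :=
  homOfLinear Φ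

theorem map₀₁_endOneOfLinear (Φ : 𝓔.E₀.Sec →ₗ[C^∞⟮𝓡 m, M; ℝ⟯] 𝓔.E₁.Sec)
    (Ψ : 𝓔.E₁.Sec →ₗ[C^∞⟮𝓡 m, M; ℝ⟯] 𝓔.E₂.Sec) (e) : map₀₁ (endOneOfLinear Φ Ψ) e = Φ e :=
  homOfLinear_act Φ e

theorem map₁₂_endOneOfLinear (Φ : 𝓔.E₀.Sec →ₗ[C^∞⟮𝓡 m, M; ℝ⟯] 𝓔.E₁.Sec)
    (Ψ : 𝓔.E₁.Sec →ₗ[C^∞⟮𝓡 m, M; ℝ⟯] 𝓔.E₂.Sec) (e) : map₁₂ (endOneOfLinear Φ Ψ) e = Ψ e :=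
  homOfLinear_act Ψ e

theorem map₀₂_endTwoOfLinear (Φ : 𝓔.E₀.Sec →ₗ[C^∞⟮𝓡 m, M; ℝ⟯] 𝓔.E₂.Sec) (e) :
    map₀₂ (endTwoOfLinear Φ) e = Φ e :=
  homOfLinear_act Φ e

end Endomorphisms

namespace DevPiBundle

variable [IsManifold (𝓡 m) ∞ M] (𝔇 : 𝓔.DevPiBundle)

theorem toCdo_mem (s : 𝔇.bundle.Sec) : (𝔇.toCdo s : 𝓔.Quad) ∈ 𝓔.cdoPi := (𝔇.toCdo s).2

theorem op₀_smul (s : 𝔇.bundle.Sec) (f : C^∞⟮𝓡 m, M; ℝ⟯) (e) :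
    𝔇.op₀ s (f • e) = f • 𝔇.op₀ s e + lieDeriv (𝔇.symbol s) f • e :=
  (𝔇.toCdo_mem s).1.1 f e

theorem op₁_smul (s : 𝔇.bundle.Sec) (f : C^∞⟮𝓡 m, M; ℝ⟯) (e) :
    𝔇.op₁ s (f • e) = f • 𝔇.op₁ s e + lieDeriv (𝔇.symbol s) f • e :=
  (𝔇.toCdo_mem s).1.2.1 f e

theorem op₂_smul (s : 𝔇.bundle.Sec) (f : C^∞⟮𝓡 m, M; ℝ⟯) (e) :
    𝔇.op₂ s (f • e) = f • 𝔇.op₂ s e + lieDeriv (𝔇.symbol s) f • e :=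
  (𝔇.toCdo_mem s).1.2.2 f e

theorem op₀_π₁ (s : 𝔇.bundle.Sec) (e) : 𝔇.op₀ s (𝓔.π₁.act e) = 𝓔.π₁.act (𝔇.op₁ s e) :=
  (𝔇.toCdo_mem s).2.1 e

theorem op₁_π₂ (s : 𝔇.bundle.Sec) (e) : 𝔇.op₁ s (𝓔.π₂.act e) = 𝓔.π₂.act (𝔇.op₂ s e) :=
  (𝔇.toCdo_mem s).2.2 e

theorem symbol_add (s t : 𝔇.bundle.Sec) : 𝔇.symbol (s + t) = 𝔇.symbol s + 𝔇.symbol t := by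
  simp only [symbol, map_add]; rfl

theorem op₀_add (s t : 𝔇.bundle.Sec) : 𝔇.op₀ (s + t) = 𝔇.op₀ s + 𝔇.op₀ t := by
  simp only [op₀, map_add]; rfl

theorem op₁_add (s t : 𝔇.bundle.Sec) : 𝔇.op₁ (s + t) = 𝔇.op₁ s + 𝔇.op₁ t := by
  simp only [op₁, map_add]; rfl

theorem op₂_add (s t : 𝔇.bundle.Sec) : 𝔇.op₂ (s + t) = 𝔇.op₂ s + 𝔇.op₂ t := by
  simp only [op₂, map_add]; rfl

theorem symbol_smul (f : C^∞⟮𝓡 m, M; ℝ⟯) (s : 𝔇.bundle.Sec) :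
    𝔇.symbol (f • s) = f • 𝔇.symbol s := by
  simp only [symbol, map_smul]; rfl

theorem op₀_smul_left (f : C^∞⟮𝓡 m, M; ℝ⟯) (s : 𝔇.bundle.Sec) : 𝔇.op₀ (f • s) = f • 𝔇.op₀ s := by
  simp only [op₀, map_smul]; rfl

theorem op₁_smul_left (f : C^∞⟮𝓡 m, M; ℝ⟯) (s : 𝔇.bundle.Sec) : 𝔇.op₁ (f • s) = f • 𝔇.op₁ s := by
  simp only [op₁, map_smul]; rfl

theorem op₂_smul_left (f : C^∞⟮𝓡 m, M; ℝ⟯) (s : 𝔇.bundle.Sec) : 𝔇.op₂ (f • s) = f • 𝔇.op₂ s := by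
  simp only [op₂, map_smul]; rfl

theorem symbol_zero : 𝔇.symbol 0 = 0 := by
  simp only [symbol, map_zero]; rfl

theorem op₀_zero : 𝔇.op₀ 0 = 0 := by
  simp only [op₀, map_zero]; rfl

theorem op₁_zero : 𝔇.op₁ 0 = 0 := by
  simp only [op₁, map_zero]; rfl

theorem op₂_zero : 𝔇.op₂ 0 = 0 := by
  simp only [op₂, map_zero]; rfl

/-- The section of `𝔇_π` given by a covariant differential operator. -/
def ofCdo (D : 𝓔.Quad) (h : D ∈ 𝓔.cdoPi) : 𝔇.bundle.Sec := 𝔇.toCdo.symm ⟨D, h⟩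

theorem symbol_ofCdo (D : 𝓔.Quad) (h : D ∈ 𝓔.cdoPi) : 𝔇.symbol (𝔇.ofCdo D h) = D.1 := by
  rw [symbol, ofCdo, LinearEquiv.apply_symm_apply]

theorem op₀_ofCdo (D : 𝓔.Quad) (h : D ∈ 𝓔.cdoPi) : 𝔇.op₀ (𝔇.ofCdo D h) = D.2.1 := by
  rw [op₀, ofCdo, LinearEquiv.apply_symm_apply]

theorem op₁_ofCdo (D : 𝓔.Quad) (h : D ∈ 𝓔.cdoPi) : 𝔇.op₁ (𝔇.ofCdo D h) = D.2.2.1 := by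
  rw [op₁, ofCdo, LinearEquiv.apply_symm_apply]

theorem op₂_ofCdo (D : 𝓔.Quad) (h : D ∈ 𝓔.cdoPi) : 𝔇.op₂ (𝔇.ofCdo D h) = D.2.2.2 := by
  rw [op₂, ofCdo, LinearEquiv.apply_symm_apply]

theorem sec_ext [T2Space M] {s t : 𝔇.bundle.Sec}
    (h : ∀ f, lieDeriv (𝔇.symbol s) f = lieDeriv (𝔇.symbol t) f)
    (h0 : ∀ e, 𝔇.op₀ s e = 𝔇.op₀ t e) (h1 : ∀ e, 𝔇.op₁ s e = 𝔇.op₁ t e)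
    (h2 : ∀ e, 𝔇.op₂ s e = 𝔇.op₂ t e) : s = t :=
  𝔇.toCdo.injective (Subtype.ext (Prod.ext (lieDeriv_injective h)
    (Prod.ext (LinearMap.ext h0) (Prod.ext (LinearMap.ext h1) (LinearMap.ext h2)))))

end DevPiBundle

end ThreeTermComplex

/-! ### The faithful action on functions and sections of the complex. -/

namespace ThreeTermComplex

open SmoothVectorBundle

variable {m : ℕ} {M : Type u} [TopologicalSpace M]
  [ChartedSpace (EuclideanSpace ℝ (Fin m)) M]
  {𝓔 : ThreeTermComplex.{u, v} m M}

/-- The space `C^∞(M) ⊕ Γ(E₀) ⊕ Γ(E₁) ⊕ Γ(E₂)` on which the graded sections act. -/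
abbrev Total (𝓔 : ThreeTermComplex.{u, v} m M) : Type (max u v) :=
  C^∞⟮𝓡 m, M; ℝ⟯ × 𝓔.E₀.Sec × 𝓔.E₁.Sec × 𝓔.E₂.Sec

/-- The differential of the complex as an operator on `Total`. -/
def totalDiff (𝓔 : ThreeTermComplex.{u, v} m M) : Module.End ℝ 𝓔.Total where
  toFun p := (0, 𝓔.π₁.act p.2.2.1, 𝓔.π₂.act p.2.2.2, 0)
  map_add' p q := by
    simp only [Prod.fst_add, Prod.snd_add, act_add, Prod.mk_add_mk, add_zero]
  map_smul' c p := by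
    simp only [Prod.smul_fst, Prod.smul_snd, act_real_smul, Prod.smul_mk, smul_zero,
      RingHom.id_apply]

theorem totalDiff_mul_totalDiff : 𝓔.totalDiff * 𝓔.totalDiff = 0 := by
  refine LinearMap.ext fun p => ?_
  change ((0 : C^∞⟮𝓡 m, M; ℝ⟯), 𝓔.π₁.act (𝓔.π₂.act p.2.2.2), 𝓔.π₂.act 0, (0 : 𝓔.E₂.Sec)) = 0
  rw [𝓔.comp_eq_zero, act_zero]
  rfl

namespace DevPiBundle

variable [IsManifold (𝓡 m) ∞ M] (𝔇 : 𝓔.DevPiBundle)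

theorem op₀_real_smul_left (c : ℝ) (s : 𝔇.bundle.Sec) (e) : 𝔇.op₀ (c • s) e = c • 𝔇.op₀ s e := by
  rw [← algebraMap_smul_sec, op₀_smul_left, ← algebraMap_smul_sec]; rfl

theorem op₁_real_smul_left (c : ℝ) (s : 𝔇.bundle.Sec) (e) : 𝔇.op₁ (c • s) e = c • 𝔇.op₁ s e := by
  rw [← algebraMap_smul_sec, op₁_smul_left, ← algebraMap_smul_sec]; rfl

theorem op₂_real_smul_left (c : ℝ) (s : 𝔇.bundle.Sec) (e) : 𝔇.op₂ (c • s) e = c • 𝔇.op₂ s e := by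
  rw [← algebraMap_smul_sec, op₂_smul_left, ← algebraMap_smul_sec]; rfl

theorem symbol_real_smul (c : ℝ) (s : 𝔇.bundle.Sec) : 𝔇.symbol (c • s) = c • 𝔇.symbol s := by
  rw [← algebraMap_smul_sec, symbol_smul, algebraMap_smul_sec]

theorem out₀_add (z w : 𝔇.GSec) : 𝔇.out₀ (z + w) = 𝔇.out₀ z + 𝔇.out₀ w := rfl
theorem out₁_add (z w : 𝔇.GSec) : 𝔇.out₁ (z + w) = 𝔇.out₁ z + 𝔇.out₁ w := rfl
theorem out₂_add (z w : 𝔇.GSec) : 𝔇.out₂ (z + w) = 𝔇.out₂ z + 𝔇.out₂ w := rfl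
theorem out₀_real_smul (c : ℝ) (z : 𝔇.GSec) : 𝔇.out₀ (c • z) = c • 𝔇.out₀ z := rfl
theorem out₁_real_smul (c : ℝ) (z : 𝔇.GSec) : 𝔇.out₁ (c • z) = c • 𝔇.out₁ z := rfl
theorem out₂_real_smul (c : ℝ) (z : 𝔇.GSec) : 𝔇.out₂ (c • z) = c • 𝔇.out₂ z := rfl
theorem out₀_smul (f : C^∞⟮𝓡 m, M; ℝ⟯) (z : 𝔇.GSec) : 𝔇.out₀ (f • z) = f • 𝔇.out₀ z := rfl
theorem out₁_smul (f : C^∞⟮𝓡 m, M; ℝ⟯) (z : 𝔇.GSec) : 𝔇.out₁ (f • z) = f • 𝔇.out₁ z := rfl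
theorem out₂_smul (f : C^∞⟮𝓡 m, M; ℝ⟯) (z : 𝔇.GSec) : 𝔇.out₂ (f • z) = f • 𝔇.out₂ z := rfl

/-- The even part of the action of the graded sections on `Total`. -/
def evOp : 𝔇.GSec →ₗ[ℝ] Module.End ℝ 𝓔.Total where
  toFun z :=
    { toFun := fun p => (lieDeriv (𝔇.symbol (𝔇.out₀ z)) p.1, 𝔇.op₀ (𝔇.out₀ z) p.2.1,
        𝔇.op₁ (𝔇.out₀ z) p.2.2.1, 𝔇.op₂ (𝔇.out₀ z) p.2.2.2 + map₀₂ (𝔇.out₂ z) p.2.1)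
      map_add' := fun p q => by
        simp only [Prod.fst_add, Prod.snd_add, map_add, map₀₂_add, lieDeriv_add_right,
          Prod.mk_add_mk, add_add_add_comm]
      map_smul' := fun c p => by
        simp only [Prod.smul_fst, Prod.smul_snd, map_smul, map₀₂_real_smul, lieDeriv_smul_right,
          Prod.smul_mk, smul_add, RingHom.id_apply] }
  map_add' z w := LinearMap.ext fun p => by
    simp only [LinearMap.coe_mk, AddHom.coe_mk, LinearMap.add_apply, out₀_add, out₂_add,
      symbol_add, op₀_add, op₁_add, op₂_add, lieDeriv_add, map₀₂_add_left, Prod.mk_add_mk,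
      add_add_add_comm]
  map_smul' c z := LinearMap.ext fun p => by
    simp only [LinearMap.coe_mk, AddHom.coe_mk, LinearMap.smul_apply, out₀_real_smul,
      out₂_real_smul, symbol_real_smul, op₀_real_smul_left, op₁_real_smul_left,
      op₂_real_smul_left, lieDeriv_smul_left, Prod.smul_mk, smul_add, RingHom.id_apply]
    rw [← algebraMap_smul_sec 𝓔.endTwo, map₀₂_smul_left, algebraMap_smul_sec]

/-- The odd part of the action of the graded sections on `Total`. -/
def odOp : 𝔇.GSec →ₗ[ℝ] Module.End ℝ 𝓔.Total where
  toFun z :=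
    { toFun := fun p => (0, 0, map₀₁ (𝔇.out₁ z) p.2.1, map₁₂ (𝔇.out₁ z) p.2.2.1)
      map_add' := fun p q => by
        simp only [Prod.fst_add, Prod.snd_add, map₀₁_add, map₁₂_add, Prod.mk_add_mk, add_zero]
      map_smul' := fun c p => by
        simp only [Prod.smul_fst, Prod.smul_snd, map₀₁_real_smul, map₁₂_real_smul, smul_zero,
          Prod.smul_mk, RingHom.id_apply] }
  map_add' z w := LinearMap.ext fun p => by
    simp only [LinearMap.coe_mk, AddHom.coe_mk, LinearMap.add_apply, out₁_add, map₀₁_add_left,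
      map₁₂_add_left, Prod.mk_add_mk, add_zero]
  map_smul' c z := LinearMap.ext fun p => by
    simp only [LinearMap.coe_mk, AddHom.coe_mk, LinearMap.smul_apply, out₁_real_smul,
      Prod.smul_mk, smul_zero, RingHom.id_apply]
    rw [← algebraMap_smul_sec 𝓔.endOne, map₀₁_smul_left, map₁₂_smul_left, algebraMap_smul_sec,
      algebraMap_smul_sec]

theorem evOp_apply (z : 𝔇.GSec) (p : 𝓔.Total) : 𝔇.evOp z p =
    (lieDeriv (𝔇.symbol (𝔇.out₀ z)) p.1, 𝔇.op₀ (𝔇.out₀ z) p.2.1, 𝔇.op₁ (𝔇.out₀ z) p.2.2.1,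
      𝔇.op₂ (𝔇.out₀ z) p.2.2.2 + map₀₂ (𝔇.out₂ z) p.2.1) := rfl

theorem odOp_apply (z : 𝔇.GSec) (p : 𝓔.Total) : 𝔇.odOp z p =
    (0, 0, map₀₁ (𝔇.out₁ z) p.2.1, map₁₂ (𝔇.out₁ z) p.2.2.1) := rfl

theorem gsec_ext {z w : 𝔇.GSec} (h0 : 𝔇.out₀ z = 𝔇.out₀ w) (h1 : 𝔇.out₁ z = 𝔇.out₁ w)
    (h2 : 𝔇.out₂ z = 𝔇.out₂ w) : z = w := by
  funext i
  match i with
  | 0 => exact h0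
  | 1 => exact h1
  | 2 => exact h2

/-- The summand `C^∞(M)` detects the symbol even if all three bundles have rank zero. The operator
on `Γ(E₂)` and the `End⁻²` part share a target but are separated by their arguments. -/
theorem evOp_odOp_ext [T2Space M] {z w : 𝔇.GSec} (he : 𝔇.evOp z = 𝔇.evOp w)
    (ho : 𝔇.odOp z = 𝔇.odOp w) : z = w := by
  have he' := fun p => LinearMap.congr_fun he p
  have ho' := fun p => LinearMap.congr_fun ho p
  simp only [evOp_apply, odOp_apply, Prod.mk.injEq] at he' ho'
  refine 𝔇.gsec_ext (𝔇.sec_ext (fun f => (he' (f, 0, 0, 0)).1) (fun e => (he' (0, e, 0, 0)).2.1)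
    (fun e => (he' (0, 0, e, 0)).2.2.1) fun e => ?_)
    (endOne_ext (fun e => (ho' (0, e, 0, 0)).2.2.1) fun e => (ho' (0, 0, e, 0)).2.2.2)
    (endTwo_ext fun e => ?_)
  · simpa only [map₀₂_zero, add_zero] using (he' (0, 0, 0, e)).2.2.2
  · simpa only [map_zero, zero_add] using (he' (0, e, 0, 0)).2.2.2

/-- The graded section with given components. -/
def gsecMk (a : 𝔇.bundle.Sec) (b : 𝓔.endOne.Sec) (c : 𝓔.endTwo.Sec) : 𝔇.GSec
  | 0 => a
  | 1 => b
  | 2 => c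

/-- The component of degree `0` of the differential of a section of `End⁻¹`. -/
def diffOne (θ : 𝓔.endOne.Sec) : 𝔇.bundle.Sec :=
  𝔇.ofCdo (0,
    { toFun := fun e => 𝓔.π₁.act (map₀₁ θ e)
      map_add' := fun e e' => by simp only [map₀₁_add, act_add]
      map_smul' := fun c e => by simp only [map₀₁_real_smul, act_real_smul, RingHom.id_apply] },
    { toFun := fun e => 𝓔.π₂.act (map₁₂ θ e) + map₀₁ θ (𝓔.π₁.act e)
      map_add' := fun e e' => by simp only [map₀₁_add, map₁₂_add, act_add, add_add_add_comm]
      map_smul' := fun c e => by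
        simp only [map₀₁_real_smul, map₁₂_real_smul, act_real_smul, smul_add, RingHom.id_apply] },
    { toFun := fun e => map₁₂ θ (𝓔.π₂.act e)
      map_add' := fun e e' => by simp only [map₁₂_add, act_add]
      map_smul' := fun c e => by
        simp only [map₁₂_real_smul, act_real_smul, RingHom.id_apply] })
    ⟨⟨fun f e => by simp [lieDeriv_zero, map₀₁_smul, act_smul],
      fun f e => by simp [lieDeriv_zero, map₀₁_smul, map₁₂_smul, act_smul],
      fun f e => by simp [lieDeriv_zero, map₁₂_smul, act_smul]⟩,
      -- Since `π² = 0`, both sides reduce to `π ∘ θ ∘ π`, here and in the next condition.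
      fun e => by simp [act_add, 𝓔.comp_eq_zero],
      fun e => by simp [𝓔.comp_eq_zero, map₀₁_zero]⟩

theorem symbol_diffOne (θ : 𝓔.endOne.Sec) : 𝔇.symbol (𝔇.diffOne θ) = 0 :=
  𝔇.symbol_ofCdo _ _

theorem op₀_diffOne (θ : 𝓔.endOne.Sec) (e) :
    𝔇.op₀ (𝔇.diffOne θ) e = 𝓔.π₁.act (map₀₁ θ e) :=
  LinearMap.congr_fun (𝔇.op₀_ofCdo _ _) e

theorem op₁_diffOne (θ : 𝓔.endOne.Sec) (e) :
    𝔇.op₁ (𝔇.diffOne θ) e = 𝓔.π₂.act (map₁₂ θ e) + map₀₁ θ (𝓔.π₁.act e) :=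
  LinearMap.congr_fun (𝔇.op₁_ofCdo _ _) e

theorem op₂_diffOne (θ : 𝓔.endOne.Sec) (e) :
    𝔇.op₂ (𝔇.diffOne θ) e = map₁₂ θ (𝓔.π₂.act e) :=
  LinearMap.congr_fun (𝔇.op₂_ofCdo _ _) e

/-- The commutator of two sections of `𝔇_π`. -/
def commutator (s t : 𝔇.bundle.Sec) : 𝔇.bundle.Sec :=
  𝔇.ofCdo (lieBracket (𝔇.symbol s) (𝔇.symbol t),
    𝔇.op₀ s ∘ₗ 𝔇.op₀ t - 𝔇.op₀ t ∘ₗ 𝔇.op₀ s, 𝔇.op₁ s ∘ₗ 𝔇.op₁ t - 𝔇.op₁ t ∘ₗ 𝔇.op₁ s,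
    𝔇.op₂ s ∘ₗ 𝔇.op₂ t - 𝔇.op₂ t ∘ₗ 𝔇.op₂ s)
    ⟨⟨fun f e => by
        -- The mixed terms, one symbol applied to `f` times the other operator applied to `e`,
        -- cancel in the commutator. The iterated symbols that remain form the Lie bracket applied
        -- to `f`.
        simp only [LinearMap.sub_apply, LinearMap.comp_apply, op₀_smul, map_add,
          lieDeriv_lieBracket, sub_smul, smul_sub]
        abel,
      fun f e => by
        simp only [LinearMap.sub_apply, LinearMap.comp_apply, op₁_smul, map_add,
          lieDeriv_lieBracket, sub_smul, smul_sub]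
        abel,
      fun f e => by
        simp only [LinearMap.sub_apply, LinearMap.comp_apply, op₂_smul, map_add,
          lieDeriv_lieBracket, sub_smul, smul_sub]
        abel⟩,
      fun e => by
        simp only [LinearMap.sub_apply, LinearMap.comp_apply, op₀_π₁, act_sub],
      fun e => by
        simp only [LinearMap.sub_apply, LinearMap.comp_apply, op₁_π₂, act_sub]⟩

theorem symbol_commutator (s t : 𝔇.bundle.Sec) (f) :
    lieDeriv (𝔇.symbol (𝔇.commutator s t)) f =
      lieDeriv (𝔇.symbol s) (lieDeriv (𝔇.symbol t) f) -
        lieDeriv (𝔇.symbol t) (lieDeriv (𝔇.symbol s) f) :=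
  (congrArg (fun X => lieDeriv X f) (𝔇.symbol_ofCdo _ _)).trans (lieDeriv_lieBracket _ _ f)

theorem op₀_commutator (s t : 𝔇.bundle.Sec) (e) :
    𝔇.op₀ (𝔇.commutator s t) e = 𝔇.op₀ s (𝔇.op₀ t e) - 𝔇.op₀ t (𝔇.op₀ s e) :=
  LinearMap.congr_fun (𝔇.op₀_ofCdo _ _) e

theorem op₁_commutator (s t : 𝔇.bundle.Sec) (e) :
    𝔇.op₁ (𝔇.commutator s t) e = 𝔇.op₁ s (𝔇.op₁ t e) - 𝔇.op₁ t (𝔇.op₁ s e) :=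
  LinearMap.congr_fun (𝔇.op₁_ofCdo _ _) e

theorem op₂_commutator (s t : 𝔇.bundle.Sec) (e) :
    𝔇.op₂ (𝔇.commutator s t) e = 𝔇.op₂ s (𝔇.op₂ t e) - 𝔇.op₂ t (𝔇.op₂ s e) :=
  LinearMap.congr_fun (𝔇.op₂_ofCdo _ _) e

variable [T2Space M]

/-- The differential of a section of `End⁻²`. -/
def diffTwo (θ : 𝓔.endTwo.Sec) : 𝓔.endOne.Sec :=
  endOneOfLinear
    { toFun := fun e => 𝓔.π₂.act (map₀₂ θ e)
      map_add' := fun e e' => by simp only [map₀₂_add, act_add]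
      map_smul' := fun f e => by simp only [map₀₂_smul, act_smul, RingHom.id_apply] }
    { toFun := fun e => -map₀₂ θ (𝓔.π₁.act e)
      map_add' := fun e e' => by simp only [map₀₂_add, act_add, neg_add]
      map_smul' := fun f e => by simp only [map₀₂_smul, act_smul, smul_neg, RingHom.id_apply] }

/-- The component of degree `-1` of the bracket. -/
def bracketOne (s t : 𝔇.bundle.Sec) (θ η : 𝓔.endOne.Sec) : 𝓔.endOne.Sec :=
  endOneOfLinear
    { toFun := fun e => 𝔇.op₁ s (map₀₁ η e) - map₀₁ η (𝔇.op₀ s e) -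
        (𝔇.op₁ t (map₀₁ θ e) - map₀₁ θ (𝔇.op₀ t e))
      map_add' := fun e e' => by simp only [map₀₁_add, map_add]; abel
      map_smul' := fun f e => by
        -- Function-linearity: the operators on `Γ(E₀)` and `Γ(E₁)` have the same symbol, so the
        -- derivative terms cancel.
        simp only [map₀₁_smul, map₀₁_add, op₀_smul, op₁_smul, smul_sub, RingHom.id_apply]; abel }
    { toFun := fun e => 𝔇.op₂ s (map₁₂ η e) - map₁₂ η (𝔇.op₁ s e) -
        (𝔇.op₂ t (map₁₂ θ e) - map₁₂ θ (𝔇.op₁ t e))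
      map_add' := fun e e' => by simp only [map₁₂_add, map_add]; abel
      map_smul' := fun f e => by
        simp only [map₁₂_smul, map₁₂_add, op₁_smul, op₂_smul, smul_sub, RingHom.id_apply]; abel }

/-- The component of degree `-2` of the bracket. -/
def bracketTwo (z w : 𝔇.GSec) : 𝓔.endTwo.Sec :=
  endTwoOfLinear
    { toFun := fun e =>
        𝔇.op₂ (𝔇.out₀ z) (map₀₂ (𝔇.out₂ w) e) - map₀₂ (𝔇.out₂ w) (𝔇.op₀ (𝔇.out₀ z) e) -
        (𝔇.op₂ (𝔇.out₀ w) (map₀₂ (𝔇.out₂ z) e) - map₀₂ (𝔇.out₂ z) (𝔇.op₀ (𝔇.out₀ w) e)) +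
        (map₁₂ (𝔇.out₁ z) (map₀₁ (𝔇.out₁ w) e) + map₁₂ (𝔇.out₁ w) (map₀₁ (𝔇.out₁ z) e))
      map_add' := fun e e' => by simp only [map₀₂_add, map₀₁_add, map₁₂_add, map_add]; abel
      map_smul' := fun f e => by
        simp only [map₀₂_smul, map₀₂_add, map₀₁_smul, map₁₂_smul, op₀_smul, op₂_smul, smul_sub,
          smul_add, RingHom.id_apply]
        abel }

theorem map₀₁_diffTwo (θ : 𝓔.endTwo.Sec) (e) :
    map₀₁ (diffTwo θ) e = 𝓔.π₂.act (map₀₂ θ e) :=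
  map₀₁_endOneOfLinear _ _ e

theorem map₁₂_diffTwo (θ : 𝓔.endTwo.Sec) (e) :
    map₁₂ (diffTwo θ) e = -map₀₂ θ (𝓔.π₁.act e) :=
  map₁₂_endOneOfLinear _ _ e

theorem map₀₁_bracketOne (s t : 𝔇.bundle.Sec) (θ η : 𝓔.endOne.Sec) (e) :
    map₀₁ (𝔇.bracketOne s t θ η) e = 𝔇.op₁ s (map₀₁ η e) - map₀₁ η (𝔇.op₀ s e) -
      (𝔇.op₁ t (map₀₁ θ e) - map₀₁ θ (𝔇.op₀ t e)) :=
  map₀₁_endOneOfLinear _ _ e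

theorem map₁₂_bracketOne (s t : 𝔇.bundle.Sec) (θ η : 𝓔.endOne.Sec) (e) :
    map₁₂ (𝔇.bracketOne s t θ η) e = 𝔇.op₂ s (map₁₂ η e) - map₁₂ η (𝔇.op₁ s e) -
      (𝔇.op₂ t (map₁₂ θ e) - map₁₂ θ (𝔇.op₁ t e)) :=
  map₁₂_endOneOfLinear _ _ e

theorem map₀₂_bracketTwo (z w : 𝔇.GSec) (e) : map₀₂ (𝔇.bracketTwo z w) e =
    𝔇.op₂ (𝔇.out₀ z) (map₀₂ (𝔇.out₂ w) e) - map₀₂ (𝔇.out₂ w) (𝔇.op₀ (𝔇.out₀ z) e) -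
    (𝔇.op₂ (𝔇.out₀ w) (map₀₂ (𝔇.out₂ z) e) - map₀₂ (𝔇.out₂ z) (𝔇.op₀ (𝔇.out₀ w) e)) +
    (map₁₂ (𝔇.out₁ z) (map₀₁ (𝔇.out₁ w) e) + map₁₂ (𝔇.out₁ w) (map₀₁ (𝔇.out₁ z) e)) :=
  map₀₂_endTwoOfLinear _ e

/-- The differential on graded sections. -/
def gdiff (z : 𝔇.GSec) : 𝔇.GSec := 𝔇.gsecMk (𝔇.diffOne (𝔇.out₁ z)) (diffTwo (𝔇.out₂ z)) 0

/-- The graded commutator on graded sections. -/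
def gbracket (z w : 𝔇.GSec) : 𝔇.GSec :=
  𝔇.gsecMk (𝔇.commutator (𝔇.out₀ z) (𝔇.out₀ w))
    (𝔇.bracketOne (𝔇.out₀ z) (𝔇.out₀ w) (𝔇.out₁ z) (𝔇.out₁ w)) (𝔇.bracketTwo z w)

theorem out₀_gdiff (z : 𝔇.GSec) : 𝔇.out₀ (𝔇.gdiff z) = 𝔇.diffOne (𝔇.out₁ z) := rfl
theorem out₁_gdiff (z : 𝔇.GSec) : 𝔇.out₁ (𝔇.gdiff z) = diffTwo (𝔇.out₂ z) := rfl
theorem out₂_gdiff (z : 𝔇.GSec) : 𝔇.out₂ (𝔇.gdiff z) = 0 := rfl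
theorem out₀_gbracket (z w : 𝔇.GSec) :
    𝔇.out₀ (𝔇.gbracket z w) = 𝔇.commutator (𝔇.out₀ z) (𝔇.out₀ w) := rfl
theorem out₁_gbracket (z w : 𝔇.GSec) : 𝔇.out₁ (𝔇.gbracket z w) =
    𝔇.bracketOne (𝔇.out₀ z) (𝔇.out₀ w) (𝔇.out₁ z) (𝔇.out₁ w) := rfl
theorem out₂_gbracket (z w : 𝔇.GSec) : 𝔇.out₂ (𝔇.gbracket z w) = 𝔇.bracketTwo z w := rfl

/-- The action of the graded sections on `Total`. -/
def model : GradedOperatorModel 𝔇.GSec (Module.End ℝ 𝓔.Total) where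
  ev := 𝔇.evOp
  od := 𝔇.odOp
  ext := 𝔇.evOp_odOp_ext
  diff := 𝓔.totalDiff
  diff_mul_diff := totalDiff_mul_totalDiff
  d := 𝔇.gdiff
  br := 𝔇.gbracket
  ev_d z := LinearMap.ext fun p => by
    change _ = 𝓔.totalDiff (𝔇.odOp z p) + 𝔇.odOp z (𝓔.totalDiff p)
    simp only [evOp_apply, odOp_apply, totalDiff, LinearMap.coe_mk, AddHom.coe_mk, out₀_gdiff,
      out₂_gdiff, symbol_diffOne, lieDeriv_zero, op₀_diffOne, op₁_diffOne, op₂_diffOne,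
      map₀₂_zero_left, Prod.mk_add_mk, add_zero, zero_add]
  od_d z := LinearMap.ext fun p => by
    change _ = 𝓔.totalDiff (𝔇.evOp z p) - 𝔇.evOp z (𝓔.totalDiff p)
    -- The degree `0` part commutes with `π` and drops out, leaving the differential of the `End⁻²`
    -- part.
    simp only [evOp_apply, odOp_apply, totalDiff, LinearMap.coe_mk, AddHom.coe_mk, out₁_gdiff,
      map₀₁_diffTwo, map₁₂_diffTwo, op₀_π₁, op₁_π₂, act_add, map_zero, Prod.mk_sub_mk, sub_self,
      zero_add, zero_sub, add_sub_cancel_left, lieDeriv_zero_right]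
  ev_br z w := LinearMap.ext fun p => by
    change _ = 𝔇.evOp z (𝔇.evOp w p) - 𝔇.evOp w (𝔇.evOp z p) +
      (𝔇.odOp z (𝔇.odOp w p) + 𝔇.odOp w (𝔇.odOp z p))
    simp only [evOp_apply, odOp_apply, out₀_gbracket, out₂_gbracket, symbol_commutator,
      op₀_commutator, op₁_commutator, op₂_commutator, map₀₂_bracketTwo, map_add, map₀₁_zero,
      Prod.mk_sub_mk, Prod.mk_add_mk, add_zero]
    refine congrArg _ (congrArg _ (congrArg _ ?_))
    abel
  od_br z w := LinearMap.ext fun p => by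
    change _ = 𝔇.evOp z (𝔇.odOp w p) - 𝔇.odOp w (𝔇.evOp z p) +
      (𝔇.odOp z (𝔇.evOp w p) - 𝔇.evOp w (𝔇.odOp z p))
    simp only [evOp_apply, odOp_apply, out₁_gbracket, map₀₁_bracketOne, map₁₂_bracketOne,
      map_zero, map₀₂_zero, lieDeriv_zero_right, Prod.mk_sub_mk, Prod.mk_add_mk, sub_self,
      add_zero]
    refine congrArg _ (congrArg _ (congrArg₂ Prod.mk ?_ ?_)) <;> abel

end DevPiBundle

end ThreeTermComplex

/-! ### Leibniz rules, degrees and the Lie 3-algebroid. -/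

namespace ThreeTermComplex

open SmoothVectorBundle

variable {m : ℕ} {M : Type u} [TopologicalSpace M]
  [ChartedSpace (EuclideanSpace ℝ (Fin m)) M]
  {𝓔 : ThreeTermComplex.{u, v} m M}

theorem totalDiff_smul (f : C^∞⟮𝓡 m, M; ℝ⟯) (p : 𝓔.Total) :
    𝓔.totalDiff (f • p) = f • 𝓔.totalDiff p := by
  change ((0 : C^∞⟮𝓡 m, M; ℝ⟯), 𝓔.π₁.act (f • p.2.2.1), 𝓔.π₂.act (f • p.2.2.2), (0 : 𝓔.E₂.Sec)) =
    (f • (0 : C^∞⟮𝓡 m, M; ℝ⟯), f • 𝓔.π₁.act p.2.2.1, f • 𝓔.π₂.act p.2.2.2, f • (0 : 𝓔.E₂.Sec))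
  rw [act_smul, act_smul, smul_zero, smul_zero]

namespace DevPiBundle

variable [IsManifold (𝓡 m) ∞ M] (𝔇 : 𝓔.DevPiBundle)

theorem evOp_smul_left (f : C^∞⟮𝓡 m, M; ℝ⟯) (z : 𝔇.GSec) (p : 𝓔.Total) :
    𝔇.evOp (f • z) p = f • 𝔇.evOp z p := by
  simp only [evOp_apply, out₀_smul, out₂_smul, symbol_smul, op₀_smul_left, op₁_smul_left,
    op₂_smul_left, lieDeriv_smul, map₀₂_smul_left, LinearMap.smul_apply, Prod.smul_mk, smul_add,
    smul_eq_mul]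

theorem odOp_smul_left (f : C^∞⟮𝓡 m, M; ℝ⟯) (z : 𝔇.GSec) (p : 𝓔.Total) :
    𝔇.odOp (f • z) p = f • 𝔇.odOp z p := by
  simp only [odOp_apply, out₁_smul, map₀₁_smul_left, map₁₂_smul_left, Prod.smul_mk, smul_zero]

theorem evOp_smul (z : 𝔇.GSec) (f : C^∞⟮𝓡 m, M; ℝ⟯) (p : 𝓔.Total) :
    𝔇.evOp z (f • p) = f • 𝔇.evOp z p + lieDeriv (𝔇.symbol (𝔇.out₀ z)) f • p := by
  obtain ⟨g, a, b, c⟩ := p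
  simp only [evOp_apply, Prod.smul_mk, op₀_smul, op₁_smul, op₂_smul, map₀₂_smul, smul_eq_mul,
    lieDeriv_mul, Prod.mk_add_mk, smul_add]
  refine congrArg _ (congrArg _ (congrArg _ ?_))
  abel

theorem odOp_smul (z : 𝔇.GSec) (f : C^∞⟮𝓡 m, M; ℝ⟯) (p : 𝓔.Total) :
    𝔇.odOp z (f • p) = f • 𝔇.odOp z p := by
  simp only [odOp_apply, Prod.smul_fst, Prod.smul_snd, map₀₁_smul, map₁₂_smul, Prod.smul_mk,
    smul_zero]

variable [T2Space M]

theorem evOp_gdiff (z : 𝔇.GSec) (p : 𝓔.Total) : 𝔇.evOp (𝔇.gdiff z) p =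
    𝓔.totalDiff (𝔇.odOp z p) + 𝔇.odOp z (𝓔.totalDiff p) :=
  LinearMap.congr_fun (𝔇.model.ev_d z) p

theorem odOp_gdiff (z : 𝔇.GSec) (p : 𝓔.Total) : 𝔇.odOp (𝔇.gdiff z) p =
    𝓔.totalDiff (𝔇.evOp z p) - 𝔇.evOp z (𝓔.totalDiff p) :=
  LinearMap.congr_fun (𝔇.model.od_d z) p

theorem evOp_gbracket (z w : 𝔇.GSec) (p : 𝓔.Total) : 𝔇.evOp (𝔇.gbracket z w) p =
    𝔇.evOp z (𝔇.evOp w p) - 𝔇.evOp w (𝔇.evOp z p) +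
      (𝔇.odOp z (𝔇.odOp w p) + 𝔇.odOp w (𝔇.odOp z p)) :=
  LinearMap.congr_fun (𝔇.model.ev_br z w) p

theorem odOp_gbracket (z w : 𝔇.GSec) (p : 𝓔.Total) : 𝔇.odOp (𝔇.gbracket z w) p =
    𝔇.evOp z (𝔇.odOp w p) - 𝔇.odOp w (𝔇.evOp z p) +
      (𝔇.odOp z (𝔇.evOp w p) - 𝔇.evOp w (𝔇.odOp z p)) :=
  LinearMap.congr_fun (𝔇.model.od_br z w) p

theorem gdiff_smul (f : C^∞⟮𝓡 m, M; ℝ⟯) (z : 𝔇.GSec) : 𝔇.gdiff (f • z) = f • 𝔇.gdiff z := by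
  refine 𝔇.evOp_odOp_ext (LinearMap.ext fun p => ?_) (LinearMap.ext fun p => ?_)
  · simp only [evOp_smul_left, odOp_smul_left, evOp_gdiff, totalDiff_smul, smul_add]
  · simp only [evOp_smul_left, odOp_smul_left, odOp_gdiff, totalDiff_smul, smul_sub]

/-- In the action, `evOp z` is a derivation over the symbol and `odOp z` is function-linear. Only
the degree `0` part of `z` has a symbol, so this formula yields both the Leibniz rule and
function-linearity in negative degrees. -/
theorem gbracket_smul (z w : 𝔇.GSec) (f : C^∞⟮𝓡 m, M; ℝ⟯) : 𝔇.gbracket z (f • w) =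
    f • 𝔇.gbracket z w + lieDeriv (𝔇.symbol (𝔇.out₀ z)) f • w := by
  refine 𝔇.evOp_odOp_ext (LinearMap.ext fun p => ?_) (LinearMap.ext fun p => ?_)
  · simp only [map_add, LinearMap.add_apply, evOp_smul_left, odOp_smul_left, evOp_gbracket,
      evOp_smul, odOp_smul, smul_add, smul_sub]
    abel
  · simp only [map_add, LinearMap.add_apply, evOp_smul_left, odOp_smul_left, odOp_gbracket,
      evOp_smul, odOp_smul, smul_add, smul_sub]
    abel

/-- The anchor of `𝔇_π`. -/
def anchorHom : ((𝔇.graded 0).hom (tangent m M)).Sec :=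
  homOfLinear (V := 𝔇.bundle)
    { toFun := 𝔇.symbol
      map_add' := 𝔇.symbol_add
      map_smul' := 𝔇.symbol_smul }

theorem anchorHom_act (s : 𝔇.bundle.Sec) :
    Sec.act (V := 𝔇.bundle) 𝔇.anchorHom s = 𝔇.symbol s :=
  homOfLinear_act _ s

theorem hasParity_single (i : Fin 3) (s : (𝔇.graded i).Sec) :
    𝔇.model.HasParity i (Pi.single i s) := by
  have ho (h : (1 : Fin 3) ≠ i) : 𝔇.odOp (Pi.single i s) = 0 := LinearMap.ext fun p => by
    rw [odOp_apply, show 𝔇.out₁ (Pi.single i s) = 0 from Pi.single_eq_of_ne h _,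
      map₀₁_zero_left, map₁₂_zero_left]
    rfl
  have he (h0 : (0 : Fin 3) ≠ i) (h2 : (2 : Fin 3) ≠ i) : 𝔇.evOp (Pi.single i s) = 0 :=
    LinearMap.ext fun p => by
      rw [evOp_apply, show 𝔇.out₀ (Pi.single i s) = 0 from Pi.single_eq_of_ne h0 _,
        show 𝔇.out₂ (Pi.single i s) = 0 from Pi.single_eq_of_ne h2 _, symbol_zero, op₀_zero,
        op₁_zero, op₂_zero, lieDeriv_zero, map₀₂_zero_left]
      exact congrArg _ (congrArg _ (congrArg _ (add_zero _)))
  match i with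
  | 0 => exact Or.inl ⟨by decide, ho (by decide)⟩
  | 1 => exact Or.inr ⟨by decide, he (by decide) (by decide)⟩
  | 2 => exact Or.inl ⟨by decide, ho (by decide)⟩

theorem diffOne_zero : 𝔇.diffOne 0 = 0 := by
  refine 𝔇.sec_ext (fun f => ?_) (fun e => ?_) (fun e => ?_) fun e => ?_
  · rw [symbol_diffOne, symbol_zero]
  · rw [op₀_diffOne, map₀₁_zero_left, act_zero, op₀_zero]; rfl
  · rw [op₁_diffOne, map₁₂_zero_left, map₀₁_zero_left, act_zero, add_zero, op₁_zero]; rfl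
  · rw [op₂_diffOne, map₁₂_zero_left, op₂_zero]; rfl

theorem diffTwo_zero : diffTwo (0 : 𝓔.endTwo.Sec) = 0 := by
  refine endOne_ext (fun e => ?_) fun e => ?_
  · rw [map₀₁_diffTwo, map₀₂_zero_left, act_zero, map₀₁_zero_left]
  · rw [map₁₂_diffTwo, map₀₂_zero_left, neg_zero, map₁₂_zero_left]

theorem commutator_eq_zero {s t : 𝔇.bundle.Sec} (h : s = 0 ∨ t = 0) : 𝔇.commutator s t = 0 := by
  refine 𝔇.sec_ext (fun f => ?_) (fun e => ?_) (fun e => ?_) fun e => ?_ <;>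
  rcases h with rfl | rfl <;>
  simp only [symbol_commutator, op₀_commutator, op₁_commutator, op₂_commutator, symbol_zero,
    op₀_zero, op₁_zero, op₂_zero, lieDeriv_zero, lieDeriv_zero_right, LinearMap.zero_apply,
    map_zero, sub_self]

theorem bracketOne_eq_zero {s t : 𝔇.bundle.Sec} {θ η : 𝓔.endOne.Sec} (h : s = 0 ∨ η = 0)
    (h' : t = 0 ∨ θ = 0) : 𝔇.bracketOne s t θ η = 0 := by
  refine endOne_ext (fun e => ?_) fun e => ?_ <;>
  rcases h with rfl | rfl <;> rcases h' with rfl | rfl <;>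
  simp only [map₀₁_bracketOne, map₁₂_bracketOne, op₀_zero, op₁_zero, op₂_zero,
    LinearMap.zero_apply, map₀₁_zero, map₁₂_zero, map₀₁_zero_left, map₁₂_zero_left, map_zero,
    sub_self]

theorem bracketTwo_eq_zero {z w : 𝔇.GSec} (h : 𝔇.out₀ z = 0 ∨ 𝔇.out₂ w = 0)
    (h' : 𝔇.out₀ w = 0 ∨ 𝔇.out₂ z = 0) (h'' : 𝔇.out₁ z = 0 ∨ 𝔇.out₁ w = 0) :
    𝔇.bracketTwo z w = 0 := by
  refine endTwo_ext fun e => ?_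
  rw [map₀₂_bracketTwo]
  rcases h with h | h <;> rcases h' with h' | h' <;> rcases h'' with h'' | h'' <;>
  simp only [h, h', h'', op₀_zero, op₂_zero, LinearMap.zero_apply, map₁₂_zero, map₀₂_zero,
    map₀₁_zero_left, map₁₂_zero_left, map₀₂_zero_left, map_zero, sub_self, add_zero]

theorem gdiff_single (i : Fin 3) (s : (𝔇.graded i).Sec) (c : Fin 3) (h : (i : ℕ) ≠ c + 1) :
    𝔇.gdiff (Pi.single i s) c = 0 := by
  match c with
  | 0 =>
    refine (congrArg 𝔇.diffOne ?_).trans 𝔇.diffOne_zero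
    exact Pi.single_eq_of_ne (M := fun i => (𝔇.graded i).Sec) (by rintro rfl; exact h rfl) s
  | 1 =>
    refine (congrArg diffTwo ?_).trans diffTwo_zero
    exact Pi.single_eq_of_ne (M := fun i => (𝔇.graded i).Sec) (by rintro rfl; exact h rfl) s
  | 2 => rfl

/-- The component of index `c` is built from products of a component `k` of one argument and `l` of
the other with `k + l = c`; if `i + j ≠ c`, each has a zero factor. -/
theorem gbracket_single (i j : Fin 3) (s : (𝔇.graded i).Sec) (t : (𝔇.graded j).Sec) (c : Fin 3)
    (h : (i : ℕ) + j ≠ c) : 𝔇.gbracket (Pi.single i s) (Pi.single j t) c = 0 := by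
  have h1 (k : Fin 3) (hk : k ≠ i) : (Pi.single i s : 𝔇.GSec) k = 0 :=
    Pi.single_eq_of_ne (M := fun i => (𝔇.graded i).Sec) hk s
  have h2 (k : Fin 3) (hk : k ≠ j) : (Pi.single j t : 𝔇.GSec) k = 0 :=
    Pi.single_eq_of_ne (M := fun i => (𝔇.graded i).Sec) hk t
  have key (k l : Fin 3) (hkl : (k : ℕ) + l = c) :
      (Pi.single i s : 𝔇.GSec) k = 0 ∨ (Pi.single j t : 𝔇.GSec) l = 0 := by
    by_cases hk : k = i
    · refine Or.inr (h2 l ?_)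
      rintro rfl
      exact h (hk ▸ hkl)
    · exact Or.inl (h1 k hk)
  match c with
  | 0 => exact 𝔇.commutator_eq_zero (key 0 0 rfl)
  | 1 => exact 𝔇.bracketOne_eq_zero (key 0 1 rfl) (key 1 0 rfl).symm
  | 2 => exact 𝔇.bracketTwo_eq_zero (key 0 2 rfl) (key 2 0 rfl).symm (key 1 1 rfl)

/-- The strict Lie 3-algebroid of endomorphisms of a three-term complex. -/
def endAlgebroid : SplitLieAlgebroid 3 𝔇.graded where
  anchor := 𝔇.anchorHom
  l := 𝔇.model.bracket
  degree k d s c h := by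
    match k with
    | 0 => rfl
    | 1 =>
      refine 𝔇.gdiff_single (d 0) (s 0) c fun h' => h ?_
      rw [Fin.sum_univ_one, h']
      push_cast
      ring
    | 2 =>
      refine 𝔇.gbracket_single (d 0) (d 1) (s 0) (s 1) c fun h' => h ?_
      rw [Fin.sum_univ_two, ← h']
      push_cast
      ring
    | k + 3 => rfl
  antisymm k d s σ := 𝔇.model.bracket_perm (fun j => (d j : ℕ)) _
    (fun j => 𝔇.hasParity_single (d j) (s j)) σ
  jacobi k d s := 𝔇.model.jacobiator_eq_zero _ _ fun j => 𝔇.hasParity_single (d j) (s j)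
  leibniz X f i Y := by
    change 𝔇.gbracket (Pi.single 0 X) (Pi.single i (f • Y)) =
      f • 𝔇.gbracket (Pi.single 0 X) (Pi.single i Y) + _
    rw [Pi.single_smul, gbracket_smul, Pi.single_smul, ← anchorHom_act]
    rfl
  linear_two i j hi _ X f Y := by
    change 𝔇.gbracket (Pi.single i X) (Pi.single j (f • Y)) =
      f • 𝔇.gbracket (Pi.single i X) (Pi.single j Y)
    rw [Pi.single_smul, gbracket_smul,
      show 𝔇.out₀ (Pi.single i X) = 0 from Pi.single_eq_of_ne hi.symm _, symbol_zero,
      lieDeriv_zero, zero_smul, add_zero]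
  linear k hk x j f := by
    match k with
    | 0 => exact j.elim0
    | 1 =>
      obtain rfl : j = 0 := Subsingleton.elim _ _
      change 𝔇.gdiff (Function.update x 0 (f • x 0) 0) = f • 𝔇.gdiff (x 0)
      rw [Function.update_self, gdiff_smul]
    | 2 => exact absurd rfl hk
    | k + 3 => exact (smul_zero f).symm

theorem isEndAlgebroid : 𝔇.IsEndAlgebroid 𝔇.endAlgebroid where
  strict := 𝔇.model.bracket_of_three_le
  anchor := 𝔇.anchorHom_act
  diff_two θ := ⟨map₀₁_diffTwo θ, map₁₂_diffTwo θ⟩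
  diff_one θ := ⟨𝔇.symbol_diffOne θ, 𝔇.op₀_diffOne θ, 𝔇.op₁_diffOne θ, 𝔇.op₂_diffOne θ⟩
  bracket_zero_zero s t := ⟨𝔇.symbol_commutator s t, 𝔇.op₀_commutator s t, 𝔇.op₁_commutator s t,
    𝔇.op₂_commutator s t⟩
  bracket_zero_one s θ := by
    refine ⟨fun e => (𝔇.map₀₁_bracketOne s 0 0 θ e).trans ?_,
      fun e => (𝔇.map₁₂_bracketOne s 0 0 θ e).trans ?_⟩
    · simp only [map₀₁_zero_left, map_zero, sub_zero]
    · simp only [map₁₂_zero_left, map_zero, sub_zero]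
  bracket_zero_two s θ e := by
    refine (𝔇.map₀₂_bracketTwo (𝔇.in₀ s) (𝔇.in₂ θ) e).trans ?_
    change 𝔇.op₂ s (map₀₂ θ e) - map₀₂ θ (𝔇.op₀ s e) - (𝔇.op₂ 0 (map₀₂ 0 e) - map₀₂ 0 (𝔇.op₀ 0 e)) +
      (map₁₂ 0 (map₀₁ 0 e) + map₁₂ 0 (map₀₁ 0 e)) = _
    simp only [map₀₂_zero_left, map₁₂_zero_left, map_zero, sub_zero, add_zero]
  bracket_one_one θ η e := by
    refine (𝔇.map₀₂_bracketTwo (𝔇.in₁ θ) (𝔇.in₁ η) e).trans ?_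
    change 𝔇.op₂ 0 (map₀₂ 0 e) - map₀₂ 0 (𝔇.op₀ 0 e) - (𝔇.op₂ 0 (map₀₂ 0 e) - map₀₂ 0 (𝔇.op₀ 0 e)) +
      (map₁₂ θ (map₀₁ η e) + map₁₂ η (map₀₁ θ e)) = _
    rw [sub_self, zero_add]

end DevPiBundle

end ThreeTermComplex

end

theorem mainTheorem12 {m : ℕ} {M : Type u} [TopologicalSpace M]
    [ChartedSpace (EuclideanSpace ℝ (Fin m)) M] [IsManifold (𝓡 m) ∞ M]
    [T2Space M] [SecondCountableTopology M]
    (𝓔 : ThreeTermComplex.{u, v} m M)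
    (hrank : ∃ r : ℕ, ∀ x : M, Module.finrank ℝ (𝓔.devPiFiber x) = r) :
    Nonempty 𝓔.DevPiBundle ∧
      ∀ 𝔇 : 𝓔.DevPiBundle, ∃ S : SplitLieAlgebroid 3 𝔇.graded, 𝔇.IsEndAlgebroid S := by
  obtain ⟨r, hr⟩ := hrank
  -- Constant rank produces the bundle; the algebroid is built from the identification `toCdo`,
  -- hence on every such bundle.
  exact ⟨⟨𝓔.devPiBundle hr⟩, fun 𝔇 => ⟨𝔇.endAlgebroid, 𝔇.isEndAlgebroid⟩⟩
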